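/- Let $\Lambda$ be a finite labelled graph, that is, a finite simple graph with vertex set $V$ in which every edge $e$ carries an integer label $\epsilon(e)\ge 2$; write $\epsilon(v,w)$ for the label of the edge $[v,w]$. The \emph{Artin group} $G^a_\Lambda$ has generators $g_v$ ($v\in V$) and one relation $$\underbrace{g_vg_wg_v\cdots}_{\epsilon(v,w)\text{ factors}}=\underbrace{g_wg_vg_w\cdots}_{\epsilon(v,w)\text{ factors}}$$ for each edge $[v,w]$. A \emph{real unipotent group} is a Zariski closed subgroup of some $GL_n(\mathbb R)$ consisting of unipotent matrices, with its Euclidean topology. A \emph{pro-unipotent group} is an inverse limit $P=\varprojlim U_i\subset\prod_i GL_{n_i}(\mathbb R)$ of a directed system of real unipotent groups and continuous homomorphisms, with the inverse limit topology. Its Lie algebra is $$\mathrm{Lie}(P)=\Big\{X\in\prod_i M_{n_i}(\mathbb R):\exp(tX)\in P\ \text{for all } t\in\mathbb R\Big\}$$ with the commutator bracket and the topology of the product. A \emph{Malcev completion} of a group $\Gamma$ is a homomorphism $\eta:\Gamma\to P$ to a pro-unipotent group such that for every real unipotent group $U$ and every homomorphism $\rho:\Gamma\to U$ there is a unique continuous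 homomorphism $\tilde\rho:P\to U$ with $\tilde\rho\circ\eta=\rho$; then $\mathcal L(\Gamma)=\mathrm{Lie}(P)$ is the \emph{real Malcev Lie algebra} of $\Gamma$. For a set $S$ of elements of the free real Lie algebra $L(H)$ on a vector space $H$ with a chosen basis, the \emph{pro-nilpotent Lie algebra presented by $S$} is $\varprojlim_k \mathfrak l/\gamma_k\mathfrak l$, where $\mathfrak l=L(H)/(S)$ is the quotient by the ideal generated by $S$ and $\gamma_k$ is the lower central series; it carries the inverse limit topology. An element of $L(H)$ is \emph{quadratic} if it is a nonzero linear combination of brackets $[u,v]$ with $u,v\in H$. The \emph{degree} of an element of $L(H)\subset T(H)$ is the highest degree of a monomial in its expansion in the tensor algebra $T(H)$. \textbf{Theorem.} Every Artin group $G^a_\Lambda$ as above has a Malcev completion, and for every Malcev completion $\eta:G^a_\Lambda\to P$ the following hold. 1. $\mathcal L(G^a_\Lambda)=\mathrm{Lie}(P)$ is isomorphic, as a topological Lie algebra, to the pro-nilpotent real Lie algebra with generators $X_v$ ($v\in V$) and relations $[X_v,X_w]=0$ for every edge $[v,w]$ with even label and $X_v=X_w$ for every edge $[v,w]$ with odd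 label. The isomorphism can be chosen so that $X_v$ corresponds to $\log\eta(g_v)$ for every $v\in V$. 2. $\mathcal L(G^a_\Lambda)$ is quadratically presented: it is isomorphic, as a topological Lie algebra, to the pro-nilpotent Lie algebra presented by a set of quadratic elements of $L(H)$ for some finite-dimensional real vector space $H$. 3. In particular $\mathcal L(G^a_\Lambda)$ satisfies the condition of Morgan's test: it is isomorphic, as a topological Lie algebra, to the pro-nilpotent Lie algebra presented by a set of elements of degrees $2\le d\le 4$ of $L(H)$ for some finite-dimensional real vector space $H$. -/

import Mathlib

open Filter Topology

/-! ## Artin groups -/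

/-- A labelled graph: a simple graph (no loops, no multiple edges) whose edges carry integer labels
`≥ 2`.  Values of `label` outside the edge set are irrelevant. -/
structure LabelledGraph (V : Type*) where
  graph : SimpleGraph V
  label : Sym2 V → ℕ
  two_le_label : ∀ e ∈ graph.edgeSet, 2 ≤ label e

/-- The alternating product `a * b * a * b * ⋯` with `n` factors. -/
def altProd {M : Type*} [Monoid M] (a b : M) : ℕ → M
  | 0 => 1
  | n + 1 => a * altProd b a n

namespace LabelledGraph

variable {V : Type*} (Λ : LabelledGraph V)

/-- The Artin relators, one for each (oriented) edge. -/
def artinRelators : Set (FreeGroup V) :=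
  {r | ∃ v w, Λ.graph.Adj v w ∧
    r = altProd (FreeGroup.of v) (FreeGroup.of w) (Λ.label s(v, w)) *
      (altProd (FreeGroup.of w) (FreeGroup.of v) (Λ.label s(v, w)))⁻¹}

/-- The Artin group of a labelled graph. -/
abbrev ArtinGroup : Type _ := PresentedGroup Λ.artinRelators

/-- The standard generator of the Artin group attached to a vertex. -/
def gen (v : V) : Λ.ArtinGroup := PresentedGroup.of v

/-- The relators `[X_v, X_w]` for the edges with even label, `X_v - X_w` for the edges with odd
label, in the free real Lie algebra on the vertices. -/
def lieRelators : Set (FreeLieAlgebra ℝ V) :=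
  {r | ∃ v w, Λ.graph.Adj v w ∧ Even (Λ.label s(v, w)) ∧
      r = ⁅FreeLieAlgebra.of ℝ v, FreeLieAlgebra.of ℝ w⁆} ∪
  {r | ∃ v w, Λ.graph.Adj v w ∧ Odd (Λ.label s(v, w)) ∧
      r = FreeLieAlgebra.of ℝ v - FreeLieAlgebra.of ℝ w}

end LabelledGraph

/-! ## Pro-nilpotent completions and presentations of Lie algebras -/

section Completion

variable (L : Type*) [LieRing L] [LieAlgebra ℝ L]

/-- The quotient of `L` by the `k`-th term of its lower central series (the term `0` is `L`). -/
def NilQuotient (k : ℕ) : Type _ := L ⧸ LieModule.lowerCentralSeries ℝ L L k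

noncomputable instance (k : ℕ) : LieRing (NilQuotient L k) :=
  inferInstanceAs (LieRing (L ⧸ LieModule.lowerCentralSeries ℝ L L k))

noncomputable instance (k : ℕ) : LieAlgebra ℝ (NilQuotient L k) :=
  inferInstanceAs (LieAlgebra ℝ (L ⧸ LieModule.lowerCentralSeries ℝ L L k))

/-- The canonical vector space topology (the usual one if the quotient is finite-dimensional). -/
noncomputable instance (k : ℕ) : TopologicalSpace (NilQuotient L k) := moduleTopology ℝ (NilQuotient L k)

/-- The quotient map. -/
noncomputable def NilQuotient.mk (k : ℕ) : L →ₗ⁅ℝ⁆ NilQuotient L k where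
  toFun x := LieSubmodule.Quotient.mk (N := LieModule.lowerCentralSeries ℝ L L k) x
  map_add' _ _ := rfl
  map_smul' _ _ := rfl
  map_lie' := rfl

/-- The product of all the quotients `L / γ_k L`, a Lie algebra with componentwise operations. -/
def NilProduct : Type _ := ∀ k : ℕ, NilQuotient L k

noncomputable instance : AddCommGroup (NilProduct L) :=
  inferInstanceAs (AddCommGroup (∀ k : ℕ, NilQuotient L k))

noncomputable instance : Module ℝ (NilProduct L) :=
  inferInstanceAs (Module ℝ (∀ k : ℕ, NilQuotient L k))

noncomputable instance : TopologicalSpace (NilProduct L) :=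
  inferInstanceAs (TopologicalSpace (∀ k : ℕ, NilQuotient L k))

noncomputable instance : LieRing (NilProduct L) where
  bracket x y := fun k => ⁅x k, y k⁆
  add_lie x y z := funext fun k => add_lie (x k) (y k) (z k)
  lie_add x y z := funext fun k => lie_add (x k) (y k) (z k)
  lie_self x := funext fun k => lie_self (x k)
  leibniz_lie x y z := funext fun k => leibniz_lie (x k) (y k) (z k)

noncomputable instance : LieAlgebra ℝ (NilProduct L) where
  lie_smul t x y := funext fun k => lie_smul t (x k) (y k)

/-- The pro-nilpotent completion `lim_k L / γ_k L`: the families of compatible residue classes. -/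
noncomputable def nilCompletion : LieSubalgebra ℝ (NilProduct L) where
  carrier := {x | ∀ k, ∃ y : L, ∀ j ≤ k, x j = NilQuotient.mk L j y}
  zero_mem' k := ⟨0, fun j _ => ((NilQuotient.mk L j).map_zero).symm⟩
  add_mem' {a b} ha hb k := by
    obtain ⟨y, hy⟩ := ha k
    obtain ⟨z, hz⟩ := hb k
    refine ⟨y + z, fun j hj => ?_⟩
    rw [map_add, ← hy j hj, ← hz j hj]
    rfl
  smul_mem' c a ha k := by
    obtain ⟨y, hy⟩ := ha k
    refine ⟨c • y, fun j hj => ?_⟩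
    rw [map_smul, ← hy j hj]
    rfl
  lie_mem' {a b} ha hb k := by
    obtain ⟨y, hy⟩ := ha k
    obtain ⟨z, hz⟩ := hb k
    refine ⟨⁅y, z⁆, fun j hj => ?_⟩
    rw [LieHom.map_lie, ← hy j hj, ← hz j hj]
    rfl

/-- The canonical map from a Lie algebra to its pro-nilpotent completion. -/
noncomputable def toNilCompletion (x : L) : nilCompletion L :=
  ⟨fun k => NilQuotient.mk L k x, fun _ => ⟨x, fun _ _ => rfl⟩⟩

end Completion

section Presentation

variable {X : Type*}

/-- The Lie algebra `⟨X | S⟩`: the free real Lie algebra on `X` modulo the ideal generated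
by `S`. -/
abbrev PresentedLie (S : Set (FreeLieAlgebra ℝ X)) : Type _ :=
  FreeLieAlgebra ℝ X ⧸ LieSubmodule.lieSpan ℝ (FreeLieAlgebra ℝ X) S

/-- The pro-nilpotent real Lie algebra presented by the generators `X` and the relators `S`. -/
abbrev PresentedProLie (S : Set (FreeLieAlgebra ℝ X)) : Type _ :=
  nilCompletion (PresentedLie S)

/-- The generator of the presented pro-nilpotent Lie algebra attached to `x`. -/
noncomputable def PresentedProLie.gen (S : Set (FreeLieAlgebra ℝ X)) (x : X) : PresentedProLie S :=
  toNilCompletion (PresentedLie S) (LieSubmodule.Quotient.mk (FreeLieAlgebra.of ℝ x))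

/-- The space `H` spanned by the free generators. -/
noncomputable def linearPart (X : Type*) : Submodule ℝ (FreeLieAlgebra ℝ X) :=
  Submodule.span ℝ (Set.range (FreeLieAlgebra.of ℝ))

/-- Quadratic elements: nonzero linear combinations of brackets of elements of `H`. -/
def IsQuadratic (u : FreeLieAlgebra ℝ X) : Prop :=
  u ≠ 0 ∧ u ∈ Submodule.span ℝ {z | ∃ a ∈ linearPart X, ∃ b ∈ linearPart X, z = ⁅a, b⁆}

section

attribute [local instance 100] LieRing.ofAssociativeRing

/-- The degree of an element `u` of the free Lie algebra: the highest degree of a monomial in the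
expansion of `u` as a noncommutative polynomial (an element of the tensor algebra). -/
noncomputable def lieDegree (u : FreeLieAlgebra ℝ X) : ℕ :=
  (FreeAlgebra.equivMonoidAlgebraFreeMonoid
    (FreeLieAlgebra.lift ℝ (FreeAlgebra.ι ℝ (X := X)) u)).coeff.support.sup FreeMonoid.length

end

end Presentation

section Predicates

variable (𝔤 : Type*) [LieRing 𝔤] [LieAlgebra ℝ 𝔤] [TopologicalSpace 𝔤]

/-- `𝔤` is (topologically isomorphic to) a pro-nilpotent Lie algebra with finitely many generators
and with quadratic relators. -/
def IsQuadraticallyPresented : Prop :=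
  ∃ (r : ℕ) (S : Set (FreeLieAlgebra ℝ (Fin r))), (∀ u ∈ S, IsQuadratic u) ∧
    ∃ e : PresentedProLie S ≃ₗ⁅ℝ⁆ 𝔤, Continuous e ∧ Continuous e.symm

/-- The condition on the Malcev Lie algebra in Morgan's test: `𝔤` is (topologically isomorphic to)
a pro-nilpotent Lie algebra with finitely many generators and with relators of degrees
`2 ≤ d ≤ 4`. -/
def PassesMorganTest : Prop :=
  ∃ (r : ℕ) (S : Set (FreeLieAlgebra ℝ (Fin r))), (∀ u ∈ S, 2 ≤ lieDegree u ∧ lieDegree u ≤ 4) ∧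
    ∃ e : PresentedProLie S ≃ₗ⁅ℝ⁆ 𝔤, Continuous e ∧ Continuous e.symm

end Predicates

/-! ## Auxiliary facts on the exponential map -/

section BanachAlgebra

variable {A : Type*} [NormedRing A] [NormedAlgebra ℝ A] [CompleteSpace A]

/-- If `γ` is a curve through `1` with velocity `B`, then `γ (1/n) ^ n` tends to `exp B`. -/
theorem tendsto_curve_pow (γ : ℝ → A) (B : A) (h0 : γ 0 = 1) (h : HasDerivAt γ B 0) :
    Tendsto (fun n : ℕ => γ ((n : ℝ)⁻¹) ^ n) atTop (𝓝 (NormedSpace.exp B)) := by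
  let _ : NormedAlgebra ℚ A := NormedAlgebra.restrictScalars ℚ ℝ A
  have hf : HasStrictFDerivAt (NormedSpace.exp : A → A)
      ((ContinuousLinearEquiv.refl ℝ A : A ≃L[ℝ] A) : A →L[ℝ] A) 0 :=
    hasStrictFDerivAt_exp_zero
  set g := hf.localInverse NormedSpace.exp _ 0 with hg
  have hg1 : HasStrictFDerivAt g (((ContinuousLinearEquiv.refl ℝ A).symm : A ≃L[ℝ] A) : A →L[ℝ] A)
      (NormedSpace.exp 0) := hf.to_localInverse
  have hg0 : g (NormedSpace.exp 0) = 0 := hf.localInverse_apply_image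
  have hr : ∀ᶠ y in 𝓝 (NormedSpace.exp (0 : A)), NormedSpace.exp (g y) = y :=
    hf.eventually_right_inverse
  rw [NormedSpace.exp_zero] at hg1 hg0 hr
  have hd : HasDerivAt (fun s => g (γ s)) B 0 := by
    have := (h0 ▸ hg1.hasFDerivAt : HasFDerivAt g _ (γ 0)).comp_hasDerivAt (0 : ℝ) h
    simpa [Function.comp_def] using this
  have hn : Tendsto (fun n : ℕ => (n : ℝ)⁻¹) atTop (𝓝[≠] 0) := by
    rw [tendsto_nhdsWithin_iff]
    refine ⟨tendsto_inv_atTop_nhds_zero_nat, ?_⟩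
    filter_upwards [eventually_gt_atTop 0] with n hn
    simp only [Set.mem_compl_iff, Set.mem_singleton_iff, inv_eq_zero]
    exact_mod_cast hn.ne'
  have hs : Tendsto (fun n : ℕ => (n : ℝ) • g (γ ((n : ℝ)⁻¹))) atTop (𝓝 B) := by
    have := hd.tendsto_slope_zero.comp hn
    simpa [Function.comp_def, h0, hg0] using this
  have he := ((NormedSpace.exp_continuous (𝔸 := A)).tendsto B).comp hs
  refine he.congr' ?_
  have hγ : Tendsto (fun n : ℕ => γ ((n : ℝ)⁻¹)) atTop (𝓝 1) := by
    have := h.continuousAt.tendsto.comp (hn.mono_right nhdsWithin_le_nhds)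
    rwa [h0] at this
  filter_upwards [hγ.eventually hr] with n hn
  simp only [Function.comp_apply]
  rw [Nat.cast_smul_eq_nsmul, NormedSpace.exp_nsmul, hn]

theorem banach_product_formula (X Y : A) :
    Tendsto (fun n : ℕ => (NormedSpace.exp ((n : ℝ)⁻¹ • X) * NormedSpace.exp ((n : ℝ)⁻¹ • Y)) ^ n)
      atTop (𝓝 (NormedSpace.exp (X + Y))) := by
  refine tendsto_curve_pow (fun s => NormedSpace.exp (s • X) * NormedSpace.exp (s • Y)) _ ?_ ?_
  · simp
  · have := (hasDerivAt_exp_smul_const (𝕂 := ℝ) X 0).mul (hasDerivAt_exp_smul_const (𝕂 := ℝ) Y 0)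
    simpa [Pi.mul_def] using this

theorem banach_bracket_formula (X Y : A) :
    Tendsto (fun n : ℕ => (n : ℝ) • (NormedSpace.exp ((n : ℝ)⁻¹ • X) * Y *
      NormedSpace.exp ((n : ℝ)⁻¹ • -X) - Y)) atTop (𝓝 (X * Y - Y * X)) := by
  have hn : Tendsto (fun n : ℕ => (n : ℝ)⁻¹) atTop (𝓝[≠] 0) := by
    rw [tendsto_nhdsWithin_iff]
    refine ⟨tendsto_inv_atTop_nhds_zero_nat, ?_⟩
    filter_upwards [eventually_gt_atTop 0] with n hn
    simp only [Set.mem_compl_iff, Set.mem_singleton_iff, inv_eq_zero]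
    exact_mod_cast hn.ne'
  have hd := ((hasDerivAt_exp_smul_const (𝕂 := ℝ) X 0).mul_const Y).mul
    (hasDerivAt_exp_smul_const (𝕂 := ℝ) (-X) 0)
  have := hd.tendsto_slope_zero.comp hn
  simpa [Function.comp_def, sub_eq_add_neg] using this

theorem banach_exp_continuous : Continuous (NormedSpace.exp : A → A) := by
  let _ : NormedAlgebra ℚ A := NormedAlgebra.restrictScalars ℚ ℝ A
  exact NormedSpace.exp_continuous

theorem banach_tendsto_units {A : Type*} [NormedRing A] [CompleteSpace A] {g : ℕ → Aˣ} {h : Aˣ}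
    (H : Tendsto (fun m => (g m : A)) atTop (𝓝 (h : A))) : Tendsto g atTop (𝓝 h) :=
  (Units.isOpenEmbedding_val (R := A)).isEmbedding.tendsto_nhds_iff.2 H

end BanachAlgebra

section MatrixExp
variable {n : ℕ}

theorem matrix_product_formula (X Y : Matrix (Fin n) (Fin n) ℝ) :
    Tendsto (fun m : ℕ => (NormedSpace.exp ((m : ℝ)⁻¹ • X) * NormedSpace.exp ((m : ℝ)⁻¹ • Y)) ^ m)
      atTop (𝓝 (NormedSpace.exp (X + Y))) := by
  let _ : NormedRing (Matrix (Fin n) (Fin n) ℝ) := Matrix.linftyOpNormedRing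
  let _ : NormedAlgebra ℝ (Matrix (Fin n) (Fin n) ℝ) := Matrix.linftyOpNormedAlgebra
  exact banach_product_formula X Y

theorem matrix_bracket_formula (X Y : Matrix (Fin n) (Fin n) ℝ) :
    Tendsto (fun m : ℕ => (m : ℝ) • (NormedSpace.exp ((m : ℝ)⁻¹ • X) * Y *
      NormedSpace.exp ((m : ℝ)⁻¹ • -X) - Y)) atTop (𝓝 (X * Y - Y * X)) := by
  let _ : NormedRing (Matrix (Fin n) (Fin n) ℝ) := Matrix.linftyOpNormedRing
  let _ : NormedAlgebra ℝ (Matrix (Fin n) (Fin n) ℝ) := Matrix.linftyOpNormedAlgebra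
  exact banach_bracket_formula X Y

theorem matrix_exp_continuous :
    Continuous (NormedSpace.exp : Matrix (Fin n) (Fin n) ℝ → Matrix (Fin n) (Fin n) ℝ) := by
  let _ : NormedRing (Matrix (Fin n) (Fin n) ℝ) := Matrix.linftyOpNormedRing
  let _ : NormedAlgebra ℝ (Matrix (Fin n) (Fin n) ℝ) := Matrix.linftyOpNormedAlgebra
  exact banach_exp_continuous

theorem tendsto_gl_of_tendsto_matrix {g : ℕ → GL (Fin n) ℝ} {h : GL (Fin n) ℝ}
    (H : Tendsto (fun m => (g m : Matrix (Fin n) (Fin n) ℝ)) atTop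
      (𝓝 (h : Matrix (Fin n) (Fin n) ℝ))) : Tendsto g atTop (𝓝 h) := by
  let _ : NormedRing (Matrix (Fin n) (Fin n) ℝ) := Matrix.linftyOpNormedRing
  let _ : NormedAlgebra ℝ (Matrix (Fin n) (Fin n) ℝ) := Matrix.linftyOpNormedAlgebra
  exact banach_tendsto_units H
end MatrixExp

/-! ## Unipotent and pro-unipotent groups -/

/-- A real unipotent group: a Zariski closed subgroup of `GL_n(ℝ)` consisting of unipotent
matrices. -/
structure UnipotentGroup where
  n : ℕ
  toSubgroup : Subgroup (GL (Fin n) ℝ)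
  unipotent : ∀ g ∈ toSubgroup, IsNilpotent ((g : Matrix (Fin n) (Fin n) ℝ) - 1)
  zariskiClosed : ∃ I : Set (MvPolynomial (Fin n × Fin n) ℝ), ∀ g : GL (Fin n) ℝ,
    g ∈ toSubgroup ↔
      ∀ p ∈ I, MvPolynomial.eval (fun ij => (g : Matrix (Fin n) (Fin n) ℝ) ij.1 ij.2) p = 0

/-- The underlying Lie group of a unipotent group, with its group structure and its Euclidean
topology. -/
abbrev UnipotentGroup.Carrier (U : UnipotentGroup) : Type := U.toSubgroup

/-- A real pro-unipotent group, given as the inverse limit of a directed system of unipotent groups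
and continuous homomorphisms (for real unipotent groups a homomorphism is continuous if and only if
it is algebraic). -/
structure ProUnipotentGroup where
  ι : Type
  [preorder : Preorder ι]
  [directed : IsDirectedOrder ι]
  [nonempty : Nonempty ι]
  obj : ι → UnipotentGroup
  map : ∀ {i j : ι}, i ≤ j → (obj j).Carrier →* (obj i).Carrier
  continuous_map : ∀ {i j : ι} (h : i ≤ j), Continuous (map h)
  map_refl : ∀ (i : ι) (g : (obj i).Carrier), map (le_refl i) g = g
  map_map : ∀ {i j k : ι} (h : i ≤ j) (h' : j ≤ k) (g : (obj k).Carrier),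
    map h (map h' g) = map (h.trans h') g

attribute [instance] ProUnipotentGroup.preorder ProUnipotentGroup.directed
  ProUnipotentGroup.nonempty

namespace ProUnipotentGroup

variable (P : ProUnipotentGroup)

/-- The inverse limit, as a subgroup of the product. -/
def toSubgroup : Subgroup (∀ i, (P.obj i).Carrier) where
  carrier := {g | ∀ i j (h : i ≤ j), P.map h (g j) = g i}
  one_mem' i j h := (P.map h).map_one
  mul_mem' {a b} ha hb i j h := by
    rw [Pi.mul_apply, map_mul, ha i j h, hb i j h]; rfl
  inv_mem' {a} ha i j h := by
    rw [Pi.inv_apply, map_inv, ha i j h]; rfl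

/-- The underlying topological group of a pro-unipotent group. -/
abbrev Carrier : Type := P.toSubgroup

/-- The `i`-th coordinate of an element of a pro-unipotent group, as a matrix. -/
def coord (g : P.Carrier) (i : P.ι) : Matrix (Fin (P.obj i).n) (Fin (P.obj i).n) ℝ :=
  ((g.1 i).1 : Matrix (Fin (P.obj i).n) (Fin (P.obj i).n) ℝ)

/-- The product of matrix algebras that contains the group and its Lie algebra. -/
abbrev Ambient : Type := ∀ i : P.ι, Matrix (Fin (P.obj i).n) (Fin (P.obj i).n) ℝ

/-- `P.IsExp g X` says that `g = exp X`, coordinate by coordinate. -/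
def IsExp (g : P.Carrier) (X : P.Ambient) : Prop :=
  ∀ i, P.coord g i = NormedSpace.exp (X i)

/-- The group is closed in the product of matrix algebras, as far as invertible limits go. -/
theorem exists_of_tendsto (g : ℕ → P.Carrier) (M : P.Ambient) (hM : ∀ i, IsUnit (M i))
    (H : ∀ i, Tendsto (fun m => P.coord (g m) i) atTop (𝓝 (M i))) :
    ∃ x : P.Carrier, ∀ i, P.coord x i = M i := by
  choose u hu using hM
  have hG : ∀ i, Tendsto (fun m => ((g m).1 i).1) atTop (𝓝 (u i)) := fun i =>
    tendsto_gl_of_tendsto_matrix (by rw [hu i]; exact H i)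
  have hmem : ∀ i, u i ∈ (P.obj i).toSubgroup := by
    intro i
    obtain ⟨I, hI⟩ := (P.obj i).zariskiClosed
    rw [hI]
    intro p hp
    have hc : Continuous fun A : Matrix (Fin (P.obj i).n) (Fin (P.obj i).n) ℝ =>
        MvPolynomial.eval (fun ij : Fin (P.obj i).n × Fin (P.obj i).n => A ij.1 ij.2) p := by
      have h1 := MvPolynomial.continuous_eval p
      have h2 : Continuous fun A : Matrix (Fin (P.obj i).n) (Fin (P.obj i).n) ℝ =>
          (fun ij : Fin (P.obj i).n × Fin (P.obj i).n => A ij.1 ij.2) :=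
        continuous_pi fun ij => continuous_id.matrix_elem ij.1 ij.2
      exact h1.comp h2
    have h1 := (hc.tendsto (M i)).comp (H i)
    rw [hu i]
    refine tendsto_nhds_unique h1 (tendsto_const_nhds.congr fun m => ?_)
    exact ((hI _).1 ((g m).1 i).2 p hp).symm
  have hU : ∀ i, Tendsto (fun m => (g m).1 i) atTop
      (𝓝 (⟨u i, hmem i⟩ : (P.obj i).Carrier)) := fun i => tendsto_subtype_rng.2 (hG i)
  refine ⟨⟨fun i => ⟨u i, hmem i⟩, fun i j h => ?_⟩, fun i => hu i⟩
  refine tendsto_nhds_unique ((((P.continuous_map h).tendsto _).comp (hU j))) ?_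
  refine (hU i).congr fun m => ?_
  exact ((g m).2 i j h).symm

theorem coord_mul (g h : P.Carrier) (i : P.ι) : P.coord (g * h) i = P.coord g i * P.coord h i :=
  rfl

theorem coord_pow (g : P.Carrier) (m : ℕ) (i : P.ι) : P.coord (g ^ m) i = P.coord g i ^ m := by
  induction m with
  | zero => rw [pow_zero, pow_zero]; rfl
  | succ m ih => rw [pow_succ, pow_succ, coord_mul, ih]

theorem exists_isExp_add {X Y : P.Ambient} (hX : ∀ t : ℝ, ∃ g, P.IsExp g (t • X))
    (hY : ∀ t : ℝ, ∃ g, P.IsExp g (t • Y)) : ∃ g, P.IsExp g (X + Y) := by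
  choose a ha using hX
  choose b hb using hY
  refine P.exists_of_tendsto (fun m => (a (m : ℝ)⁻¹ * b (m : ℝ)⁻¹) ^ m) _
    (fun i => Matrix.isUnit_exp ((X + Y) i)) fun i => ?_
  simp only [coord_pow, coord_mul, ha _ i, hb _ i]
  exact matrix_product_formula (X i) (Y i)

section

attribute [local instance 100] LieRing.ofAssociativeRing

/-- The Lie algebra of a pro-unipotent group: the families of matrices `X` such that `exp (t X)`
belongs to the group for all real `t`, with the commutator bracket. -/
noncomputable def lieAlgebra : LieSubalgebra ℝ P.Ambient where
  carrier := {X | ∀ t : ℝ, ∃ g, P.IsExp g (t • X)}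
  zero_mem' t := ⟨1, fun i => by
    rw [smul_zero, Pi.zero_apply, NormedSpace.exp_zero]; rfl⟩
  add_mem' {X Y} hX hY t := by
    rw [smul_add]
    exact P.exists_isExp_add (fun s => by rw [smul_smul]; exact hX _)
      (fun s => by rw [smul_smul]; exact hY _)
  smul_mem' c X hX t := by
    rw [smul_smul]; exact hX _
  lie_mem' {X Y} hX hY t := by
    have hX' : ∀ s : ℝ, ∃ g, P.IsExp g (s • X) := hX
    have hY' : ∀ s : ℝ, ∃ g, P.IsExp g (s • Y) := hY
    choose a ha using hX'
    choose b hb using hY'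
    have key : ∀ m : ℕ, ∃ g, P.IsExp g (fun i => t • ((m : ℝ) •
        (NormedSpace.exp ((m : ℝ)⁻¹ • X i) * Y i * NormedSpace.exp ((m : ℝ)⁻¹ • -X i) - Y i))) := by
      intro m
      have hu : ∀ i, NormedSpace.exp ((m : ℝ)⁻¹ • -X i) = P.coord (a (m : ℝ)⁻¹)⁻¹ i := by
        intro i
        rw [smul_neg, Matrix.exp_neg]
        have h1 : NormedSpace.exp ((m : ℝ)⁻¹ • X i) = P.coord (a (m : ℝ)⁻¹) i := (ha _ i).symm
        rw [h1]
        exact (Matrix.coe_units_inv _).symm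
      have h1 : ∀ s : ℝ, ∃ g, P.IsExp g (s • (fun i => (t * m) •
          (P.coord (a (m : ℝ)⁻¹) i * Y i * P.coord (a (m : ℝ)⁻¹)⁻¹ i) : P.Ambient)) := by
        intro s
        refine ⟨a (m : ℝ)⁻¹ * b (s * (t * m)) * (a (m : ℝ)⁻¹)⁻¹, fun i => ?_⟩
        rw [coord_mul, coord_mul, hb _ i, Pi.smul_apply, Pi.smul_apply, smul_smul,
          ← smul_mul_assoc, ← mul_smul_comm]
        exact (Matrix.exp_units_conj ((a (m : ℝ)⁻¹).1 i).1 _).symm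
      have h2 : ∀ s : ℝ, ∃ g, P.IsExp g (s • (-(t * m)) • Y) := fun s => by
        rw [smul_smul]; exact ⟨_, hb _⟩
      obtain ⟨g, hg⟩ := P.exists_isExp_add h1 h2
      refine ⟨g, fun i => (hg i).trans ?_⟩
      have h3 : NormedSpace.exp ((m : ℝ)⁻¹ • X i) = P.coord (a (m : ℝ)⁻¹) i := (ha _ i).symm
      beta_reduce
      rw [hu i, h3, Pi.add_apply, Pi.smul_apply, smul_smul, smul_sub, neg_smul, sub_eq_add_neg]
    choose g hg using key
    refine P.exists_of_tendsto g _ (fun i => Matrix.isUnit_exp ((t • ⁅X, Y⁆) i)) fun i => ?_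
    simp only [hg _ i]
    exact (matrix_exp_continuous.tendsto _).comp
      ((matrix_bracket_formula (X i) (Y i)).const_smul t)

end

end ProUnipotentGroup

/-- `η : Γ → P` is the Malcev (real unipotent) completion of `Γ`: every homomorphism from `Γ` to a
real unipotent group lifts uniquely to a morphism, that is, a continuous homomorphism, from the
pro-unipotent group `P`. -/
def IsMalcevCompletion {Γ : Type*} [Group Γ] (P : ProUnipotentGroup) (η : Γ →* P.Carrier) : Prop :=
  ∀ (U : UnipotentGroup) (ρ : Γ →* U.Carrier),
    ∃! φ : P.Carrier →* U.Carrier, Continuous φ ∧ φ.comp η = ρ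

/-!
The proof constructs one Malcev completion explicitly and transports the result to every other one.

*Unipotent groups and their Lie algebras.* For nilpotent `X` and unipotent `g` the exponential and
the logarithm are polynomials inverse to each other (`exp_nilLog`, `nilLog_exp`). A linear space `F`
of nilpotent matrices closed under brackets exponentiates to a group. Instead of the
Baker-Campbell-Hausdorff formula, `nilLog_exp_mul_exp_mem` uses that the logarithmic derivative of
`(exp X exp (t Y)) ^ m` lies in `F` for all natural `m` and is a polynomial in `m`, whose linear
coefficient is the derivative of `log (exp X exp (t Y))`. Applied to the image of a Lie algebra in a
product of two matrix algebras, this shows that homomorphisms of Lie algebras integrate to the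
exponential groups (`exists_expGroup_hom`). Conversely, a continuous homomorphism of pro-unipotent
groups has a differential (`ProUnipotentGroup.differential`): it carries one-parameter groups to
one-parameter groups, it is additive by the product formula, and it preserves brackets, since these
are derivatives of the adjoint action. As the exponential map is bijective, a homomorphism is
determined by its differential.

*The completion.* Let `L` be the Lie algebra presented by the relators of the theorem. They are
homogeneous, so that `L` has a derivation `D` that fixes the generators. It acts on the `j`-th
graded piece of the lower central series as `j + 1`, and hence is injective on `L / γ_k`; therefore
`L / γ_k` acts faithfully and nilpotently on the finite-dimensional space `L / γ_k ⋊ ℝD`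
(`exists_faithful_nilpotent_rep`). The groups `exp (L / γ_k)` form an inverse system with limit
`limitGroup`, whose Lie algebra is the pro-nilpotent completion of `L` (`limitGroupLieEquiv`).

*The Artin relations.* In a unipotent group roots are unique. A relation of even length `2 m`,
that is, `(g h) ^ m = (h g) ^ m`, therefore says that `g h = h g`, or `[log g, log h] = 0`. If a
relation of odd length holds and `h - g` lies in the `s`-th power of a nilpotent algebra, then
expanding both sides to first order in `h - g` shows that it lies in the `(s + 1)`-st power, so that
`g = h` (`eq_of_altProd_eq_of_odd`). Consequently homomorphisms from the Artin group to a unipotent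
group `U` amount to homomorphisms from `L` to the Lie algebra of `U`, and the limit group has the
universal property (`LabelledGraph.exists_isMalcevCompletion_limitGroup`).

*Quadratic presentation.* The relations `X_v = X_w` identify the generators along the odd edges.
What remains are generators for the components of the odd edges and brackets of distinct generators
as relators, which have degree two (`LabelledGraph.exists_quadratic_presentation`).
-/

/-! ### Exponentials and logarithms of nilpotent elements -/

section NilpotentExpLog

/-- The logarithm `∑ (-1)^i (g-1)^(i+1) / (i+1)`, cut off after `K` terms: this is the full
logarithm as soon as `(g - 1) ^ K = 0`. -/
noncomputable def nilLog {A : Type*} [Ring A] [Algebra ℝ A] (K : ℕ) (g : A) : A :=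
  ∑ i ∈ Finset.range K, ((-1) ^ i / (i + 1) : ℝ) • (g - 1) ^ (i + 1)

theorem geom_sum_mul_of_pow_eq_zero {A : Type*} [Ring A] {g : A} {K : ℕ} (h : (g - 1) ^ K = 0) :
    (∑ i ∈ Finset.range K, (-(g - 1)) ^ i) * g = 1 := by
  have h1 := geom_sum_mul_neg (-(g - 1)) K
  rw [neg_pow (g - 1) K, h, mul_zero, sub_zero] at h1
  simpa using h1

section Algebra

variable {A : Type*} [Ring A] [Algebra ℝ A]

@[simp] theorem nilLog_one (K : ℕ) : nilLog K (1 : A) = 0 := by simp [nilLog]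

theorem commute_nilLog {g h : A} (K : ℕ) (hc : Commute h g) : Commute h (nilLog K g) :=
  Commute.sum_right _ _ _ fun _ _ =>
    ((hc.sub_right (Commute.one_right h)).pow_right _).smul_right _

theorem nilLog_pow_eq_zero {g : A} {K : ℕ} (h : (g - 1) ^ K = 0) : nilLog K g ^ K = 0 := by
  have h1 : nilLog K g =
      (g - 1) * ∑ i ∈ Finset.range K, ((-1) ^ i / (i + 1) : ℝ) • (g - 1) ^ i := by
    rw [nilLog, Finset.mul_sum]
    simp [pow_succ']
  have hc : Commute (g - 1) (∑ i ∈ Finset.range K, ((-1) ^ i / (i + 1) : ℝ) • (g - 1) ^ i) :=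
    Commute.sum_right _ _ _ fun i _ => ((Commute.refl _).pow_right i).smul_right _
  rw [h1, hc.mul_pow, h, zero_mul]

theorem map_nilLog {B : Type*} [Ring B] [Algebra ℝ B] (φ : A →ₐ[ℝ] B) (K : ℕ) (g : A) :
    φ (nilLog K g) = nilLog K (φ g) := by
  simp [nilLog]

end Algebra

variable {A : Type*} [NormedRing A] [NormedAlgebra ℝ A]

theorem exp_eq_sum_of_pow_eq_zero {X : A} {K : ℕ} (h : X ^ K = 0) :
    NormedSpace.exp X = ∑ i ∈ Finset.range K, ((i.factorial : ℝ)⁻¹) • X ^ i := by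
  rw [NormedSpace.exp_eq_tsum ℝ]
  refine tsum_eq_sum fun i hi => ?_
  rw [Finset.mem_range, not_lt] at hi
  rw [pow_eq_zero_of_le hi h, smul_zero]

theorem exp_sub_one_pow {X : A} {K : ℕ} (h : X ^ K = 0) : (NormedSpace.exp X - 1) ^ K = 0 := by
  cases K with
  | zero => simpa using h
  | succ K =>
    have h1 : NormedSpace.exp X - 1 =
        X * ∑ i ∈ Finset.range K, (((i + 1).factorial : ℝ)⁻¹) • X ^ i := by
      rw [exp_eq_sum_of_pow_eq_zero h, Finset.sum_range_succ', Finset.mul_sum]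
      simp [pow_succ']
    have hc : Commute X (∑ i ∈ Finset.range K, (((i + 1).factorial : ℝ)⁻¹) • X ^ i) :=
      Commute.sum_right _ _ _ fun i _ => ((Commute.refl X).pow_right i).smul_right _
    rw [h1, hc.mul_pow, h, zero_mul]

theorem exp_sub_one_mem {N : Submodule ℝ A} (hN : N * N ≤ N) {X : A} (hX : X ∈ N) {K : ℕ}
    (hK : X ^ K = 0) : NormedSpace.exp X - 1 ∈ N := by
  have hpow : ∀ i : ℕ, X ^ (i + 1) ∈ N := by
    intro i
    induction i with
    | zero => simpa using hX
    | succ i ih => rw [pow_succ]; exact hN (Submodule.mul_mem_mul ih hX)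
  rw [exp_eq_sum_of_pow_eq_zero (pow_eq_zero_of_le (Nat.le_succ K) hK), Finset.sum_range_succ']
  simp only [Nat.factorial_zero, Nat.cast_one, inv_one, pow_zero, one_smul, add_sub_cancel_right]
  exact Submodule.sum_mem _ fun i _ => N.smul_mem _ (hpow i)

theorem commute_exp_right {X Y : A} (h : Commute X Y) : Commute X (NormedSpace.exp Y) := by
  let _ : NormedAlgebra ℚ A := NormedAlgebra.restrictScalars ℚ ℝ A
  exact h.exp_right

theorem continuous_nilLog (K : ℕ) : Continuous (nilLog K : A → A) := by
  unfold nilLog; fun_prop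

theorem hasDerivAt_pow_of_commute {g : ℝ → A} {g' : A} {s : ℝ} (hg : HasDerivAt g g' s)
    (hc : Commute (g s) g') (i : ℕ) :
    HasDerivAt (fun t => g t ^ (i + 1)) ((i + 1 : ℝ) • (g s ^ i * g')) s := by
  induction i with
  | zero => simpa using hg
  | succ i ih =>
    have h1 := ih.mul hg
    refine (h1.congr_deriv ?_).congr_of_eventuallyEq
      (Filter.Eventually.of_forall fun t => by simp [pow_succ])
    rw [smul_mul_assoc, mul_assoc, ← hc.eq, ← mul_assoc, ← pow_succ]
    push_cast
    module

/-- The derivative of the logarithm along a curve that commutes with its velocity. -/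
theorem hasDerivAt_nilLog_of_commute {g : ℝ → A} {g' : A} {s : ℝ} (K : ℕ)
    (hg : HasDerivAt g g' s) (hc : Commute (g s) g') :
    HasDerivAt (fun t => nilLog K (g t)) ((∑ i ∈ Finset.range K, (-(g s - 1)) ^ i) * g') s := by
  have h1 : HasDerivAt (fun t => g t - 1) g' s := hg.sub_const 1
  have h2 : Commute (g s - 1) g' := hc.sub_left (Commute.one_left _)
  have h3 := HasDerivAt.fun_sum fun i (_ : i ∈ Finset.range K) =>
    (hasDerivAt_pow_of_commute h1 h2 i).const_smul ((-1) ^ i / (i + 1) : ℝ)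
  refine h3.congr_deriv ?_
  rw [Finset.sum_mul]
  refine Finset.sum_congr rfl fun i _ => ?_
  rw [smul_smul, div_mul_cancel₀ _ (by positivity), neg_pow (g s - 1) i, mul_assoc]
  rcases Nat.even_or_odd i with h | h <;> simp [h.neg_one_pow]

/-- The derivative of the exponential along a curve of nilpotent elements that commutes with its
velocity. -/
theorem hasDerivAt_exp_of_commute {l : ℝ → A} {l' : A} {s : ℝ} {K : ℕ} (hl : HasDerivAt l l' s)
    (hc : Commute (l s) l') (hK : ∀ t, l t ^ K = 0) :
    HasDerivAt (fun t => NormedSpace.exp (l t)) (NormedSpace.exp (l s) * l') s := by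
  have h0 : (fun t => NormedSpace.exp (l t)) = fun t =>
      (∑ i ∈ Finset.range K, (((i + 1).factorial : ℝ)⁻¹) • l t ^ (i + 1)) + 1 := by
    funext t
    rw [exp_eq_sum_of_pow_eq_zero (pow_eq_zero_of_le (Nat.le_succ K) (hK t)),
      Finset.sum_range_succ']
    simp
  rw [h0]
  have h3 := (HasDerivAt.fun_sum fun i (_ : i ∈ Finset.range K) =>
    (hasDerivAt_pow_of_commute hl hc i).const_smul (((i + 1).factorial : ℝ)⁻¹)).add_const (1 : A)
  refine h3.congr_deriv ?_
  rw [exp_eq_sum_of_pow_eq_zero (hK s), Finset.sum_mul]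
  refine Finset.sum_congr rfl fun i _ => ?_
  rw [smul_smul, smul_mul_assoc]
  congr 1
  rw [Nat.factorial_succ]
  have : (i.factorial : ℝ) ≠ 0 := by positivity
  have : (i + 1 : ℝ) ≠ 0 := by positivity
  push_cast
  field_simp

/-- Conjugation by `exp X` is `exp (ad X)`: it preserves every subspace that `ad X` preserves. -/
theorem exp_mul_mul_exp_neg_mem (F : Submodule ℝ A) {X w : A} {K : ℕ} (hX : X ^ K = 0)
    (hF : ∀ y ∈ F, X * y - y * X ∈ F) (hw : w ∈ F) :
    NormedSpace.exp X * w * NormedSpace.exp (-X) ∈ F := by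
  let _ : Algebra ℚ A := Algebra.compHom A (algebraMap ℚ ℝ)
  have hsm : ∀ (q : ℚ) (a : A), q • a = (q : ℝ) • a := fun _ _ => rfl
  -- `ad X` is the sum of the commuting operators `l` and `r`
  let l : Module.End ℝ A := LinearMap.mulLeft ℝ X
  let r : Module.End ℝ A := LinearMap.mulRight ℝ (-X)
  have hl : l ^ K = 0 := by
    rw [LinearMap.pow_mulLeft, hX]; ext; simp
  have hr : r ^ K = 0 := by
    rw [LinearMap.pow_mulRight, neg_pow, hX]; ext; simp
  have hlr : Commute l r := LinearMap.commute_mulLeft_right X (-X)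
  have hadd := IsNilpotent.exp_add_of_commute hlr ⟨K, hl⟩ ⟨K, hr⟩
  obtain ⟨N, hN⟩ := hlr.isNilpotent_add ⟨K, hl⟩ ⟨K, hr⟩
  rw [IsNilpotent.exp_eq_sum hl, IsNilpotent.exp_eq_sum hr, IsNilpotent.exp_eq_sum hN] at hadd
  have hpow : ∀ i : ℕ, ((l + r) ^ i) w ∈ F := by
    intro i
    induction i with
    | zero => simpa using hw
    | succ i ih =>
      rw [pow_succ', Module.End.mul_apply]
      simpa [l, r, sub_eq_add_neg] using hF _ ih
  have hX' : (-X) ^ K = 0 := by rw [neg_pow, hX, mul_zero]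
  have key : NormedSpace.exp X * w * NormedSpace.exp (-X) =
      (∑ i ∈ Finset.range N, ((i.factorial : ℚ)⁻¹) • (l + r) ^ i) w := by
    rw [hadd, exp_eq_sum_of_pow_eq_zero hX, exp_eq_sum_of_pow_eq_zero hX']
    simp [l, r, LinearMap.pow_mulLeft, LinearMap.pow_mulRight, Finset.sum_mul, Finset.mul_sum,
      Finset.smul_sum, hsm, mul_assoc]
  rw [key, LinearMap.sum_apply]
  refine Submodule.sum_mem _ fun i _ => ?_
  have : ((i.factorial : ℚ)⁻¹ • (l + r) ^ i) w = ((i.factorial : ℝ)⁻¹) • ((l + r) ^ i) w := by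
    simp [hsm]
  rw [this]
  exact F.smul_mem _ (hpow i)

variable [CompleteSpace A]

theorem exp_commute_add {X Y : A} (h : Commute X Y) :
    NormedSpace.exp (X + Y) = NormedSpace.exp X * NormedSpace.exp Y := by
  let _ : NormedAlgebra ℚ A := NormedAlgebra.restrictScalars ℚ ℝ A
  exact NormedSpace.exp_add_of_commute h

theorem exp_mul_exp_neg (X : A) : NormedSpace.exp X * NormedSpace.exp (-X) = 1 := by
  rw [← exp_commute_add (Commute.refl X).neg_right, add_neg_cancel, NormedSpace.exp_zero]

theorem exp_neg_mul_exp (X : A) : NormedSpace.exp (-X) * NormedSpace.exp X = 1 := by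
  rw [← exp_commute_add (Commute.refl X).neg_left, neg_add_cancel, NormedSpace.exp_zero]

theorem exp_natCast_smul (m : ℕ) (X : A) :
    NormedSpace.exp ((m : ℝ) • X) = NormedSpace.exp X ^ m := by
  let _ : NormedAlgebra ℚ A := NormedAlgebra.restrictScalars ℚ ℝ A
  rw [Nat.cast_smul_eq_nsmul, NormedSpace.exp_nsmul]

/-- The logarithm inverts the exponential: the derivative of `log (exp (s X)) - s X` vanishes. -/
theorem nilLog_exp {X : A} {K : ℕ} (h : X ^ K = 0) : nilLog K (NormedSpace.exp X) = X := by
  have hd : ∀ s : ℝ, HasDerivAt (fun s : ℝ => nilLog K (NormedSpace.exp (s • X)) - s • X) 0 s := by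
    intro s
    have h1 := hasDerivAt_exp_smul_const (𝕂 := ℝ) X s
    have hc : Commute (NormedSpace.exp (s • X)) (NormedSpace.exp (s • X) * X) :=
      (Commute.refl _).mul_right (commute_exp_right ((Commute.refl X).smul_right s)).symm
    have h2 := (hasDerivAt_nilLog_of_commute K h1 hc).sub ((hasDerivAt_id s).smul_const X)
    refine h2.congr_deriv ?_
    have h3 : (NormedSpace.exp (s • X) - 1) ^ K = 0 :=
      exp_sub_one_pow (by rw [smul_pow, h, smul_zero])
    rw [← mul_assoc, geom_sum_mul_of_pow_eq_zero h3]
    simp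
  have := is_const_of_deriv_eq_zero (𝕜 := ℝ) (fun s => (hd s).differentiableAt)
    (fun s => (hd s).deriv) 1 0
  simpa [sub_eq_zero] using this

/-- The exponential inverts the logarithm: `exp (-log g) g` is constant along a line of unipotent
elements. -/
theorem exp_nilLog {g : A} {K : ℕ} (h : (g - 1) ^ K = 0) : NormedSpace.exp (nilLog K g) = g := by
  set u := g - 1 with hu
  -- the curve `1 + s u` runs from `1` to `g`
  have hnil : ∀ s : ℝ, ((1 + s • u) - 1) ^ K = 0 := fun s => by
    rw [add_sub_cancel_left, smul_pow, h, smul_zero]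
  have hd : ∀ s : ℝ, HasDerivAt
      (fun s : ℝ => NormedSpace.exp (-nilLog K (1 + s • u)) * (1 + s • u)) 0 s := by
    intro s
    have h1 : HasDerivAt (fun s : ℝ => 1 + s • u) u s := by
      simpa using ((hasDerivAt_id s).smul_const u).const_add (1 : A)
    have hc : Commute (1 + s • u) u := (Commute.one_left u).add_left ((Commute.refl u).smul_left s)
    have hq : Commute (∑ i ∈ Finset.range K, (-((1 + s • u) - 1)) ^ i) u :=
      Commute.sum_left _ _ _ fun i _ =>
        ((hc.sub_left (Commute.one_left u)).neg_left.pow_left i)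
    have hql : Commute (nilLog K (1 + s • u)) (∑ i ∈ Finset.range K, (-((1 + s • u) - 1)) ^ i) :=
      Commute.sum_right _ _ _ fun i _ =>
        ((commute_nilLog K (Commute.refl _)).symm.sub_right
          (Commute.one_right _)).neg_right.pow_right i
    have hcl : Commute (nilLog K (1 + s • u))
        ((∑ i ∈ Finset.range K, (-((1 + s • u) - 1)) ^ i) * u) :=
      hql.mul_right (commute_nilLog K hc.symm).symm
    have h2 := hasDerivAt_exp_of_commute (K := K) (hasDerivAt_nilLog_of_commute K h1 hc).neg
      hcl.neg_left.neg_right (fun t => by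
        show (-nilLog K (1 + t • u)) ^ K = 0
        rw [neg_pow, nilLog_pow_eq_zero (hnil t), mul_zero])
    refine (h2.mul h1).congr_deriv ?_
    rw [mul_assoc, neg_mul, mul_assoc, ← hc.eq, ← mul_assoc (Finset.sum _ _),
      geom_sum_mul_of_pow_eq_zero (hnil s), one_mul]
    simp
  have h1 := is_const_of_deriv_eq_zero (𝕜 := ℝ) (fun s => (hd s).differentiableAt)
    (fun s => (hd s).deriv) 1 0
  have h2 : NormedSpace.exp (-nilLog K g) * g = 1 := by
    simpa [hu] using h1
  calc NormedSpace.exp (nilLog K g)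
      = NormedSpace.exp (nilLog K g) * (NormedSpace.exp (-nilLog K g) * g) := by rw [h2, mul_one]
    _ = g := by rw [← mul_assoc, exp_mul_exp_neg, one_mul]

/-- A polynomial whose values at the natural numbers lie in a subspace has all its coefficients
there. -/
theorem Polynomial.coeff_mem_of_eval_natCast_mem {B : Type*} [Ring B] [Algebra ℝ B]
    (F : Submodule ℝ B) (p : Polynomial B) (h : ∀ m : ℕ, p.eval (m : B) ∈ F) (i : ℕ) :
    p.coeff i ∈ F := by
  -- a linear form that vanishes on `F` turns `p` into a real polynomial with infinitely many zeros
  by_contra hi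
  obtain ⟨f, hf, hF⟩ := Submodule.exists_le_ker_of_notMem hi
  let q : Polynomial ℝ :=
    ∑ j ∈ Finset.range (p.natDegree + 1), Polynomial.monomial j (f (p.coeff j))
  have hq : ∀ m : ℕ, q.eval (m : ℝ) = 0 := fun m => by
    have h1 : f (p.eval (m : B)) = 0 := hF (h m)
    rw [← h1, Polynomial.eval_eq_sum_range (p := p), map_sum, Polynomial.eval_finsetSum]
    refine Finset.sum_congr rfl fun j _ => ?_
    rw [Polynomial.eval_monomial, ← Nat.cast_pow, ← Nat.cast_pow, ← nsmul_eq_mul' (p.coeff j),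
      map_nsmul, nsmul_eq_mul']
  have hq0 : q = 0 := by
    refine Polynomial.eq_of_infinite_eval_eq q 0 (Set.Infinite.mono ?_
      (Set.infinite_range_of_injective (Nat.cast_injective (R := ℝ))))
    rintro _ ⟨m, rfl⟩
    simp [hq m]
  have h2 : q.coeff i = f (p.coeff i) := by
    simp only [q, Polynomial.finsetSum_coeff, Polynomial.coeff_monomial, Finset.sum_ite_eq',
      Finset.mem_range]
    split_ifs with hlt
    · rfl
    · rw [Polynomial.coeff_eq_zero_of_natDegree_lt (by omega), map_zero]
  exact hf (by rw [← h2, hq0, Polynomial.coeff_zero])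

/-- A form of the Baker-Campbell-Hausdorff theorem, without the formula: if the commutators of
elements of `F` lie in `F`, then `log (exp X exp Y)` lies in `F` for `X, Y ∈ F`, as far as the
logarithm is a finite sum.  Put `a t = exp X exp (t Y)` and `z t = log (a t)`. For natural `m` the
logarithmic derivative `a⁻ᵐ (aᵐ)'` lies in `F`, and as `aᵐ = exp (m z)` it is a polynomial in `m`
whose linear coefficient is `z'`.  Hence `z' ∈ F`, and `z 0 = X ∈ F`. -/
theorem nilLog_exp_mul_exp_mem [FiniteDimensional ℝ A] (F : Submodule ℝ A)
    (hF : ∀ x ∈ F, ∀ y ∈ F, x * y - y * x ∈ F) {X Y : A} (hX : X ∈ F) (hY : Y ∈ F) {K : ℕ}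
    (hXK : X ^ K = 0) (hYK : Y ^ K = 0)
    (hK : ∀ t : ℝ, (NormedSpace.exp X * NormedSpace.exp (t • Y) - 1) ^ K = 0) :
    nilLog K (NormedSpace.exp X * NormedSpace.exp Y) ∈ F := by
  set a : ℝ → A := fun t => NormedSpace.exp X * NormedSpace.exp (t • Y) with ha
  set b : ℝ → A := fun t => NormedSpace.exp (-(t • Y)) * NormedSpace.exp (-X) with hb
  have hba : ∀ t, b t * a t = 1 := fun t => by
    rw [ha, hb]; beta_reduce
    rw [mul_assoc, ← mul_assoc (NormedSpace.exp (-X)), exp_neg_mul_exp, one_mul, exp_neg_mul_exp]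
  have hab : ∀ t, a t * b t = 1 := fun t => by
    rw [ha, hb]; beta_reduce
    rw [mul_assoc, ← mul_assoc (NormedSpace.exp (t • Y)), exp_mul_exp_neg, one_mul, exp_mul_exp_neg]
  have hconj : ∀ t, ∀ w ∈ F, b t * w * a t ∈ F := fun t w hw => by
    have h1 := exp_mul_mul_exp_neg_mem F (X := -X) (K := K) (by rw [neg_pow, hXK, mul_zero])
      (fun y hy => hF _ (F.neg_mem hX) _ hy) hw
    have h2 := exp_mul_mul_exp_neg_mem F (X := -(t • Y)) (K := K)
      (by rw [neg_pow, smul_pow, hYK, smul_zero, mul_zero])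
      (fun y hy => hF _ (F.neg_mem (F.smul_mem t hY)) _ hy) h1
    rw [neg_neg, neg_neg] at h2
    simpa only [ha, hb, mul_assoc] using h2
  have hda : ∀ t, HasDerivAt a (a t * Y) t := fun t => by
    have := (hasDerivAt_exp_smul_const (𝕂 := ℝ) Y t).const_mul (NormedSpace.exp X)
    simpa only [ha, mul_assoc] using this
  -- the logarithmic derivatives of the powers of `a` lie in `F`, by induction on the exponent
  have hpow : ∀ (t : ℝ) (m : ℕ), ∃ y ∈ F, HasDerivAt (fun s => a s ^ m) (a t ^ m * y) t := by
    intro t m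
    induction m with
    | zero => exact ⟨0, F.zero_mem, by simpa using hasDerivAt_const t (1 : A)⟩
    | succ m ih =>
      obtain ⟨y, hy, hd⟩ := ih
      refine ⟨b t * y * a t + Y, F.add_mem (hconj t y hy) hY, ?_⟩
      simp only [pow_succ]
      refine (hd.mul (hda t)).congr_deriv ?_
      rw [mul_add, mul_assoc (a t ^ m) (a t) (b t * y * a t), ← mul_assoc (a t), ← mul_assoc (a t),
        hab, one_mul]
      simp only [mul_assoc]
  have hzd : Differentiable ℝ fun t => nilLog K (a t) := fun t => by
    have : DifferentiableAt ℝ a t := (hda t).differentiableAt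
    unfold nilLog
    fun_prop
  have hzK : ∀ t, nilLog K (a t) ^ K = 0 := fun t => nilLog_pow_eq_zero (hK t)
  generalize hz : (fun t => nilLog K (a t)) = z at hzd
  have hzK' : ∀ t, z t ^ (K + 2) = 0 := fun t => by
    rw [← hz]; exact pow_eq_zero_of_le (by omega) (hzK t)
  have hexp : ∀ t (m : ℕ), a t ^ m = NormedSpace.exp ((m : ℝ) • z t) := fun t m => by
    rw [exp_natCast_smul, ← hz]
    exact congrArg (· ^ m) (exp_nilLog (hK t)).symm
  have hderiv : ∀ t, deriv z t ∈ F := by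
    intro t
    -- `p` and `q` are `exp (-m z t)` and the derivative of `exp (m z)` at `t`, as polynomials in
    -- `m`; with `K + 2` terms, both contain the coefficients of index `0` and `1`
    let w : ℕ → A := fun i => deriv (fun s => z s ^ i) t
    let p : Polynomial A := ∑ j ∈ Finset.range (K + 2),
      Polynomial.monomial j (((j.factorial : ℝ)⁻¹ * (-1) ^ j) • z t ^ j)
    let q : Polynomial A := ∑ i ∈ Finset.range (K + 2),
      Polynomial.monomial i ((i.factorial : ℝ)⁻¹ • w i)
    have hq : ∀ m : ℕ, HasDerivAt (fun s => a s ^ m) (q.eval (m : A)) t := by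
      intro m
      have h1 : (fun s => a s ^ m) = fun s => ∑ i ∈ Finset.range (K + 2),
          ((i.factorial : ℝ)⁻¹ * (m : ℝ) ^ i) • z s ^ i := by
        funext s
        rw [hexp, exp_eq_sum_of_pow_eq_zero (K := K + 2) (by rw [smul_pow, hzK', smul_zero])]
        simp only [smul_pow, smul_smul]
      rw [h1]
      refine (HasDerivAt.fun_sum fun i (_ : i ∈ Finset.range (K + 2)) =>
        ((hzd t).fun_pow i).hasDerivAt.const_smul
          ((i.factorial : ℝ)⁻¹ * (m : ℝ) ^ i)).congr_deriv ?_
      simp only [q, Polynomial.eval_finsetSum, Polynomial.eval_monomial]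
      refine Finset.sum_congr rfl fun i _ => ?_
      rw [← Nat.cast_pow (α := A), ← nsmul_eq_mul' (_ • w i), ← Nat.cast_smul_eq_nsmul ℝ, smul_smul,
        mul_comm, Nat.cast_pow]
    have hp : ∀ m : ℕ, b t ^ m = p.eval (m : A) := by
      intro m
      have h1 : b t ^ m = NormedSpace.exp (-((m : ℝ) • z t)) := by
        have h2 : b t ^ m * a t ^ m = 1 := by
          rw [← Commute.mul_pow ((hba t).trans (hab t).symm), hba, one_pow]
        calc b t ^ m = b t ^ m * (a t ^ m * NormedSpace.exp (-((m : ℝ) • z t))) := by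
              rw [hexp, exp_mul_exp_neg, mul_one]
          _ = _ := by rw [← mul_assoc, h2, one_mul]
      rw [h1, exp_eq_sum_of_pow_eq_zero (K := K + 2)
        (by rw [neg_pow, smul_pow, hzK', smul_zero, mul_zero])]
      simp only [p, Polynomial.eval_finsetSum, Polynomial.eval_monomial]
      refine Finset.sum_congr rfl fun i _ => ?_
      rw [← Nat.cast_pow (α := A), ← nsmul_eq_mul' (_ • z t ^ i), ← Nat.cast_smul_eq_nsmul ℝ,
        smul_smul, ← neg_smul,
        smul_pow, smul_smul, Nat.cast_pow, neg_pow]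
      congr 1
      ring
    have hmem : ∀ m : ℕ, (p * q).eval (m : A) ∈ F := by
      intro m
      have h1 : (p * q).eval (m : A) = p.eval (m : A) * q.eval (m : A) :=
        Polynomial.eval₂_mul_noncomm _ _ fun k => (Nat.cast_commute m _).symm
      obtain ⟨y, hy, hd⟩ := hpow t m
      rw [h1, ← hp, (hq m).unique hd, ← mul_assoc,
        ← Commute.mul_pow ((hba t).trans (hab t).symm), hba, one_pow, one_mul]
      exact hy
    have hc := Polynomial.coeff_mem_of_eval_natCast_mem F _ hmem 1
    have hp0 : p.coeff 0 = 1 := by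
      simp [p, Polynomial.finsetSum_coeff, Polynomial.coeff_monomial]
    have hq0 : q.coeff 0 = 0 := by
      simp [q, w, Polynomial.finsetSum_coeff, Polynomial.coeff_monomial]
    have hq1 : q.coeff 1 = deriv z t := by
      simp [q, w, Polynomial.finsetSum_coeff, Polynomial.coeff_monomial]
    rwa [Polynomial.mul_coeff_one, hp0, hq0, hq1, one_mul, mul_zero, add_zero] at hc
  -- a linear form that vanishes on `F` is constant along `z`
  by_contra hn
  obtain ⟨f, hf, hfF⟩ := Submodule.exists_le_ker_of_notMem hn
  let fc : A →L[ℝ] ℝ := LinearMap.toContinuousLinearMap f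
  have hfd : ∀ t, HasDerivAt (fun s => fc (z s)) 0 t := fun t => by
    have h1 := fc.hasFDerivAt.comp_hasDerivAt t (hzd t).hasDerivAt
    refine h1.congr_deriv ?_
    exact hfF (hderiv t)
  have h1 := is_const_of_deriv_eq_zero (𝕜 := ℝ) (fun s => (hfd s).differentiableAt)
    (fun s => (hfd s).deriv) 1 0
  have hz1 : z 1 = nilLog K (NormedSpace.exp X * NormedSpace.exp Y) := by
    rw [← hz]; simp [ha]
  have hz0 : z 0 = X := by
    rw [← hz]; simp [ha, nilLog_exp hXK]
  rw [hz1, hz0] at h1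
  exact hf (h1.trans (hfF hX))

end NilpotentExpLog

/-! ### Unipotent matrices -/

section MatrixLog

variable {n : ℕ}

theorem Matrix.pow_eq_zero_of_isNilpotent {X : Matrix (Fin n) (Fin n) ℝ} (h : IsNilpotent X) :
    X ^ n = 0 := by
  have h1 : IsNilpotent (Matrix.toLin' X) := (Matrix.isNilpotent_toLin'_iff X).2 h
  have h2 := LinearMap.aeval_self_charpoly (Matrix.toLin' X)
  rw [h1.charpoly_eq_X_pow_finrank] at h2
  simp only [Module.finrank_fintype_fun_eq_card, Fintype.card_fin, map_pow,
    Polynomial.aeval_X] at h2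
  rw [← Matrix.toLin'_pow] at h2
  exact (LinearEquiv.map_eq_zero_iff _).1 h2

/-- The logarithm of a unipotent matrix. -/
noncomputable def matLog (g : Matrix (Fin n) (Fin n) ℝ) : Matrix (Fin n) (Fin n) ℝ := nilLog n g

theorem exp_matLog {g : Matrix (Fin n) (Fin n) ℝ} (h : IsNilpotent (g - 1)) :
    NormedSpace.exp (matLog g) = g := by
  let _ : NormedRing (Matrix (Fin n) (Fin n) ℝ) := Matrix.linftyOpNormedRing
  let _ : NormedAlgebra ℝ (Matrix (Fin n) (Fin n) ℝ) := Matrix.linftyOpNormedAlgebra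
  exact exp_nilLog (Matrix.pow_eq_zero_of_isNilpotent h)

theorem matLog_exp {X : Matrix (Fin n) (Fin n) ℝ} (h : IsNilpotent X) :
    matLog (NormedSpace.exp X) = X := by
  let _ : NormedRing (Matrix (Fin n) (Fin n) ℝ) := Matrix.linftyOpNormedRing
  let _ : NormedAlgebra ℝ (Matrix (Fin n) (Fin n) ℝ) := Matrix.linftyOpNormedAlgebra
  exact nilLog_exp (Matrix.pow_eq_zero_of_isNilpotent h)

theorem isNilpotent_matLog {g : Matrix (Fin n) (Fin n) ℝ} (h : IsNilpotent (g - 1)) :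
    IsNilpotent (matLog g) := by
  let _ : NormedRing (Matrix (Fin n) (Fin n) ℝ) := Matrix.linftyOpNormedRing
  let _ : NormedAlgebra ℝ (Matrix (Fin n) (Fin n) ℝ) := Matrix.linftyOpNormedAlgebra
  exact ⟨n, nilLog_pow_eq_zero (Matrix.pow_eq_zero_of_isNilpotent h)⟩

theorem isNilpotent_exp_sub_one {X : Matrix (Fin n) (Fin n) ℝ} (h : IsNilpotent X) :
    IsNilpotent (NormedSpace.exp X - 1) := by
  let _ : NormedRing (Matrix (Fin n) (Fin n) ℝ) := Matrix.linftyOpNormedRing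
  let _ : NormedAlgebra ℝ (Matrix (Fin n) (Fin n) ℝ) := Matrix.linftyOpNormedAlgebra
  exact ⟨n, exp_sub_one_pow (Matrix.pow_eq_zero_of_isNilpotent h)⟩

theorem continuous_matLog :
    Continuous (matLog : Matrix (Fin n) (Fin n) ℝ → Matrix (Fin n) (Fin n) ℝ) := by
  let _ : NormedRing (Matrix (Fin n) (Fin n) ℝ) := Matrix.linftyOpNormedRing
  let _ : NormedAlgebra ℝ (Matrix (Fin n) (Fin n) ℝ) := Matrix.linftyOpNormedAlgebra
  exact continuous_nilLog n

theorem commute_matLog {g h : Matrix (Fin n) (Fin n) ℝ} (hc : Commute g h) :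
    Commute (matLog g) (matLog h) := by
  let _ : NormedRing (Matrix (Fin n) (Fin n) ℝ) := Matrix.linftyOpNormedRing
  let _ : NormedAlgebra ℝ (Matrix (Fin n) (Fin n) ℝ) := Matrix.linftyOpNormedAlgebra
  exact commute_nilLog n (commute_nilLog n hc.symm).symm

theorem matrix_exp_eq_sum {X : Matrix (Fin n) (Fin n) ℝ} (h : IsNilpotent X) :
    NormedSpace.exp X = ∑ i ∈ Finset.range n, ((i.factorial : ℝ)⁻¹) • X ^ i := by
  let _ : NormedRing (Matrix (Fin n) (Fin n) ℝ) := Matrix.linftyOpNormedRing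
  let _ : NormedAlgebra ℝ (Matrix (Fin n) (Fin n) ℝ) := Matrix.linftyOpNormedAlgebra
  exact exp_eq_sum_of_pow_eq_zero (Matrix.pow_eq_zero_of_isNilpotent h)

theorem matrix_exp_sub_one_mem {N : Submodule ℝ (Matrix (Fin n) (Fin n) ℝ)} (hN : N * N ≤ N)
    {X : Matrix (Fin n) (Fin n) ℝ} (hX : X ∈ N) (h : IsNilpotent X) :
    NormedSpace.exp X - 1 ∈ N := by
  let _ : NormedRing (Matrix (Fin n) (Fin n) ℝ) := Matrix.linftyOpNormedRing
  let _ : NormedAlgebra ℝ (Matrix (Fin n) (Fin n) ℝ) := Matrix.linftyOpNormedAlgebra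
  exact exp_sub_one_mem hN hX (Matrix.pow_eq_zero_of_isNilpotent h)

theorem matrix_exp_natCast_smul (m : ℕ) (X : Matrix (Fin n) (Fin n) ℝ) :
    NormedSpace.exp ((m : ℝ) • X) = NormedSpace.exp X ^ m := by
  rw [Nat.cast_smul_eq_nsmul, Matrix.exp_nsmul]

theorem matrix_exp_add_smul (s t : ℝ) (X : Matrix (Fin n) (Fin n) ℝ) :
    NormedSpace.exp ((s + t) • X) = NormedSpace.exp (s • X) * NormedSpace.exp (t • X) := by
  rw [add_smul, Matrix.exp_add_of_commute]
  exact ((Commute.refl X).smul_left s).smul_right t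

theorem IsNilpotent.real_smul {X : Matrix (Fin n) (Fin n) ℝ} (h : IsNilpotent X) (t : ℝ) :
    IsNilpotent (t • X) := h.smul t

theorem eq_of_exp_eq {X Y : Matrix (Fin n) (Fin n) ℝ} (hX : IsNilpotent X) (hY : IsNilpotent Y)
    (h : NormedSpace.exp X = NormedSpace.exp Y) : X = Y := by
  rw [← matLog_exp hX, h, matLog_exp hY]

/-- Roots of unipotent matrices are unique. -/
theorem eq_of_pow_eq_of_unipotent {g h : Matrix (Fin n) (Fin n) ℝ} (hg : IsNilpotent (g - 1))
    (hh : IsNilpotent (h - 1)) {m : ℕ} (hm : m ≠ 0) (he : g ^ m = h ^ m) : g = h := by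
  have h1 : (m : ℝ) • matLog g = (m : ℝ) • matLog h := by
    refine eq_of_exp_eq ((isNilpotent_matLog hg).real_smul _)
      ((isNilpotent_matLog hh).real_smul _) ?_
    rw [matrix_exp_natCast_smul, matrix_exp_natCast_smul, exp_matLog hg, exp_matLog hh, he]
  have h2 : matLog g = matLog h :=
    smul_right_injective _ (Nat.cast_ne_zero.2 hm : (m : ℝ) ≠ 0) h1
  rw [← exp_matLog hg, h2, exp_matLog hh]

/-- A continuous one-parameter group of unipotent matrices is `t ↦ exp (t X)`: its logarithm is
additive and continuous, hence linear. -/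
theorem oneParameter_eq_exp (γ : ℝ → Matrix (Fin n) (Fin n) ℝ) (hc : Continuous γ)
    (hadd : ∀ s t, γ (s + t) = γ s * γ t) (hu : ∀ t, IsNilpotent (γ t - 1)) (t : ℝ) :
    γ t = NormedSpace.exp (t • matLog (γ 1)) := by
  have hlog : ∀ s t, matLog (γ (s + t)) = matLog (γ s) + matLog (γ t) := fun s t => by
    have hcomm : Commute (matLog (γ s)) (matLog (γ t)) :=
      commute_matLog (by rw [commute_iff_eq, ← hadd, ← hadd, add_comm])
    have h1 := Matrix.exp_add_of_commute _ _ hcomm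
    rw [exp_matLog (hu s), exp_matLog (hu t), ← hadd] at h1
    rw [← h1]
    exact matLog_exp
      (hcomm.isNilpotent_add (isNilpotent_matLog (hu s)) (isNilpotent_matLog (hu t)))
  let f : ℝ →+ Matrix (Fin n) (Fin n) ℝ := AddMonoidHom.mk' (fun t => matLog (γ t)) hlog
  have h2 := map_real_smul f (continuous_matLog.comp hc) t 1
  have h3 : matLog (γ t) = t • matLog (γ 1) := by simpa [f] using h2
  rw [← h3, exp_matLog (hu t)]

theorem continuous_exp_smul (X : Matrix (Fin n) (Fin n) ℝ) :
    Continuous fun t : ℝ => NormedSpace.exp (t • X) :=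
  matrix_exp_continuous.comp (continuous_id.smul continuous_const)

/-- A matrix is the logarithm of its exponential, hence nilpotent, if its one-parameter group is
unipotent. -/
theorem eq_matLog_of_unipotent_exp {X : Matrix (Fin n) (Fin n) ℝ}
    (h : ∀ t : ℝ, IsNilpotent (NormedSpace.exp (t • X) - 1)) :
    X = matLog (NormedSpace.exp X) := by
  have h1 := oneParameter_eq_exp (fun t : ℝ => NormedSpace.exp (t • X)) (continuous_exp_smul X)
    (fun s t => matrix_exp_add_smul s t X) h
  simp only [one_smul] at h1
  generalize matLog (NormedSpace.exp X) = Y at h1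
  let _ : NormedRing (Matrix (Fin n) (Fin n) ℝ) := Matrix.linftyOpNormedRing
  let _ : NormedAlgebra ℝ (Matrix (Fin n) (Fin n) ℝ) := Matrix.linftyOpNormedAlgebra
  have hX := hasDerivAt_exp_smul_const (𝕂 := ℝ) X 0
  have hY := hasDerivAt_exp_smul_const (𝕂 := ℝ) Y 0
  have h2 : HasDerivAt (fun u : ℝ => NormedSpace.exp (u • X))
      (NormedSpace.exp ((0 : ℝ) • Y) * Y) 0 :=
    hY.congr_of_eventuallyEq (Filter.Eventually.of_forall h1)
  have h3 := hX.unique h2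
  simpa using h3

/-- If all natural powers of the unipotent matrix `exp X` lie in an algebraic group, then so does
the one-parameter group through it. -/
theorem UnipotentGroup.exp_smul_mem (U : UnipotentGroup) {X : Matrix (Fin U.n) (Fin U.n) ℝ}
    (hX : IsNilpotent X) (g : U.Carrier)
    (hg : (g.1 : Matrix (Fin U.n) (Fin U.n) ℝ) = NormedSpace.exp X) (t : ℝ) :
    ∃ u : U.Carrier, (u.1 : Matrix (Fin U.n) (Fin U.n) ℝ) = NormedSpace.exp (t • X) := by
  obtain ⟨I, hI⟩ := U.zariskiClosed
  let w : GL (Fin U.n) ℝ := (Matrix.isUnit_exp (t • X)).unit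
  have hw : (w : Matrix (Fin U.n) (Fin U.n) ℝ) = NormedSpace.exp (t • X) := IsUnit.unit_spec _
  refine ⟨⟨w, (hI w).2 fun p hp => ?_⟩, hw⟩
  -- the entries of `exp (s X)` are polynomials in `s`, so that the equations of `U` become real
  -- polynomials in `s` that vanish at the natural numbers
  let e : Fin U.n × Fin U.n → Polynomial ℝ := fun ij => ∑ i ∈ Finset.range U.n,
    Polynomial.monomial i (((i.factorial : ℝ)⁻¹) * (X ^ i) ij.1 ij.2)
  have he : ∀ (s : ℝ) ij, (e ij).eval s = (NormedSpace.exp (s • X)) ij.1 ij.2 := by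
    intro s ij
    rw [matrix_exp_eq_sum (hX.real_smul s), Matrix.sum_apply, Polynomial.eval_finsetSum]
    refine Finset.sum_congr rfl fun i _ => ?_
    simp [smul_pow]; ring
  have heval : ∀ s : ℝ, (MvPolynomial.aeval e p).eval s =
      MvPolynomial.eval (fun ij => (NormedSpace.exp (s • X)) ij.1 ij.2) p := by
    intro s
    have h1 := MvPolynomial.comp_aeval_apply (R := ℝ) e
      (Polynomial.aeval s : Polynomial ℝ →ₐ[ℝ] ℝ) p
    rw [Polynomial.coe_aeval_eq_eval] at h1
    rw [h1, MvPolynomial.aeval_eq_eval]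
    congr 2
    funext ij
    simp [he]
  have hzero : MvPolynomial.aeval e p = 0 := by
    refine Polynomial.eq_of_infinite_eval_eq _ 0 (Set.Infinite.mono ?_
      (Set.infinite_range_of_injective (Nat.cast_injective (R := ℝ))))
    rintro _ ⟨m, rfl⟩
    have h1 := (hI (g ^ m).1).1 (g ^ m).2 p hp
    have h2 : (((g ^ m).1 : GL (Fin U.n) ℝ) : Matrix (Fin U.n) (Fin U.n) ℝ) =
        NormedSpace.exp ((m : ℝ) • X) := by
      rw [matrix_exp_natCast_smul, ← hg]; simp
    rw [h2] at h1
    simp [heval, h1]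
  rw [hw, ← heval, hzero, Polynomial.eval_zero]

end MatrixLog

/-! ### The exponential map of a pro-unipotent group -/

theorem Matrix.isEmbedding_GL_val (n : ℕ) :
    IsEmbedding (fun g : GL (Fin n) ℝ => (g : Matrix (Fin n) (Fin n) ℝ)) := by
  let _ : NormedRing (Matrix (Fin n) (Fin n) ℝ) := Matrix.linftyOpNormedRing
  let _ : NormedAlgebra ℝ (Matrix (Fin n) (Fin n) ℝ) := Matrix.linftyOpNormedAlgebra
  exact (Units.isOpenEmbedding_val (R := Matrix (Fin n) (Fin n) ℝ)).isEmbedding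

/-- An element of a unipotent group, as a matrix. -/
abbrev UnipotentGroup.mat {U : UnipotentGroup} (g : U.Carrier) : Matrix (Fin U.n) (Fin U.n) ℝ :=
  (g.1 : Matrix (Fin U.n) (Fin U.n) ℝ)

theorem UnipotentGroup.isEmbedding_val (U : UnipotentGroup) :
    IsEmbedding (UnipotentGroup.mat : U.Carrier → _) :=
  (Matrix.isEmbedding_GL_val U.n).comp IsEmbedding.subtypeVal

namespace ProUnipotentGroup

variable (P Q R : ProUnipotentGroup)

theorem isEmbedding_coord : IsEmbedding (P.coord : P.Carrier → P.Ambient) :=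
  (IsEmbedding.piMap fun i => (P.obj i).isEmbedding_val).comp IsEmbedding.subtypeVal

variable {P Q R}

theorem isNilpotent_coord_sub_one (g : P.Carrier) (i : P.ι) : IsNilpotent (P.coord g i - 1) :=
  (P.obj i).unipotent _ (g.1 i).2

theorem ext_coord {g h : P.Carrier} (H : ∀ i, P.coord g i = P.coord h i) : g = h :=
  P.isEmbedding_coord.injective (funext H)

theorem continuous_coord (i : P.ι) : Continuous fun g : P.Carrier => P.coord g i :=
  (continuous_apply i).comp P.isEmbedding_coord.continuous

theorem continuous_of_coord {T : Type*} [TopologicalSpace T] {f : T → P.Carrier}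
    (h : ∀ i, Continuous fun t => P.coord (f t) i) : Continuous f :=
  P.isEmbedding_coord.continuous_iff.2 (continuous_pi h)

theorem tendsto_of_coord {T : Type*} {l : Filter T} {f : T → P.Carrier} {g : P.Carrier}
    (h : ∀ i, Tendsto (fun t => P.coord (f t) i) l (𝓝 (P.coord g i))) : Tendsto f l (𝓝 g) :=
  P.isEmbedding_coord.tendsto_nhds_iff.2 (tendsto_pi_nhds.2 h)

theorem IsExp.unique {g h : P.Carrier} {X : P.Ambient} (hg : P.IsExp g X) (hh : P.IsExp h X) :
    g = h := ext_coord fun i => (hg i).trans (hh i).symm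

attribute [local instance 100] LieRing.ofAssociativeRing

/-- The exponential map of a pro-unipotent group. -/
noncomputable def exp (X : P.lieAlgebra) : P.Carrier :=
  (show ∃ g, P.IsExp g (X : P.Ambient) by simpa using X.2 1).choose

theorem isExp_exp (X : P.lieAlgebra) : P.IsExp (exp X) X :=
  (show ∃ g, P.IsExp g (X : P.Ambient) by simpa using X.2 1).choose_spec

theorem exp_eq_iff {X : P.lieAlgebra} {g : P.Carrier} : exp X = g ↔ P.IsExp g X :=
  ⟨fun h => h ▸ isExp_exp X, fun h => (isExp_exp X).unique h⟩

theorem coord_exp (X : P.lieAlgebra) (i : P.ι) :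
    P.coord (exp X) i = NormedSpace.exp ((X : P.Ambient) i) := isExp_exp X i

theorem coord_exp_smul (t : ℝ) (X : P.lieAlgebra) (i : P.ι) :
    P.coord (exp (t • X)) i = NormedSpace.exp (t • (X : P.Ambient) i) := isExp_exp _ i

theorem exp_add_smul (s t : ℝ) (X : P.lieAlgebra) :
    exp ((s + t) • X) = exp (s • X) * exp (t • X) :=
  ext_coord fun i => by
    rw [coord_mul, coord_exp_smul, coord_exp_smul, coord_exp_smul, matrix_exp_add_smul]

theorem lieAlgebra_eq_matLog (X : P.lieAlgebra) (i : P.ι) :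
    (X : P.Ambient) i = matLog (P.coord (exp X) i) := by
  rw [coord_exp]
  refine eq_matLog_of_unipotent_exp fun t => ?_
  rw [← coord_exp_smul]
  exact isNilpotent_coord_sub_one _ i

theorem isNilpotent_lieAlgebra (X : P.lieAlgebra) (i : P.ι) :
    IsNilpotent ((X : P.Ambient) i) := by
  rw [lieAlgebra_eq_matLog]
  exact isNilpotent_matLog (isNilpotent_coord_sub_one _ i)

/-- The coordinatewise logarithm lies in the Lie algebra: each component of `exp (t log g)` lies in
the algebraic group in question, and the transition maps carry one-parameter groups to one-parameter
groups. -/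
theorem matLog_mem_lieAlgebra (g : P.Carrier) :
    (fun i => matLog (P.coord g i) : P.Ambient) ∈ P.lieAlgebra := by
  intro t
  have h1 : ∀ (i : P.ι) (t : ℝ), ∃ u : (P.obj i).Carrier,
      UnipotentGroup.mat u = NormedSpace.exp (t • matLog (P.coord g i)) := fun i t =>
    (P.obj i).exp_smul_mem (isNilpotent_matLog (isNilpotent_coord_sub_one g i)) (g.1 i)
      (exp_matLog (isNilpotent_coord_sub_one g i)).symm t
  choose u hu using h1
  refine ⟨⟨fun i => u i t, fun i j h => ?_⟩, fun i => hu i t⟩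
  have hval : ∀ i, Function.Injective (UnipotentGroup.mat : (P.obj i).Carrier → _) :=
    fun i => (P.obj i).isEmbedding_val.injective
  have hadd : ∀ i s t, u i (s + t) = u i s * u i t := fun i s t => hval i (by
    show UnipotentGroup.mat (u i (s + t)) = UnipotentGroup.mat (u i s) * UnipotentGroup.mat (u i t)
    rw [hu, hu, hu, matrix_exp_add_smul])
  have hcont : ∀ i, Continuous (u i) := fun i => (P.obj i).isEmbedding_val.continuous_iff.2 (by
    have : (UnipotentGroup.mat ∘ u i) =
        fun t => NormedSpace.exp (t • matLog (P.coord g i)) := funext (hu i)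
    rw [this]
    exact continuous_exp_smul _)
  have hone : ∀ i, u i 1 = g.1 i := fun i => hval i (by
    show UnipotentGroup.mat (u i 1) = UnipotentGroup.mat (g.1 i)
    rw [hu, one_smul]
    exact exp_matLog (isNilpotent_coord_sub_one g i))
  refine hval i ?_
  show UnipotentGroup.mat (P.map h (u j t)) = UnipotentGroup.mat (u i t)
  rw [hu i]
  have h2 := oneParameter_eq_exp (fun s => UnipotentGroup.mat (P.map h (u j s)))
    ((P.obj i).isEmbedding_val.continuous.comp ((P.continuous_map h).comp (hcont j)))
    (fun s t => by rw [hadd, map_mul]; rfl) (fun s => (P.obj i).unipotent _ (P.map h (u j s)).2) t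
  rw [h2]
  congr 3
  show UnipotentGroup.mat (P.map h (u j 1)) = UnipotentGroup.mat (g.1 i)
  rw [hone, g.2 i j h]

/-- The logarithm of a pro-unipotent group. -/
noncomputable def log (g : P.Carrier) : P.lieAlgebra :=
  ⟨fun i => matLog (P.coord g i), matLog_mem_lieAlgebra g⟩

@[simp] theorem log_exp (X : P.lieAlgebra) : log (exp X) = X :=
  Subtype.ext (funext fun i => (lieAlgebra_eq_matLog X i).symm)

@[simp] theorem exp_log (g : P.Carrier) : exp (log g) = g :=
  exp_eq_iff.2 fun i => (exp_matLog (isNilpotent_coord_sub_one g i)).symm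

theorem exp_injective : Function.Injective (exp : P.lieAlgebra → P.Carrier) :=
  Function.LeftInverse.injective log_exp

theorem continuous_log : Continuous (log : P.Carrier → P.lieAlgebra) :=
  Continuous.subtype_mk (continuous_pi fun i => continuous_matLog.comp (continuous_coord i)) _

theorem continuous_exp : Continuous (exp : P.lieAlgebra → P.Carrier) := by
  refine continuous_of_coord fun i => ?_
  simp only [coord_exp]
  exact matrix_exp_continuous.comp ((continuous_apply i).comp continuous_subtype_val)

theorem tendsto_exp_mul_exp_pow (X Y : P.lieAlgebra) :
    Tendsto (fun m : ℕ => (exp ((m : ℝ)⁻¹ • X) * exp ((m : ℝ)⁻¹ • Y)) ^ m) atTop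
      (𝓝 (exp (X + Y))) := by
  refine tendsto_of_coord fun i => ?_
  simp only [coord_pow, coord_mul, coord_exp_smul]
  rw [coord_exp]
  exact matrix_product_formula _ _

theorem coord_inv_mul (g : P.Carrier) (i : P.ι) : P.coord g⁻¹ i * P.coord g i = 1 := by
  rw [← coord_mul, inv_mul_cancel]; rfl

/-- The adjoint action of the group on its Lie algebra. -/
noncomputable def Ad (g : P.Carrier) (Y : P.lieAlgebra) : P.lieAlgebra :=
  ⟨fun i => P.coord g i * (Y : P.Ambient) i * P.coord g⁻¹ i, fun t =>
    ⟨g * exp (t • Y) * g⁻¹, fun i => by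
      rw [coord_mul, coord_mul, coord_exp_smul]
      have h := Matrix.exp_units_conj (g.1 i).1 (t • (Y : P.Ambient) i)
      rw [Pi.smul_apply, ← smul_mul_assoc, ← mul_smul_comm]
      exact h.symm⟩⟩

theorem exp_Ad (g : P.Carrier) (Y : P.lieAlgebra) : exp (Ad g Y) = g * exp Y * g⁻¹ :=
  exp_eq_iff.2 fun i => by
    rw [coord_mul, coord_mul, coord_exp]
    exact (Matrix.exp_units_conj (g.1 i).1 _).symm

/-- The bracket is the derivative of the adjoint action. -/
theorem tendsto_bracket (X Y : P.lieAlgebra) :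
    Tendsto (fun m : ℕ => (m : ℝ) • (Ad (exp ((m : ℝ)⁻¹ • X)) Y - Y)) atTop (𝓝 ⁅X, Y⁆) := by
  rw [tendsto_subtype_rng]
  refine tendsto_pi_nhds.2 fun i => ?_
  have h1 := matrix_bracket_formula ((X : P.Ambient) i) ((Y : P.Ambient) i)
  refine h1.congr fun m => ?_
  have h2 : NormedSpace.exp ((m : ℝ)⁻¹ • -(X : P.Ambient) i) =
      P.coord (exp ((m : ℝ)⁻¹ • X))⁻¹ i := by
    rw [smul_neg, Matrix.exp_neg, ← coord_exp_smul]
    exact Matrix.inv_eq_left_inv (coord_inv_mul _ _)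
  rw [h2, ← coord_exp_smul]
  rfl

/-! ### The differential of a morphism -/

section Differential

variable (φ : P.Carrier →* Q.Carrier) (hφ : Continuous φ)

/-- Morphisms carry one-parameter groups to one-parameter groups. -/
theorem exp_smul_log_map (hφ : Continuous φ) (X : P.lieAlgebra) (t : ℝ) :
    exp (t • log (φ (exp X))) = φ (exp (t • X)) := by
  refine ext_coord fun i => ?_
  rw [coord_exp_smul]
  have hc : Continuous fun s : ℝ => exp (s • X) :=
    continuous_exp.comp (continuous_id.smul continuous_const)
  have := oneParameter_eq_exp (fun s => Q.coord (φ (exp (s • X))) i)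
    ((continuous_coord i).comp (hφ.comp hc))
    (fun s t => by rw [exp_add_smul, map_mul, coord_mul])
    (fun s => isNilpotent_coord_sub_one _ i) t
  rw [this, one_smul]
  rfl

/-- The differential of a continuous homomorphism of pro-unipotent groups. It preserves sums by
the product formula and brackets by the derivative of the adjoint action. -/
noncomputable def differential : P.lieAlgebra →ₗ⁅ℝ⁆ Q.lieAlgebra :=
  have hsmul : ∀ (t : ℝ) (X : P.lieAlgebra), log (φ (exp (t • X))) = t • log (φ (exp X)) :=
    fun t X => by rw [← exp_smul_log_map φ hφ, log_exp]
  have hadd : ∀ X Y : P.lieAlgebra,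
      log (φ (exp (X + Y))) = log (φ (exp X)) + log (φ (exp Y)) := fun X Y => by
    have h1 := (hφ.tendsto _).comp (tendsto_exp_mul_exp_pow X Y)
    have h2 := tendsto_exp_mul_exp_pow (log (φ (exp X))) (log (φ (exp Y)))
    have h3 : exp (log (φ (exp X)) + log (φ (exp Y))) = φ (exp (X + Y)) := by
      refine tendsto_nhds_unique h2 (h1.congr fun m => ?_)
      rw [Function.comp_apply, map_pow, map_mul, exp_smul_log_map φ hφ, exp_smul_log_map φ hφ]
    rw [← h3, log_exp]
  have hcont : Continuous fun X : P.lieAlgebra => log (φ (exp X)) :=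
    continuous_log.comp (hφ.comp continuous_exp)
  let l : P.lieAlgebra →ₗ[ℝ] Q.lieAlgebra :=
    { toFun := fun X => log (φ (exp X)), map_add' := hadd, map_smul' := hsmul }
  have hl : ∀ X, exp (l X) = φ (exp X) := fun X => exp_log _
  { l with
    map_lie' := fun {X Y} => by
      show l ⁅X, Y⁆ = ⁅l X, l Y⁆
      have h1 := ((hcont.tendsto _).comp (tendsto_bracket X Y))
      refine tendsto_nhds_unique h1 ((tendsto_bracket (l X) (l Y)).congr fun m => ?_)
      have h2 : l (Ad (exp ((m : ℝ)⁻¹ • X)) Y) = Ad (exp ((m : ℝ)⁻¹ • l X)) (l Y) := by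
        refine exp_injective ?_
        rw [hl, exp_Ad, exp_Ad, map_mul, map_mul, map_inv, hl, ← l.map_smul, hl]
      rw [← h2, ← l.map_sub, ← l.map_smul]
      rfl }

@[simp] theorem exp_differential (X : P.lieAlgebra) : exp (differential φ hφ X) = φ (exp X) :=
  exp_log _

theorem continuous_differential : Continuous (differential φ hφ) :=
  continuous_log.comp (hφ.comp continuous_exp)

end Differential

/-- A morphism is determined by its differential, since the exponential map is onto. -/
theorem hom_eq_of_differential_eq {φ ψ : P.Carrier →* Q.Carrier} (hφ : Continuous φ)
    (hψ : Continuous ψ) (h : ∀ X, differential φ hφ X = differential ψ hψ X) : φ = ψ := by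
  ext1 g
  rw [← exp_log g, ← exp_differential φ hφ, h, exp_differential]

/-- Mutually inverse continuous homomorphisms induce an isomorphism of the Lie algebras. -/
noncomputable def lieEquivOfInverse (φ : P.Carrier →* Q.Carrier) (ψ : Q.Carrier →* P.Carrier)
    (hφ : Continuous φ) (hψ : Continuous ψ) (h1 : ∀ g, ψ (φ g) = g) (h2 : ∀ g, φ (ψ g) = g) :
    P.lieAlgebra ≃ₗ⁅ℝ⁆ Q.lieAlgebra :=
  { differential φ hφ with
    invFun := differential ψ hψ
    left_inv := fun X => exp_injective (by
      show exp (differential ψ hψ (differential φ hφ X)) = _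
      rw [exp_differential, exp_differential, h1])
    right_inv := fun X => exp_injective (by
      show exp (differential φ hφ (differential ψ hψ X)) = _
      rw [exp_differential, exp_differential, h2]) }

end ProUnipotentGroup

/-! ### Morphisms of Malcev completions -/

/-- A unipotent group, as a pro-unipotent group indexed by one point. -/
def UnipotentGroup.toPro (U : UnipotentGroup) : ProUnipotentGroup where
  ι := Unit
  obj _ := U
  map _ := MonoidHom.id _
  continuous_map _ := continuous_id
  map_refl _ _ := rfl
  map_map _ _ _ := rfl

/-- The canonical map from a unipotent group to the constant inverse limit. -/
def UnipotentGroup.toProHom (U : UnipotentGroup) : U.Carrier →* U.toPro.Carrier where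
  toFun g := ⟨fun _ => g, fun _ _ _ => rfl⟩
  map_one' := rfl
  map_mul' _ _ := rfl

theorem UnipotentGroup.continuous_toProHom (U : UnipotentGroup) : Continuous U.toProHom :=
  Continuous.subtype_mk (continuous_pi fun _ => continuous_id) _

theorem UnipotentGroup.toProHom_injective (U : UnipotentGroup) : Function.Injective U.toProHom :=
  fun _ _ h => congrFun (congrArg Subtype.val h) ()

/-- A morphism of a Malcev completion to another pro-unipotent group with a homomorphism from the
same group: it is put together from the morphisms to the components of the target. -/
theorem IsMalcevCompletion.exists_hom {Γ : Type*} [Group Γ] {P Q : ProUnipotentGroup}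
    {η : Γ →* P.Carrier} (h : IsMalcevCompletion P η) (θ : Γ →* Q.Carrier) :
    ∃ φ : P.Carrier →* Q.Carrier, Continuous φ ∧ φ.comp η = θ := by
  let pr : ∀ i, Q.Carrier →* (Q.obj i).Carrier := fun i =>
    (Pi.evalMonoidHom (fun i => (Q.obj i).Carrier) i).comp Q.toSubgroup.subtype
  have hex := fun i => (h (Q.obj i) ((pr i).comp θ)).exists
  choose φ hφ hφη using hex
  have hcompat : ∀ i j (hij : i ≤ j), (Q.map hij).comp (φ j) = φ i := fun i j hij => by
    refine (h (Q.obj i) ((pr i).comp θ)).unique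
      ⟨(Q.continuous_map hij).comp (hφ j), ?_⟩ ⟨hφ i, hφη i⟩
    rw [MonoidHom.comp_assoc, hφη]
    ext1 x
    exact (θ x).2 i j hij
  refine ⟨(MonoidHom.pi φ).codRestrict Q.toSubgroup fun g i j hij => ?_, ?_, ?_⟩
  · exact DFunLike.congr_fun (hcompat i j hij) g
  · exact Continuous.subtype_mk (continuous_pi hφ) _
  · ext1 x
    exact Subtype.ext (funext fun i => DFunLike.congr_fun (hφη i) x)

/-- Morphisms from a Malcev completion to any pro-unipotent group are determined by their
composition with `η`. -/
theorem IsMalcevCompletion.hom_ext {Γ : Type*} [Group Γ] {P Q : ProUnipotentGroup}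
    {η : Γ →* P.Carrier} (h : IsMalcevCompletion P η) {φ ψ : P.Carrier →* Q.Carrier}
    (hφ : Continuous φ) (hψ : Continuous ψ) (he : φ.comp η = ψ.comp η) : φ = ψ := by
  let pr : ∀ i, Q.Carrier →* (Q.obj i).Carrier := fun i =>
    (Pi.evalMonoidHom (fun i => (Q.obj i).Carrier) i).comp Q.toSubgroup.subtype
  have hpr : ∀ i, Continuous (pr i) := fun i => (continuous_apply i).comp continuous_subtype_val
  ext1 g
  refine Subtype.ext (funext fun i => ?_)
  have := (h (Q.obj i) (((pr i).comp φ).comp η)).unique (y₁ := (pr i).comp φ) (y₂ := (pr i).comp ψ)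
    ⟨(hpr i).comp hφ, rfl⟩ ⟨(hpr i).comp hψ, by rw [MonoidHom.comp_assoc, ← he]; rfl⟩
  exact DFunLike.congr_fun this g

attribute [local instance 100] LieRing.ofAssociativeRing in
/-- The Lie algebras of two Malcev completions are isomorphic as topological Lie algebras,
compatibly with the logarithms of the given group elements. -/
theorem IsMalcevCompletion.exists_lieEquiv {Γ : Type*} [Group Γ] {P Q : ProUnipotentGroup}
    {η : Γ →* P.Carrier} {θ : Γ →* Q.Carrier} (hP : IsMalcevCompletion P η)
    (hQ : IsMalcevCompletion Q θ) :
    ∃ e : P.lieAlgebra ≃ₗ⁅ℝ⁆ Q.lieAlgebra, Continuous e ∧ Continuous e.symm ∧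
      ∀ (x : Γ) (X : P.lieAlgebra), P.IsExp (η x) X → Q.IsExp (θ x) (e X : Q.Ambient) := by
  obtain ⟨φ, hφ, hφη⟩ := hP.exists_hom θ
  obtain ⟨ψ, hψ, hψθ⟩ := hQ.exists_hom η
  have h1 : ψ.comp φ = MonoidHom.id _ := hP.hom_ext (hψ.comp hφ) continuous_id (by
    rw [MonoidHom.comp_assoc, hφη, hψθ, MonoidHom.id_comp])
  have h2 : φ.comp ψ = MonoidHom.id _ := hQ.hom_ext (hφ.comp hψ) continuous_id (by
    rw [MonoidHom.comp_assoc, hψθ, hφη, MonoidHom.id_comp])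
  refine ⟨ProUnipotentGroup.lieEquivOfInverse φ ψ hφ hψ (DFunLike.congr_fun h1)
    (DFunLike.congr_fun h2), ProUnipotentGroup.continuous_differential φ hφ,
    ProUnipotentGroup.continuous_differential ψ hψ, fun x X hX => ?_⟩
  rw [← ProUnipotentGroup.exp_eq_iff] at hX ⊢
  rw [← hφη, MonoidHom.comp_apply, ← hX]
  exact ProUnipotentGroup.exp_differential φ hφ X

/-! ### Generators of Lie algebras and the lower central series -/

section LowerCentralSeries

variable {L : Type*} [LieRing L] [LieAlgebra ℝ L]

theorem lowerCentralSeries_succ_le {j : ℕ} {N : Submodule ℝ L}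
    (h : ∀ a : L, ∀ b ∈ LieModule.lowerCentralSeries ℝ L L j, ⁅a, b⁆ ∈ N) :
    (LieModule.lowerCentralSeries ℝ L L (j + 1)).toSubmodule ≤ N := by
  rw [LieModule.lowerCentralSeries_succ, LieSubmodule.lieIdeal_oper_eq_linear_span',
    Submodule.span_le]
  rintro _ ⟨a, -, b, hb, rfl⟩
  exact h a b hb

theorem lie_mem_lowerCentralSeries_succ {j : ℕ} (a : L) {b : L}
    (hb : b ∈ LieModule.lowerCentralSeries ℝ L L j) :
    ⁅a, b⁆ ∈ LieModule.lowerCentralSeries ℝ L L (j + 1) := by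
  rw [LieModule.lowerCentralSeries_succ]
  exact LieSubmodule.lie_mem_lie (LieSubmodule.mem_top a) hb

theorem lie_mem_lowerCentralSeries_one (a b : L) :
    ⁅a, b⁆ ∈ LieModule.lowerCentralSeries ℝ L L 1 :=
  lie_mem_lowerCentralSeries_succ (j := 0) a (LieSubmodule.mem_top b)

/-- `[γ_1, γ_j] ⊆ γ_{j+2}`, where `γ_0 = L`: by the Jacobi identity. -/
theorem lie_mem_lowerCentralSeries_add_two {j : ℕ} {a b : L}
    (ha : a ∈ LieModule.lowerCentralSeries ℝ L L 1)
    (hb : b ∈ LieModule.lowerCentralSeries ℝ L L j) :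
    ⁅a, b⁆ ∈ LieModule.lowerCentralSeries ℝ L L (j + 2) := by
  let f : L →ₗ[ℝ] L := (LieModule.toEnd ℝ L L : L →ₗ[ℝ] Module.End ℝ L).flip b
  have h := lowerCentralSeries_succ_le (j := 0)
    (N := (LieModule.lowerCentralSeries ℝ L L (j + 2)).toSubmodule.comap f) (fun p q _ => by
      show ⁅⁅p, q⁆, b⁆ ∈ LieModule.lowerCentralSeries ℝ L L (j + 2)
      rw [lie_lie]
      exact sub_mem (lie_mem_lowerCentralSeries_succ p (lie_mem_lowerCentralSeries_succ q hb))
        (lie_mem_lowerCentralSeries_succ q (lie_mem_lowerCentralSeries_succ p hb)))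
  exact h ha

theorem lowerCentralSeries_mono {i j : ℕ} (h : i ≤ j) :
    LieModule.lowerCentralSeries ℝ L L j ≤ LieModule.lowerCentralSeries ℝ L L i :=
  LieModule.antitone_lowerCentralSeries ℝ L L h

/-- Modulo brackets, a Lie algebra is spanned by its generators. -/
theorem mem_span_sup_of_generators {X : Type*} {x : X → L}
    (hx : ∀ K : LieSubalgebra ℝ L, (∀ v, x v ∈ K) → ∀ y, y ∈ K) (y : L) :
    y ∈ Submodule.span ℝ (Set.range x) ⊔
      (LieModule.lowerCentralSeries ℝ L L 1).toSubmodule := by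
  let K : LieSubalgebra ℝ L :=
    { Submodule.span ℝ (Set.range x) ⊔ (LieModule.lowerCentralSeries ℝ L L 1).toSubmodule with
      lie_mem' := fun {a b} _ _ =>
        Submodule.mem_sup_right (lie_mem_lowerCentralSeries_one a b) }
  exact hx K (fun v => Submodule.mem_sup_left (Submodule.subset_span ⟨v, rfl⟩)) y

theorem exists_fg_lowerCentralSeries_le {X : Type*} [Finite X] {x : X → L}
    (hx : ∀ K : LieSubalgebra ℝ L, (∀ v, x v ∈ K) → ∀ y, y ∈ K) (j : ℕ) :
    ∃ W : Submodule ℝ L, W.FG ∧ (LieModule.lowerCentralSeries ℝ L L j).toSubmodule ≤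
      W ⊔ (LieModule.lowerCentralSeries ℝ L L (j + 1)).toSubmodule := by
  have hfg : (Submodule.span ℝ (Set.range x)).FG := Submodule.fg_span (Set.finite_range x)
  induction j with
  | zero => exact ⟨_, hfg, fun y _ => mem_span_sup_of_generators hx y⟩
  | succ j ih =>
    obtain ⟨W, hW, hle⟩ := ih
    let f : L →ₗ[ℝ] L →ₗ[ℝ] L := (LieModule.toEnd ℝ L L : L →ₗ[ℝ] Module.End ℝ L)
    refine ⟨Submodule.map₂ f (Submodule.span ℝ (Set.range x)) W, hfg.map₂ f hW,
      lowerCentralSeries_succ_le fun a b hb => ?_⟩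
    obtain ⟨v, hv, a', ha', rfl⟩ := Submodule.mem_sup.1 (mem_span_sup_of_generators hx a)
    have hb1 := hle hb
    obtain ⟨w, hw, b', hb', rfl⟩ := Submodule.mem_sup.1 hb1
    rw [add_lie, lie_add, add_assoc ⁅v, w⁆]
    refine Submodule.add_mem_sup (Submodule.apply_mem_map₂ f hv hw) (Submodule.add_mem _ ?_ ?_)
    · exact lie_mem_lowerCentralSeries_succ v hb'
    · exact lie_mem_lowerCentralSeries_add_two ha' hb

theorem exists_fg_sup_lowerCentralSeries {X : Type*} [Finite X] {x : X → L}
    (hx : ∀ K : LieSubalgebra ℝ L, (∀ v, x v ∈ K) → ∀ y, y ∈ K) (k : ℕ) :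
    ∃ W : Submodule ℝ L, W.FG ∧ ⊤ ≤ W ⊔ (LieModule.lowerCentralSeries ℝ L L k).toSubmodule := by
  induction k with
  | zero => exact ⟨⊥, Submodule.fg_bot, fun y _ => Submodule.mem_sup_right trivial⟩
  | succ k ih =>
    obtain ⟨W, hW, hle⟩ := ih
    obtain ⟨W', hW', hle'⟩ := exists_fg_lowerCentralSeries_le hx k
    refine ⟨W ⊔ W', hW.sup hW', hle.trans ?_⟩
    rw [sup_assoc]
    exact sup_le_sup_left hle' W

end LowerCentralSeries

section NilQuotientFacts

variable {L : Type*} [LieRing L] [LieAlgebra ℝ L]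

theorem NilQuotient.mk_surjective (k : ℕ) : Function.Surjective (NilQuotient.mk L k) :=
  Submodule.Quotient.mk_surjective _

theorem NilQuotient.mk_eq_zero {k : ℕ} {x : L} :
    NilQuotient.mk L k x = 0 ↔ x ∈ LieModule.lowerCentralSeries ℝ L L k :=
  LieSubmodule.Quotient.mk_eq_zero'

/-- The nilpotent quotients of a finitely generated Lie algebra are finite-dimensional. Generation
by the `x v` is expressed by: a Lie subalgebra that contains them is everything. -/
theorem NilQuotient.finite_of_generators {X : Type*} [Finite X] {x : X → L}
    (hx : ∀ K : LieSubalgebra ℝ L, (∀ v, x v ∈ K) → ∀ y, y ∈ K) (k : ℕ) :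
    Module.Finite ℝ (NilQuotient L k) := by
  obtain ⟨W, hW, hle⟩ := exists_fg_sup_lowerCentralSeries hx k
  have hmap : W.map (NilQuotient.mk L k : L →ₗ[ℝ] NilQuotient L k) = ⊤ := by
    rw [eq_top_iff]
    intro y _
    obtain ⟨z, rfl⟩ := NilQuotient.mk_surjective k y
    obtain ⟨w, hw, u, hu, rfl⟩ := Submodule.mem_sup.1 (hle (Submodule.mem_top : z ∈ ⊤))
    refine ⟨w, hw, ?_⟩
    show NilQuotient.mk L k w = _
    rw [map_add, NilQuotient.mk_eq_zero.2 hu, add_zero]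
  exact ⟨hmap ▸ hW.map _⟩

/-- A Lie homomorphism that kills `γ_k` factors through `L / γ_k`. -/
noncomputable def NilQuotient.lift {k : ℕ} {𝔥 : Type*} [LieRing 𝔥] [LieAlgebra ℝ 𝔥]
    (f : L →ₗ⁅ℝ⁆ 𝔥) (hf : ∀ y ∈ LieModule.lowerCentralSeries ℝ L L k, f y = 0) :
    NilQuotient L k →ₗ⁅ℝ⁆ 𝔥 :=
  { (LieModule.lowerCentralSeries ℝ L L k).toSubmodule.liftQ (f : L →ₗ[ℝ] 𝔥) hf with
    map_lie' := fun {a b} => by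
      obtain ⟨a, rfl⟩ := NilQuotient.mk_surjective k a
      obtain ⟨b, rfl⟩ := NilQuotient.mk_surjective k b
      exact f.map_lie a b }

/-- The projection `L / γ_j → L / γ_i` for `i ≤ j`. -/
noncomputable def NilQuotient.proj {i j : ℕ} (h : i ≤ j) : NilQuotient L j →ₗ⁅ℝ⁆ NilQuotient L i :=
  NilQuotient.lift (NilQuotient.mk L i) fun _ hy =>
    NilQuotient.mk_eq_zero.2 (lowerCentralSeries_mono h hy)

@[simp] theorem NilQuotient.proj_mk {i j : ℕ} (h : i ≤ j) (y : L) :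
    NilQuotient.proj h (NilQuotient.mk L j y) = NilQuotient.mk L i y := rfl

end NilQuotientFacts

/-! ### A faithful nilpotent representation -/

section Representation

attribute [local instance 100] LieRing.ofAssociativeRing

variable {𝔤 : Type*} [LieRing 𝔤] [LieAlgebra ℝ 𝔤]

/-- The adjoint representation of `𝔤` on `𝔤 ⋊ ℝD`, for a derivation `D` of `𝔤`. -/
noncomputable def derivationRep (D : 𝔤 →ₗ[ℝ] 𝔤) (hD : ∀ a b, D ⁅a, b⁆ = ⁅D a, b⁆ + ⁅a, D b⁆) :
    𝔤 →ₗ⁅ℝ⁆ Module.End ℝ (𝔤 × ℝ) where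
  toFun x :=
    { toFun := fun p => (⁅x, p.1⁆ - p.2 • D x, 0)
      map_add' := fun p q => by
        ext
        · simp [add_smul]; abel
        · simp
      map_smul' := fun c p => by
        ext
        · simp [smul_sub, mul_smul]
        · simp }
  map_add' x y := by
    refine LinearMap.ext fun p => Prod.ext ?_ ?_
    · simp; abel
    · simp
  map_smul' c x := by
    refine LinearMap.ext fun p => Prod.ext ?_ ?_
    · show ⁅c • x, p.1⁆ - p.2 • D (c • x) = c • (⁅x, p.1⁆ - p.2 • D x)
      rw [smul_lie, map_smul, smul_sub, smul_comm c]
    · simp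
  map_lie' {x y} := by
    refine LinearMap.ext fun p => Prod.ext ?_ ?_
    · simp only [LinearMap.coe_mk, AddHom.coe_mk, LieRing.of_associative_ring_bracket,
        LinearMap.sub_apply, Module.End.mul_apply, hD, zero_smul, sub_zero, Prod.fst_sub, lie_sub,
        lie_smul, smul_add, lie_lie]
      rw [← lie_skew (D x) y, smul_neg]
      abel
    · simp [LieRing.of_associative_ring_bracket]

theorem derivationRep_apply (D : 𝔤 →ₗ[ℝ] 𝔤) (hD : ∀ a b, D ⁅a, b⁆ = ⁅D a, b⁆ + ⁅a, D b⁆)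
    (x : 𝔤) (p : 𝔤 × ℝ) : derivationRep D hD x p = (⁅x, p.1⁆ - p.2 • D x, 0) := rfl

/-- The representation is faithful if `D` is injective: `x` sends `D` to `-D x`. -/
theorem derivationRep_injective (D : 𝔤 →ₗ[ℝ] 𝔤)
    (hD : ∀ a b, D ⁅a, b⁆ = ⁅D a, b⁆ + ⁅a, D b⁆) (hi : ∀ x, D x = 0 → x = 0) :
    Function.Injective (derivationRep D hD) := by
  refine (injective_iff_map_eq_zero _).2 fun x hx => hi x ?_
  have h := congrArg Prod.fst (LinearMap.congr_fun hx ((0, 1) : 𝔤 × ℝ))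
  rw [derivationRep_apply] at h
  simpa using h

theorem derivationRep_isNilpotent (D : 𝔤 →ₗ[ℝ] 𝔤)
    (hD : ∀ a b, D ⁅a, b⁆ = ⁅D a, b⁆ + ⁅a, D b⁆) {k : ℕ} {x : 𝔤}
    (hx : ∀ y, (LieModule.toEnd ℝ 𝔤 𝔤 x)^[k] y = 0) : IsNilpotent (derivationRep D hD x) := by
  refine ⟨k + 1, LinearMap.ext fun p => ?_⟩
  have h : ∀ (m : ℕ) (y : 𝔤), ((derivationRep D hD x) ^ m) (y, 0) =
      ((LieModule.toEnd ℝ 𝔤 𝔤 x)^[m] y, 0) := by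
    intro m y
    induction m with
    | zero => rfl
    | succ m ih =>
      rw [pow_succ', Module.End.mul_apply, ih, derivationRep_apply, Function.iterate_succ_apply']
      simp
  rw [pow_succ, Module.End.mul_apply, derivationRep_apply, h, hx]
  rfl

end Representation

section GradedLie

variable {L : Type*} [LieRing L] [LieAlgebra ℝ L]

/-- A derivation that is the identity modulo brackets acts as `j + 1` on the `j`-th graded piece of
the lower central series. -/
theorem derivation_sub_smul_mem (D : L →ₗ[ℝ] L) (hD : ∀ a b, D ⁅a, b⁆ = ⁅D a, b⁆ + ⁅a, D b⁆)
    (h1 : ∀ y, D y - y ∈ LieModule.lowerCentralSeries ℝ L L 1) (j : ℕ) :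
    ∀ y ∈ LieModule.lowerCentralSeries ℝ L L j,
      D y - (j + 1 : ℝ) • y ∈ LieModule.lowerCentralSeries ℝ L L (j + 1) := by
  induction j with
  | zero => intro y _; simpa using h1 y
  | succ j ih =>
    let T : L →ₗ[ℝ] L := D - ((j + 1 : ℕ) + 1 : ℝ) • LinearMap.id
    have := lowerCentralSeries_succ_le (j := j)
      (N := (LieModule.lowerCentralSeries ℝ L L (j + 2)).toSubmodule.comap T) (fun a b hb => by
        have h2 : T ⁅a, b⁆ = ⁅D a - a, b⁆ + ⁅a, D b - (j + 1 : ℝ) • b⁆ := by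
          simp only [T, LinearMap.sub_apply, LinearMap.smul_apply, LinearMap.id_apply, hD, sub_lie,
            lie_sub, lie_smul]
          push_cast
          module
        show T ⁅a, b⁆ ∈ LieModule.lowerCentralSeries ℝ L L (j + 2)
        rw [h2]
        exact add_mem (lie_mem_lowerCentralSeries_add_two (h1 a) hb)
          (lie_mem_lowerCentralSeries_succ a (ih b hb)))
    exact fun y hy => this hy

theorem derivation_mem_lowerCentralSeries (D : L →ₗ[ℝ] L)
    (hD : ∀ a b, D ⁅a, b⁆ = ⁅D a, b⁆ + ⁅a, D b⁆)
    (h1 : ∀ y, D y - y ∈ LieModule.lowerCentralSeries ℝ L L 1) {j : ℕ} {y : L}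
    (hy : y ∈ LieModule.lowerCentralSeries ℝ L L j) :
    D y ∈ LieModule.lowerCentralSeries ℝ L L j := by
  have h := lowerCentralSeries_mono (Nat.le_succ j) (derivation_sub_smul_mem D hD h1 j y hy)
  have h2 := add_mem h ((LieModule.lowerCentralSeries ℝ L L j).smul_mem (j + 1 : ℝ) hy)
  simpa using h2

/-- Such a derivation is injective on the quotients by the terms of the lower central series, as it
is multiplication by `j + 1 ≠ 0` on the `j`-th graded piece. -/
theorem mem_of_derivation_mem (D : L →ₗ[ℝ] L)
    (hD : ∀ a b, D ⁅a, b⁆ = ⁅D a, b⁆ + ⁅a, D b⁆)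
    (h1 : ∀ y, D y - y ∈ LieModule.lowerCentralSeries ℝ L L 1) {k : ℕ} {y : L}
    (hy : D y ∈ LieModule.lowerCentralSeries ℝ L L k) :
    y ∈ LieModule.lowerCentralSeries ℝ L L k := by
  have h : ∀ j ≤ k, y ∈ LieModule.lowerCentralSeries ℝ L L j := by
    intro j
    induction j with
    | zero => intro _; exact LieSubmodule.mem_top y
    | succ j ih =>
      intro hj
      have h2 := derivation_sub_smul_mem D hD h1 j y (ih (by omega))
      have h3 := sub_mem (lowerCentralSeries_mono hj hy) h2
      rw [sub_sub_cancel] at h3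
      have h4 := (LieModule.lowerCentralSeries ℝ L L (j + 1)).smul_mem ((j + 1 : ℝ)⁻¹) h3
      rwa [smul_smul, inv_mul_cancel₀ (by positivity), one_smul] at h4
  exact h k le_rfl

attribute [local instance 100] LieRing.ofAssociativeRing

/-- If `L` is generated by finitely many elements and has a derivation `D` that is the identity
modulo brackets, then the nilpotent quotients `L / γ_k` have faithful representations by nilpotent
matrices, namely on `L / γ_k ⋊ ℝD`. -/
theorem exists_faithful_nilpotent_rep {X : Type*} [Finite X] {x : X → L}
    (hx : ∀ K : LieSubalgebra ℝ L, (∀ v, x v ∈ K) → ∀ y, y ∈ K)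
    (D : L →ₗ[ℝ] L) (hD : ∀ a b, D ⁅a, b⁆ = ⁅D a, b⁆ + ⁅a, D b⁆)
    (h1 : ∀ y, D y - y ∈ LieModule.lowerCentralSeries ℝ L L 1) (k : ℕ) :
    ∃ (n : ℕ) (r : NilQuotient L k →ₗ⁅ℝ⁆ Matrix (Fin n) (Fin n) ℝ),
      Function.Injective r ∧ ∀ y, IsNilpotent (r y) := by
  let D' : NilQuotient L k →ₗ[ℝ] NilQuotient L k :=
    (LieModule.lowerCentralSeries ℝ L L k).toSubmodule.liftQ
      ((NilQuotient.mk L k : L →ₗ[ℝ] NilQuotient L k).comp D) fun y hy =>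
        NilQuotient.mk_eq_zero.2 (derivation_mem_lowerCentralSeries D hD h1 hy)
  have hD'mk : ∀ y, D' (NilQuotient.mk L k y) = NilQuotient.mk L k (D y) := fun _ => rfl
  have hD' : ∀ a b, D' ⁅a, b⁆ = ⁅D' a, b⁆ + ⁅a, D' b⁆ := by
    intro a b
    obtain ⟨a, rfl⟩ := NilQuotient.mk_surjective k a
    obtain ⟨b, rfl⟩ := NilQuotient.mk_surjective k b
    rw [← LieHom.map_lie, hD'mk, hD'mk, hD'mk, hD, map_add, LieHom.map_lie, LieHom.map_lie]
  have hinj : ∀ y, D' y = 0 → y = 0 := by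
    intro y hy
    obtain ⟨y, rfl⟩ := NilQuotient.mk_surjective k y
    rw [hD'mk, NilQuotient.mk_eq_zero] at hy
    exact NilQuotient.mk_eq_zero.2 (mem_of_derivation_mem D hD h1 hy)
  have hnil : ∀ a y : NilQuotient L k,
      (LieModule.toEnd ℝ (NilQuotient L k) (NilQuotient L k) a)^[k] y = 0 := by
    intro a y
    obtain ⟨a, rfl⟩ := NilQuotient.mk_surjective k a
    obtain ⟨y, rfl⟩ := NilQuotient.mk_surjective k y
    have h2 : ∀ m : ℕ, (LieModule.toEnd ℝ (NilQuotient L k) (NilQuotient L k)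
        (NilQuotient.mk L k a))^[m] (NilQuotient.mk L k y) =
        NilQuotient.mk L k ((LieModule.toEnd ℝ L L a)^[m] y) := by
      intro m
      induction m with
      | zero => rfl
      | succ m ih =>
        rw [Function.iterate_succ_apply', Function.iterate_succ_apply', ih]
        exact ((NilQuotient.mk L k).map_lie _ _).symm
    rw [h2, NilQuotient.mk_eq_zero]
    exact LieModule.iterate_toEnd_mem_lowerCentralSeries ℝ L L a y k
  have := NilQuotient.finite_of_generators hx k
  let e : Module.End ℝ (NilQuotient L k × ℝ) ≃ₐ[ℝ] Matrix _ _ ℝ :=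
    LinearMap.toMatrixAlgEquiv (Module.finBasis ℝ (NilQuotient L k × ℝ))
  refine ⟨_, e.toAlgHom.toLieHom.comp (derivationRep D' hD'), ?_, fun y => ?_⟩
  · exact e.injective.comp (derivationRep_injective D' hD' hinj)
  · exact (derivationRep_isNilpotent D' hD' (hnil y)).map e

end GradedLie

/-! ### Presented Lie algebras -/

section PresentedLieFacts

variable {X : Type*}

theorem freeLie_generated (K : LieSubalgebra ℝ (FreeLieAlgebra ℝ X))
    (h : ∀ v, FreeLieAlgebra.of ℝ v ∈ K) (f : FreeLieAlgebra ℝ X) : f ∈ K := by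
  let F : FreeLieAlgebra ℝ X →ₗ⁅ℝ⁆ K := FreeLieAlgebra.lift ℝ fun v => ⟨_, h v⟩
  have h1 : K.incl.comp F = LieHom.id := FreeLieAlgebra.hom_ext fun v => by
    simp [F]
  have h2 := LieHom.congr_fun h1 f
  rw [← show ((F f : K) : FreeLieAlgebra ℝ X) = f from h2]
  exact (F f).2

namespace PresentedLie

/-- The canonical homomorphism from the free Lie algebra to a presented Lie algebra. -/
noncomputable def mkHom (S : Set (FreeLieAlgebra ℝ X)) :
    FreeLieAlgebra ℝ X →ₗ⁅ℝ⁆ PresentedLie S where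
  toFun x := LieSubmodule.Quotient.mk x
  map_add' _ _ := rfl
  map_smul' _ _ := rfl
  map_lie' := rfl

variable {S : Set (FreeLieAlgebra ℝ X)}

/-- The generator of a presented Lie algebra attached to `v`. -/
noncomputable def gen (S : Set (FreeLieAlgebra ℝ X)) (v : X) : PresentedLie S :=
  mkHom S (FreeLieAlgebra.of ℝ v)

theorem mkHom_surjective : Function.Surjective (mkHom S) := Submodule.Quotient.mk_surjective _

theorem mkHom_eq_zero {r : FreeLieAlgebra ℝ X} (h : r ∈ S) : mkHom S r = 0 :=
  LieSubmodule.Quotient.mk_eq_zero'.2 (LieSubmodule.subset_lieSpan h)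

theorem generated (K : LieSubalgebra ℝ (PresentedLie S)) (h : ∀ v, gen S v ∈ K)
    (y : PresentedLie S) : y ∈ K := by
  obtain ⟨f, rfl⟩ := mkHom_surjective y
  exact freeLie_generated (K.comap (mkHom S)) h f

/-- The homomorphism from a presented Lie algebra defined by images of the generators that satisfy
the relations. -/
noncomputable def lift {𝔥 : Type*} [LieRing 𝔥] [LieAlgebra ℝ 𝔥] (x : X → 𝔥)
    (hx : ∀ r ∈ S, FreeLieAlgebra.lift ℝ x r = 0) : PresentedLie S →ₗ⁅ℝ⁆ 𝔥 :=
  have hle : LieSubmodule.lieSpan ℝ (FreeLieAlgebra ℝ X) S ≤ (FreeLieAlgebra.lift ℝ x).ker :=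
    LieSubmodule.lieSpan_le.2 fun r hr => LieHom.mem_ker.2 (hx r hr)
  { (LieSubmodule.lieSpan ℝ (FreeLieAlgebra ℝ X) S).toSubmodule.liftQ
      (FreeLieAlgebra.lift ℝ x : FreeLieAlgebra ℝ X →ₗ[ℝ] 𝔥)
      (fun r hr => LieHom.mem_ker.1 (hle hr)) with
    map_lie' := fun {a b} => by
      obtain ⟨a, rfl⟩ := mkHom_surjective a
      obtain ⟨b, rfl⟩ := mkHom_surjective b
      exact (FreeLieAlgebra.lift ℝ x).map_lie a b }

@[simp] theorem lift_mkHom {𝔥 : Type*} [LieRing 𝔥] [LieAlgebra ℝ 𝔥] (x : X → 𝔥)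
    (hx : ∀ r ∈ S, FreeLieAlgebra.lift ℝ x r = 0) (f : FreeLieAlgebra ℝ X) :
    lift x hx (mkHom S f) = FreeLieAlgebra.lift ℝ x f := rfl

@[simp] theorem lift_gen {𝔥 : Type*} [LieRing 𝔥] [LieAlgebra ℝ 𝔥] (x : X → 𝔥)
    (hx : ∀ r ∈ S, FreeLieAlgebra.lift ℝ x r = 0) (v : X) : lift x hx (gen S v) = x v := by
  rw [gen, lift_mkHom, FreeLieAlgebra.lift_of_apply]

theorem hom_ext {𝔥 : Type*} [LieRing 𝔥] [LieAlgebra ℝ 𝔥] {f g : PresentedLie S →ₗ⁅ℝ⁆ 𝔥}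
    (h : ∀ v, f (gen S v) = g (gen S v)) (y : PresentedLie S) : f y = g y := by
  obtain ⟨y, rfl⟩ := mkHom_surjective y
  have : f.comp (mkHom S) = g.comp (mkHom S) := FreeLieAlgebra.hom_ext h
  exact LieHom.congr_fun this y

attribute [local instance 100] LieRing.ofAssociativeRing

/-- The derivation `D` along `f : FreeLieAlgebra ℝ X → L` with `D v = f v` for the generators `v`.
It is obtained from the representation of the free Lie algebra on `L × ℝ` in which a generator `v`
sends `(y, c)` to `([f v, y] - c f v, 0)`. -/
theorem exists_free_derivation {L : Type*} [LieRing L] [LieAlgebra ℝ L]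
    (f : FreeLieAlgebra ℝ X →ₗ⁅ℝ⁆ L) :
    ∃ D : FreeLieAlgebra ℝ X →ₗ[ℝ] L, (∀ a b, D ⁅a, b⁆ = ⁅D a, f b⁆ + ⁅f a, D b⁆) ∧
      ∀ v, D (FreeLieAlgebra.of ℝ v) = f (FreeLieAlgebra.of ℝ v) := by
  let τ : L → L → Module.End ℝ (L × ℝ) := fun a d =>
    { toFun := fun p => (⁅a, p.1⁆ - p.2 • d, 0)
      map_add' := fun p q => by
        ext
        · simp [add_smul]; abel
        · simp
      map_smul' := fun c p => by
        ext
        · simp [smul_sub, mul_smul]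
        · simp }
  have hτ : ∀ a d p, τ a d p = (⁅a, p.1⁆ - p.2 • d, 0) := fun _ _ _ => rfl
  let σ : FreeLieAlgebra ℝ X →ₗ⁅ℝ⁆ Module.End ℝ (L × ℝ) :=
    FreeLieAlgebra.lift ℝ fun v => τ (f (FreeLieAlgebra.of ℝ v)) (f (FreeLieAlgebra.of ℝ v))
  let D : FreeLieAlgebra ℝ X →ₗ[ℝ] L :=
    -((LinearMap.fst ℝ L ℝ).comp ((LinearMap.applyₗ ((0, 1) : L × ℝ)).comp
      (σ : FreeLieAlgebra ℝ X →ₗ[ℝ] Module.End ℝ (L × ℝ))))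
  have hDσ : ∀ a, D a = -(σ a (0, 1)).1 := fun _ => rfl
  have hlie : ∀ (a b : FreeLieAlgebra ℝ X), σ a = τ (f a) (D a) → σ b = τ (f b) (D b) →
      ∀ p, σ ⁅a, b⁆ p = (⁅⁅f a, f b⁆, p.1⁆ - p.2 • (⁅D a, f b⁆ + ⁅f a, D b⁆), 0) := by
    intro a b ha hb p
    rw [LieHom.map_lie, LieRing.of_associative_ring_bracket, ha, hb]
    refine Prod.ext ?_ ?_
    · simp only [LinearMap.sub_apply, Module.End.mul_apply, hτ, zero_smul, sub_zero, Prod.fst_sub,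
        lie_sub, lie_smul, smul_add, lie_lie]
      rw [← lie_skew (D a) (f b), smul_neg]
      abel
    · simp [hτ]
  have key : ∀ a, σ a = τ (f a) (D a) := by
    let K : LieSubalgebra ℝ (FreeLieAlgebra ℝ X) :=
      { carrier := {a | σ a = τ (f a) (D a)}
        zero_mem' := by
          refine LinearMap.ext fun p => ?_
          simp [hτ]
          rfl
        add_mem' := fun {a b} ha hb => by
          refine LinearMap.ext fun p => ?_
          rw [Set.mem_ofPred_eq] at ha hb
          rw [map_add, LinearMap.add_apply, ha, hb]
          simp [hτ]; abel
        smul_mem' := fun c a ha => by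
          refine LinearMap.ext fun p => ?_
          rw [Set.mem_ofPred_eq] at ha
          rw [map_smul, LinearMap.smul_apply, ha]
          simp [hτ, smul_sub, smul_comm c]
        lie_mem' := fun {a b} ha hb => by
          refine LinearMap.ext fun p => ?_
          have h1 := hlie a b ha hb
          have h2 : D ⁅a, b⁆ = ⁅D a, f b⁆ + ⁅f a, D b⁆ := by rw [hDσ, h1]; simp
          rw [h1, hτ, h2, LieHom.map_lie] }
    refine freeLie_generated K fun v => ?_
    have h1 : σ (FreeLieAlgebra.of ℝ v) =
        τ (f (FreeLieAlgebra.of ℝ v)) (f (FreeLieAlgebra.of ℝ v)) :=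
      FreeLieAlgebra.lift_of_apply ..
    have h2 : D (FreeLieAlgebra.of ℝ v) = f (FreeLieAlgebra.of ℝ v) := by
      rw [hDσ, h1, hτ]; simp
    show σ _ = τ _ (D _)
    rw [h1, h2]
  refine ⟨D, fun a b => ?_, fun v => ?_⟩
  · rw [hDσ, hlie a b (key a) (key b)]; simp
  · rw [hDσ, show σ (FreeLieAlgebra.of ℝ v) = _ from FreeLieAlgebra.lift_of_apply .., hτ]; simp

/-- If the relators are brackets and differences of generators, then the Lie algebra they present
has a derivation that fixes the generators: the relators are homogeneous. Such a derivation is the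
identity modulo brackets. -/
theorem exists_derivation
    (hS : ∀ r ∈ S, (∃ v w : X, r = ⁅FreeLieAlgebra.of ℝ v, FreeLieAlgebra.of ℝ w⁆) ∨
      ∃ v w : X, r = FreeLieAlgebra.of ℝ v - FreeLieAlgebra.of ℝ w) :
    ∃ D : PresentedLie S →ₗ[ℝ] PresentedLie S, (∀ a b, D ⁅a, b⁆ = ⁅D a, b⁆ + ⁅a, D b⁆) ∧
      ∀ y, D y - y ∈ LieModule.lowerCentralSeries ℝ (PresentedLie S) (PresentedLie S) 1 := by
  obtain ⟨D, hD, hgen⟩ := exists_free_derivation (mkHom S)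
  have hrel : ∀ r ∈ S, D r = 0 := by
    intro r hr
    have h0 := mkHom_eq_zero hr
    rcases hS r hr with ⟨v, w, rfl⟩ | ⟨v, w, rfl⟩
    · rw [LieHom.map_lie] at h0
      rw [hD, hgen, hgen, h0, add_zero]
    · rw [map_sub] at h0 ⊢
      rw [hgen, hgen, h0]
  -- the elements killed both in the quotient and by `D` form an ideal that contains the relators
  let I : LieSubmodule ℝ (FreeLieAlgebra ℝ X) (FreeLieAlgebra ℝ X) :=
    { (LinearMap.ker (mkHom S : FreeLieAlgebra ℝ X →ₗ[ℝ] PresentedLie S)) ⊓ LinearMap.ker D with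
      lie_mem := fun {a b} hb => by
        obtain ⟨h1, h2⟩ := hb
        have h1' : mkHom S b = 0 := h1
        have h2' : D b = 0 := h2
        refine ⟨?_, ?_⟩
        · show mkHom S ⁅a, b⁆ = 0
          rw [LieHom.map_lie, h1', lie_zero]
        · show D ⁅a, b⁆ = 0
          rw [hD, h1', h2', lie_zero, lie_zero, add_zero] }
  have hle : LieSubmodule.lieSpan ℝ (FreeLieAlgebra ℝ X) S ≤ I :=
    LieSubmodule.lieSpan_le.2 fun r hr => ⟨mkHom_eq_zero hr, hrel r hr⟩
  let D' : PresentedLie S →ₗ[ℝ] PresentedLie S :=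
    (LieSubmodule.lieSpan ℝ (FreeLieAlgebra ℝ X) S).toSubmodule.liftQ D fun r hr => (hle hr).2
  have hD'mk : ∀ a, D' (mkHom S a) = D a := fun _ => rfl
  have hD' : ∀ a b, D' ⁅a, b⁆ = ⁅D' a, b⁆ + ⁅a, D' b⁆ := by
    intro a b
    obtain ⟨a, rfl⟩ := mkHom_surjective a
    obtain ⟨b, rfl⟩ := mkHom_surjective b
    rw [← LieHom.map_lie, hD'mk, hD'mk, hD'mk, hD]
  refine ⟨D', hD', ?_⟩
  let K : LieSubalgebra ℝ (PresentedLie S) :=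
    { (LieModule.lowerCentralSeries ℝ (PresentedLie S) (PresentedLie S) 1).toSubmodule.comap
        (D' - LinearMap.id) with
      lie_mem' := fun {a b} _ _ => by
        show D' ⁅a, b⁆ - ⁅a, b⁆ ∈ LieModule.lowerCentralSeries ℝ (PresentedLie S) _ 1
        rw [hD']
        exact sub_mem (add_mem (lie_mem_lowerCentralSeries_one _ _)
          (lie_mem_lowerCentralSeries_one _ _)) (lie_mem_lowerCentralSeries_one _ _) }
  refine generated K fun v => ?_
  show D' (gen S v) - gen S v ∈ LieModule.lowerCentralSeries ℝ (PresentedLie S) _ 1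
  rw [gen, hD'mk, hgen, sub_self]
  exact zero_mem _

end PresentedLie

end PresentedLieFacts

/-! ### Unipotent groups from nilpotent representations -/

section NilpotentReps

attribute [local instance 100] LieRing.ofAssociativeRing

variable {𝔤 : Type*} [LieRing 𝔤] [LieAlgebra ℝ 𝔤] {n m : ℕ}

/-- Engel's theorem, for the associative algebra generated by a representation by nilpotent
matrices. -/
theorem exists_nil_submodule (r : 𝔤 →ₗ⁅ℝ⁆ Matrix (Fin n) (Fin n) ℝ)
    (hr : ∀ x, IsNilpotent (r x)) :
    ∃ (N : Submodule ℝ (Matrix (Fin n) (Fin n) ℝ)) (K : ℕ),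
      (∀ x, r x ∈ N) ∧ N * N ≤ N ∧ N ^ K = ⊥ := by
  let M := Fin n → ℝ
  let ρ : 𝔤 →ₗ⁅ℝ⁆ Module.End ℝ M := (Matrix.toLinAlgEquiv' : Matrix (Fin n) (Fin n) ℝ ≃ₐ[ℝ]
    Module.End ℝ M).toAlgHom.toLieHom.comp r
  let _ : LieRingModule 𝔤 M := LieRingModule.compLieHom M ρ
  have : LieModule ℝ 𝔤 M := LieModule.compLieHom M ρ
  have hact : ∀ (x : 𝔤) (v : M), ⁅x, v⁆ = (r x).mulVec v := fun _ _ => rfl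
  have hnil : LieModule.IsNilpotent 𝔤 M := by
    rw [LieModule.isNilpotent_iff_forall' (R := ℝ)]
    intro x
    exact (hr x).map (Matrix.toLinAlgEquiv' : Matrix (Fin n) (Fin n) ℝ ≃ₐ[ℝ] Module.End ℝ M)
  obtain ⟨K, hK⟩ := hnil.nilpotent (R := ℝ)
  let F : ℕ → Submodule ℝ M := fun j => (LieModule.lowerCentralSeries ℝ 𝔤 M j).toSubmodule
  -- the matrices that lower the filtration by `s` steps
  let E : ℕ → Submodule ℝ (Matrix (Fin n) (Fin n) ℝ) := fun s =>
    { carrier := {A | ∀ j, ∀ v ∈ F j, A.mulVec v ∈ F (j + s)}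
      zero_mem' := fun j v _ => by rw [Matrix.zero_mulVec]; exact zero_mem _
      add_mem' := fun ha hb j v hv => by
        rw [Matrix.add_mulVec]; exact add_mem (ha j v hv) (hb j v hv)
      smul_mem' := fun c A ha j v hv => by
        rw [Matrix.smul_mulVec]; exact Submodule.smul_mem _ c (ha j v hv) }
  have hmul : ∀ s t, E s * E t ≤ E (t + s) := fun s t =>
    Submodule.mul_le.2 fun A hA B hB j v hv => by
      rw [← Matrix.mulVec_mulVec, ← add_assoc]
      exact hA _ _ (hB j v hv)
  refine ⟨E 1, K, fun x j v hv => ?_, (hmul 1 1).trans fun A hA j v hv => ?_, ?_⟩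
  · show (r x).mulVec v ∈ LieModule.lowerCentralSeries ℝ 𝔤 M (j + 1)
    rw [← hact, LieModule.lowerCentralSeries_succ]
    exact LieSubmodule.lie_mem_lie (LieSubmodule.mem_top x) hv
  · exact LieModule.antitone_lowerCentralSeries ℝ 𝔤 M (Nat.le_succ _) (hA j v hv)
  · have hpow : ∀ s, E 1 ^ s ≤ E s := by
      intro s
      induction s with
      | zero =>
        rw [pow_zero, Submodule.one_le]
        intro j v hv
        rwa [Matrix.one_mulVec]
      | succ s ih => exact (pow_succ (E 1) s).le.trans ((mul_le_mul_left ih (E 1)).trans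
          ((hmul s 1).trans_eq (by rw [add_comm])))
    refine (Submodule.eq_bot_iff _).2 fun A hA => ?_
    refine Matrix.ext_of_mulVec_single fun i => ?_
    have h := hpow K hA 0 (Pi.single i 1) (LieSubmodule.mem_top _)
    rw [Matrix.zero_mulVec]
    have h2 : A.mulVec (Pi.single i 1) ∈ LieModule.lowerCentralSeries ℝ 𝔤 M (0 + K) := h
    rw [zero_add, hK] at h2
    exact h2

theorem exp_prodMk {A B : Type*} [NormedRing A] [NormedAlgebra ℝ A] [CompleteSpace A]
    [NormedRing B] [NormedAlgebra ℝ B] [CompleteSpace B] (a : A) (b : B) :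
    NormedSpace.exp (a, b) = (NormedSpace.exp a, NormedSpace.exp b) := by
  let _ : NormedAlgebra ℚ A := NormedAlgebra.restrictScalars ℚ ℝ A
  let _ : NormedAlgebra ℚ B := NormedAlgebra.restrictScalars ℚ ℝ B
  exact Prod.ext (Prod.fst_exp _) (Prod.snd_exp _)

theorem isNilpotent_exp_mul_exp_sub_one (r : 𝔤 →ₗ⁅ℝ⁆ Matrix (Fin n) (Fin n) ℝ)
    (hr : ∀ x, IsNilpotent (r x)) (x y : 𝔤) :
    IsNilpotent (NormedSpace.exp (r x) * NormedSpace.exp (r y) - 1) := by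
  obtain ⟨N, K, hN, hNN, hNK⟩ := exists_nil_submodule r hr
  have h1 : ∀ x, NormedSpace.exp (r x) - 1 ∈ N := fun x => matrix_exp_sub_one_mem hNN (hN x) (hr x)
  have h2 : NormedSpace.exp (r x) * NormedSpace.exp (r y) - 1 ∈ N := by
    have h3 : NormedSpace.exp (r x) * NormedSpace.exp (r y) - 1 =
        (NormedSpace.exp (r x) - 1) * (NormedSpace.exp (r y) - 1) +
        (NormedSpace.exp (r x) - 1) + (NormedSpace.exp (r y) - 1) := by noncomm_ring
    rw [h3]
    exact N.add_mem (N.add_mem (hNN (Submodule.mul_mem_mul (h1 x) (h1 y))) (h1 x)) (h1 y)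
  refine ⟨K, ?_⟩
  have h4 := Submodule.pow_mem_pow N h2 K
  rw [hNK] at h4
  exact h4

/-- The group law of the exponentials is determined by the Lie algebra: a common logarithm of the
product exists for any two representations by nilpotent matrices. This is the
Baker-Campbell-Hausdorff theorem for the image of `𝔤` in the product of the matrix algebras. -/
theorem exists_exp_mul_exp (r : 𝔤 →ₗ⁅ℝ⁆ Matrix (Fin n) (Fin n) ℝ)
    (f : 𝔤 →ₗ⁅ℝ⁆ Matrix (Fin m) (Fin m) ℝ) (hr : ∀ x, IsNilpotent (r x))
    (hf : ∀ x, IsNilpotent (f x)) (x y : 𝔤) :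
    ∃ z, NormedSpace.exp (r z) = NormedSpace.exp (r x) * NormedSpace.exp (r y) ∧
      NormedSpace.exp (f z) = NormedSpace.exp (f x) * NormedSpace.exp (f y) := by
  have hr1 := isNilpotent_exp_mul_exp_sub_one r hr
  have hf1 := isNilpotent_exp_mul_exp_sub_one f hf
  have hrt : ∀ (t : ℝ) x, t • r x = r (t • x) := fun t x => (r.map_smul t x).symm
  have hft : ∀ (t : ℝ) x, t • f x = f (t • x) := fun t x => (f.map_smul t x).symm
  let _ : NormedRing (Matrix (Fin n) (Fin n) ℝ) := Matrix.linftyOpNormedRing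
  let _ : NormedAlgebra ℝ (Matrix (Fin n) (Fin n) ℝ) := Matrix.linftyOpNormedAlgebra
  let _ : NormedRing (Matrix (Fin m) (Fin m) ℝ) := Matrix.linftyOpNormedRing
  let _ : NormedAlgebra ℝ (Matrix (Fin m) (Fin m) ℝ) := Matrix.linftyOpNormedAlgebra
  let A := Matrix (Fin n) (Fin n) ℝ × Matrix (Fin m) (Fin m) ℝ
  let F : Submodule ℝ A := LinearMap.range
    ((r : 𝔤 →ₗ[ℝ] Matrix (Fin n) (Fin n) ℝ).prod (f : 𝔤 →ₗ[ℝ] Matrix (Fin m) (Fin m) ℝ))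
  have hmem : ∀ z, ((r z, f z) : A) ∈ F := fun z => ⟨z, rfl⟩
  have hF : ∀ a ∈ F, ∀ b ∈ F, a * b - b * a ∈ F := by
    rintro _ ⟨a, rfl⟩ _ ⟨b, rfl⟩
    refine ⟨⁅a, b⁆, Prod.ext ?_ ?_⟩
    · exact r.map_lie a b
    · exact f.map_lie a b
  have hexp : ∀ z, NormedSpace.exp ((r z, f z) : A) =
      (NormedSpace.exp (r z), NormedSpace.exp (f z)) := fun z => exp_prodMk _ _
  have hpow : ∀ (a : A), IsNilpotent a.1 → IsNilpotent a.2 → a ^ (n + m) = 0 := fun a h1 h2 =>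
    Prod.ext (pow_eq_zero_of_le (Nat.le_add_right n m) (Matrix.pow_eq_zero_of_isNilpotent h1))
      (pow_eq_zero_of_le (Nat.le_add_left m n) (Matrix.pow_eq_zero_of_isNilpotent h2))
  have hK : ∀ t : ℝ, (NormedSpace.exp ((r x, f x) : A) * NormedSpace.exp (t • ((r y, f y) : A)) - 1)
      ^ (n + m) = 0 := by
    intro t
    have h1 : t • ((r y, f y) : A) = (r (t • y), f (t • y)) := Prod.ext (hrt t y) (hft t y)
    rw [h1, hexp, hexp]
    exact hpow _ (hr1 x (t • y)) (hf1 x (t • y))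
  have hbch := nilLog_exp_mul_exp_mem F hF (hmem x) (hmem y) (hpow _ (hr x) (hf x))
    (hpow _ (hr y) (hf y)) hK
  obtain ⟨z, hz⟩ := hbch
  have hz' : ((r z, f z) : A) = nilLog (n + m) (NormedSpace.exp ((r x, f x) : A) *
    NormedSpace.exp ((r y, f y) : A)) := hz
  have h1 := hK 1
  rw [one_smul] at h1
  have h2 : NormedSpace.exp ((r z, f z) : A) =
      NormedSpace.exp ((r x, f x) : A) * NormedSpace.exp ((r y, f y) : A) := by
    rw [hz']; exact exp_nilLog h1
  replace h2 := (hexp z).symm.trans (h2.trans (congrArg₂ (· * ·) (hexp x) (hexp y)))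
  exact ⟨z, congrArg Prod.fst h2, congrArg Prod.snd h2⟩

/-- The unipotent group `exp (r 𝔤)` of a Lie algebra `𝔤` of nilpotent matrices. It is Zariski
closed, since the logarithm is a polynomial and `r 𝔤` is a linear subspace. -/
def expGroup (r : 𝔤 →ₗ⁅ℝ⁆ Matrix (Fin n) (Fin n) ℝ) (hr : ∀ x, IsNilpotent (r x)) :
    UnipotentGroup where
  n := n
  toSubgroup :=
    { carrier := {g | ∃ x, (g : Matrix (Fin n) (Fin n) ℝ) = NormedSpace.exp (r x)}
      one_mem' := ⟨0, by rw [map_zero, NormedSpace.exp_zero]; rfl⟩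
      mul_mem' := by
        rintro g h ⟨x, hx⟩ ⟨y, hy⟩
        obtain ⟨z, hz, -⟩ := exists_exp_mul_exp r r hr hr x y
        exact ⟨z, by rw [hz, ← hx, ← hy]; rfl⟩
      inv_mem' := by
        rintro g ⟨x, hx⟩
        refine ⟨-x, ?_⟩
        rw [map_neg, Matrix.exp_neg, ← hx]
        exact Matrix.coe_units_inv g }
  unipotent := by
    rintro g ⟨x, hx⟩
    rw [hx]
    exact isNilpotent_exp_sub_one (hr x)
  zariskiClosed := by
    -- the group is cut out by all the polynomials that vanish on it: for a common zero `g`, the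
    -- matrix `(g - 1) ^ n` vanishes and the linear forms that vanish on `r 𝔤` vanish at `log g`
    let ev : (g : GL (Fin n) ℝ) → MvPolynomial (Fin n × Fin n) ℝ →ₐ[ℝ] ℝ := fun g =>
      MvPolynomial.aeval fun ij => (g : Matrix (Fin n) (Fin n) ℝ) ij.1 ij.2
    refine ⟨{p | ∀ g : GL (Fin n) ℝ,
      (∃ x, (g : Matrix (Fin n) (Fin n) ℝ) = NormedSpace.exp (r x)) → ev g p = 0},
      fun g => ⟨fun hg p hp => hp g hg, fun h => ?_⟩⟩
    have h' : ∀ p : MvPolynomial (Fin n × Fin n) ℝ, (∀ g : GL (Fin n) ℝ,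
      (∃ x, (g : Matrix (Fin n) (Fin n) ℝ) = NormedSpace.exp (r x)) → ev g p = 0) → ev g p = 0 := h
    let G := Matrix.mvPolynomialX (Fin n) (Fin n) ℝ
    have hG : ∀ g : GL (Fin n) ℝ, (ev g).mapMatrix G = (g : Matrix (Fin n) (Fin n) ℝ) := fun g =>
      Matrix.mvPolynomialX_mapMatrix_aeval ℝ (g : Matrix (Fin n) (Fin n) ℝ)
    have hnil : ((g : Matrix (Fin n) (Fin n) ℝ) - 1) ^ n = 0 := by
      have h1 : ∀ g : GL (Fin n) ℝ, (ev g).mapMatrix ((G - 1) ^ n) =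
          ((g : Matrix (Fin n) (Fin n) ℝ) - 1) ^ n := fun g => by
        rw [map_pow, map_sub, map_one, hG]
      ext i j
      rw [← h1]
      refine h' (((G - 1) ^ n) i j) fun g' ⟨x, hx⟩ => ?_
      show ((ev g').mapMatrix ((G - 1) ^ n)) i j = 0
      rw [h1, hx, Matrix.pow_eq_zero_of_isNilpotent (isNilpotent_exp_sub_one (hr x))]
      rfl
    have hlog : matLog (g : Matrix (Fin n) (Fin n) ℝ) ∈
        LinearMap.range (r : 𝔤 →ₗ[ℝ] Matrix (Fin n) (Fin n) ℝ) := by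
      by_contra hn
      obtain ⟨l, hl, hle⟩ := Submodule.exists_le_ker_of_notMem hn
      have hsum : ∀ A : Matrix (Fin n) (Fin n) ℝ,
          l A = ∑ i, ∑ j, l (Matrix.single i j 1) * A i j := by
        intro A
        conv_lhs => rw [Matrix.matrix_eq_sum_single A]
        simp only [map_sum]
        refine Finset.sum_congr rfl fun i _ => Finset.sum_congr rfl fun j _ => ?_
        rw [← mul_one (A i j), ← smul_eq_mul, ← Matrix.smul_single, map_smul, smul_eq_mul, mul_comm,
          smul_eq_mul, mul_one]
      let q : MvPolynomial (Fin n × Fin n) ℝ :=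
        ∑ i, ∑ j, MvPolynomial.C (l (Matrix.single i j 1)) * (nilLog n G) i j
      have hq : ∀ g : GL (Fin n) ℝ, ev g q = l (matLog (g : Matrix (Fin n) (Fin n) ℝ)) := by
        intro g
        have h1 : ∀ i j, ev g ((nilLog n G) i j) = matLog (g : Matrix (Fin n) (Fin n) ℝ) i j := by
          intro i j
          have := map_nilLog (ev g).mapMatrix n G
          rw [hG] at this
          exact congrFun (congrFun this i) j
        simp only [q, map_sum, map_mul, h1, hsum (matLog _)]
        refine Finset.sum_congr rfl fun i _ => Finset.sum_congr rfl fun j _ => ?_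
        congr 1
        exact (ev g).commutes _
      refine hl ?_
      rw [← hq]
      refine h' q fun g' ⟨x, hx⟩ => ?_
      rw [hq, hx, matLog_exp (hr x)]
      exact hle ⟨x, rfl⟩
    obtain ⟨x, hx⟩ := hlog
    refine ⟨x, ?_⟩
    rw [← exp_matLog ⟨n, hnil⟩]
    exact congrArg _ hx.symm

theorem exists_mat_eq_exp {r : 𝔤 →ₗ⁅ℝ⁆ Matrix (Fin n) (Fin n) ℝ} {hr : ∀ x, IsNilpotent (r x)}
    (g : (expGroup r hr).Carrier) : ∃ x, UnipotentGroup.mat g = NormedSpace.exp (r x) := g.2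

theorem exists_mem_expGroup (r : 𝔤 →ₗ⁅ℝ⁆ Matrix (Fin n) (Fin n) ℝ) (hr : ∀ x, IsNilpotent (r x))
    (x : 𝔤) : ∃ g : (expGroup r hr).Carrier, UnipotentGroup.mat g = NormedSpace.exp (r x) :=
  ⟨⟨(Matrix.isUnit_exp (r x)).unit, x, IsUnit.unit_spec _⟩, IsUnit.unit_spec _⟩

/-- A representation `f` of `𝔤` whose exponentials lie in a unipotent group `U` integrates to a
homomorphism `exp (r 𝔤) → U`, if `r` is faithful. -/
theorem exists_expGroup_hom (r : 𝔤 →ₗ⁅ℝ⁆ Matrix (Fin n) (Fin n) ℝ) (hr : ∀ x, IsNilpotent (r x))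
    (hi : Function.Injective r) (U : UnipotentGroup)
    (f : 𝔤 →ₗ⁅ℝ⁆ Matrix (Fin U.n) (Fin U.n) ℝ) (hf : ∀ x, IsNilpotent (f x))
    (hU : ∀ x, ∃ u : U.Carrier, UnipotentGroup.mat u = NormedSpace.exp (f x)) :
    ∃ φ : (expGroup r hr).Carrier →* U.Carrier, Continuous φ ∧
      ∀ g x, UnipotentGroup.mat g = NormedSpace.exp (r x) →
        UnipotentGroup.mat (φ g) = NormedSpace.exp (f x) := by
  choose u hu using hU
  have hUinj : Function.Injective (UnipotentGroup.mat : U.Carrier → _) :=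
    U.isEmbedding_val.injective
  obtain ⟨s, hs⟩ := (r : 𝔤 →ₗ[ℝ] Matrix (Fin n) (Fin n) ℝ).exists_leftInverse_of_injective
    (LinearMap.ker_eq_bot.2 hi)
  have hs' : ∀ x, s (r x) = x := fun x => LinearMap.congr_fun hs x
  let φ : (expGroup r hr).Carrier → U.Carrier := fun g => u (s (matLog (UnipotentGroup.mat g)))
  have hφ : ∀ g x, UnipotentGroup.mat g = NormedSpace.exp (r x) → φ g = u x := fun g x h => by
    show u (s (matLog (UnipotentGroup.mat g))) = u x
    have h2 : matLog (UnipotentGroup.mat g) = r x := by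
      rw [h]; exact matLog_exp (hr x)
    exact congrArg u ((congrArg s h2).trans (hs' x))
  refine ⟨MonoidHom.mk' φ fun g h => ?_, ?_, fun g x h => ?_⟩
  · obtain ⟨x, hx⟩ := exists_mat_eq_exp g
    obtain ⟨y, hy⟩ := exists_mat_eq_exp h
    obtain ⟨z, hz, hz'⟩ := exists_exp_mul_exp r f hr hf x y
    rw [hφ g x hx, hφ h y hy, hφ (g * h) z (by rw [hz, ← hx, ← hy]; rfl)]
    refine hUinj ?_
    rw [hu, hz', ← hu, ← hu]
    rfl
  · refine U.isEmbedding_val.continuous_iff.2 ?_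
    have h1 : (UnipotentGroup.mat ∘ φ) = fun g => NormedSpace.exp
        (((f : 𝔤 →ₗ[ℝ] Matrix (Fin U.n) (Fin U.n) ℝ).comp s) (matLog (UnipotentGroup.mat g))) :=
      funext fun g => hu _
    show Continuous (UnipotentGroup.mat ∘ φ)
    rw [h1]
    exact matrix_exp_continuous.comp ((LinearMap.continuous_of_finiteDimensional _).comp
      (continuous_matLog.comp (expGroup r hr).isEmbedding_val.continuous))
  · show UnipotentGroup.mat (φ g) = _
    rw [hφ g x h, hu]

end NilpotentReps

/-! ### The limit of the unipotent groups of the nilpotent quotients -/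

section NilCompletionFacts

variable {L : Type*} [LieRing L] [LieAlgebra ℝ L]

instance (k : ℕ) : IsModuleTopology ℝ (NilQuotient L k) := ⟨rfl⟩

/-- The projection of the pro-nilpotent completion to `L / γ_k`. -/
noncomputable def nilCoord (k : ℕ) : nilCompletion L →ₗ⁅ℝ⁆ NilQuotient L k where
  toFun x := x.1 k
  map_add' _ _ := rfl
  map_smul' _ _ := rfl
  map_lie' := rfl

theorem nilCompletion_ext {x y : nilCompletion L} (h : ∀ k, nilCoord k x = nilCoord k y) : x = y :=
  Subtype.ext (funext h)

theorem nilCompletion_proj (x : nilCompletion L) {i j : ℕ} (h : i ≤ j) :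
    NilQuotient.proj h (nilCoord j x) = nilCoord i x := by
  obtain ⟨y, hy⟩ := x.2 j
  rw [show nilCoord j x = _ from hy j le_rfl, show nilCoord i x = _ from hy i h,
    NilQuotient.proj_mk]

theorem mem_nilCompletion {x : NilProduct L}
    (hx : ∀ i j (h : i ≤ j), NilQuotient.proj h (x j) = x i) : x ∈ nilCompletion L := by
  intro k
  obtain ⟨y, hy⟩ := NilQuotient.mk_surjective k (x k)
  exact ⟨y, fun j hj => by rw [← hx j k hj, ← hy, NilQuotient.proj_mk]⟩

variable (L) in
/-- The canonical map to the pro-nilpotent completion, as a homomorphism. -/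
noncomputable def toNilCompletionHom : L →ₗ⁅ℝ⁆ nilCompletion L where
  toFun := toNilCompletion L
  map_add' _ _ := rfl
  map_smul' _ _ := rfl
  map_lie' := rfl

theorem continuous_nilCoord (k : ℕ) :
    Continuous (nilCoord k : nilCompletion L → NilQuotient L k) :=
  (continuous_apply (A := fun k => NilQuotient L k) k).comp continuous_subtype_val

theorem continuous_nilCompletion {T : Type*} [TopologicalSpace T] {f : T → nilCompletion L}
    (h : ∀ k, Continuous fun t => nilCoord k (f t)) : Continuous f :=
  Continuous.subtype_mk (continuous_pi (A := fun k => NilQuotient L k) h) _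

theorem denseRange_toNilCompletion : DenseRange (toNilCompletion L) := by
  intro x
  choose y hy using x.2
  have h : Tendsto (fun k => toNilCompletion L (y k)) atTop (𝓝 x) := by
    refine tendsto_subtype_rng.2 (tendsto_pi_nhds (A := fun k => NilQuotient L k) |>.2 fun j => ?_)
    refine tendsto_const_nhds.congr' ?_
    filter_upwards [eventually_ge_atTop j] with k hk
    exact hy k j hk
  exact mem_closure_of_tendsto h (Eventually.of_forall fun k => ⟨_, rfl⟩)

end NilCompletionFacts

section LimitGroup

attribute [local instance 100] LieRing.ofAssociativeRing

variable {L : Type*} [LieRing L] [LieAlgebra ℝ L]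
  {n : ℕ → ℕ} (r : ∀ k, NilQuotient L k →ₗ⁅ℝ⁆ Matrix (Fin (n k)) (Fin (n k)) ℝ)
  (hr : ∀ k x, IsNilpotent (r k x))

/-- The projections `L / γ_j → L / γ_i` integrate to the exponential groups. -/
theorem exists_transition (hi : ∀ k, Function.Injective (r k)) {i j : ℕ} (h : i ≤ j) :
    ∃ φ : (expGroup (r j) (hr j)).Carrier →* (expGroup (r i) (hr i)).Carrier, Continuous φ ∧
      ∀ g x, UnipotentGroup.mat g = NormedSpace.exp (r j x) →
        UnipotentGroup.mat (φ g) = NormedSpace.exp (r i (NilQuotient.proj h x)) :=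
  exists_expGroup_hom (r j) (hr j) (hi j) (expGroup (r i) (hr i))
    ((r i).comp (NilQuotient.proj h)) (fun _ => hr i _)
    (fun x => exists_mem_expGroup (r i) (hr i) (NilQuotient.proj h x))

theorem NilQuotient.proj_refl {L : Type*} [LieRing L] [LieAlgebra ℝ L] (k : ℕ)
    (x : NilQuotient L k) : NilQuotient.proj le_rfl x = x := by
  obtain ⟨y, rfl⟩ := NilQuotient.mk_surjective k x
  rfl

theorem NilQuotient.proj_proj {L : Type*} [LieRing L] [LieAlgebra ℝ L] {i j k : ℕ} (h : i ≤ j)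
    (h' : j ≤ k) (x : NilQuotient L k) :
    NilQuotient.proj h (NilQuotient.proj h' x) = NilQuotient.proj (h.trans h') x := by
  obtain ⟨y, rfl⟩ := NilQuotient.mk_surjective k x
  rfl

variable (hi : ∀ k, Function.Injective (r k))

/-- The inverse limit of the unipotent groups `exp (L / γ_k)`, formed in faithful
representations `r k` of the nilpotent quotients. -/
noncomputable def limitGroup : ProUnipotentGroup where
  ι := ℕ
  obj k := expGroup (r k) (hr k)
  map h := (exists_transition r hr hi h).choose
  continuous_map h := (exists_transition r hr hi h).choose_spec.1
  map_refl k g := by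
    obtain ⟨x, hx⟩ := exists_mat_eq_exp g
    refine (expGroup (r k) (hr k)).isEmbedding_val.injective ?_
    rw [(exists_transition r hr hi le_rfl).choose_spec.2 g x hx, hx, NilQuotient.proj_refl]
  map_map {i j k} h h' g := by
    obtain ⟨x, hx⟩ := exists_mat_eq_exp g
    refine (expGroup (r i) (hr i)).isEmbedding_val.injective ?_
    have h1 := (exists_transition r hr hi h').choose_spec.2 g x hx
    rw [(exists_transition r hr hi h).choose_spec.2 _ _ h1,
      (exists_transition r hr hi (h.trans h')).choose_spec.2 g x hx, NilQuotient.proj_proj]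

theorem limitGroup_mat_map {i j : ℕ} (h : i ≤ j) (g : (expGroup (r j) (hr j)).Carrier)
    {x : NilQuotient L j} (hx : UnipotentGroup.mat g = NormedSpace.exp (r j x)) :
    UnipotentGroup.mat (U := expGroup (r i) (hr i)) ((limitGroup r hr hi).map h g) =
      NormedSpace.exp (r i (NilQuotient.proj h x)) :=
  (exists_transition r hr hi h).choose_spec.2 g x hx

theorem exists_limitGroup_isExp (x : nilCompletion L) :
    ∃ g : (limitGroup r hr hi).Carrier,
      (limitGroup r hr hi).IsExp g fun k : ℕ => r k (nilCoord k x) := by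
  choose u hu using fun k => exists_mem_expGroup (r k) (hr k) (nilCoord k x)
  refine ⟨⟨u, fun (i j : ℕ) h => ?_⟩, hu⟩
  refine (expGroup (r i) (hr i)).isEmbedding_val.injective ?_
  refine (limitGroup_mat_map r hr hi h (u j) (hu j)).trans ?_
  exact (congrArg (fun y => NormedSpace.exp (r i y)) (nilCompletion_proj x h)).trans (hu i).symm

/-- The map from the pro-nilpotent completion to the Lie algebra of the limit group. -/
noncomputable def limitGroupLieHom : nilCompletion L →ₗ⁅ℝ⁆ (limitGroup r hr hi).lieAlgebra where
  toFun x := ⟨fun k : ℕ => r k (nilCoord k x), fun t => by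
    obtain ⟨g, hg⟩ := exists_limitGroup_isExp r hr hi (t • x)
    exact ⟨g, fun k : ℕ => (hg k).trans (congrArg _ ((r k).map_smul t (nilCoord k x)))⟩⟩
  map_add' x y := Subtype.ext (funext fun k : ℕ => (r k).map_add (nilCoord k x) (nilCoord k y))
  map_smul' t x := Subtype.ext (funext fun k : ℕ => (r k).map_smul t (nilCoord k x))
  map_lie' {x y} := Subtype.ext (funext fun k : ℕ => (r k).map_lie (nilCoord k x) (nilCoord k y))

theorem limitGroupLieHom_bijective : Function.Bijective (limitGroupLieHom r hr hi) := by
  refine ⟨fun x y h => nilCompletion_ext fun k => hi k ?_, fun X => ?_⟩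
  · exact congrFun (congrArg Subtype.val h) k
  · have h1 : ∀ k : ℕ, ∃ x, X.1 k = r k x := by
      intro k
      obtain ⟨x, hx⟩ := exists_mat_eq_exp (r := r k) (hr := hr k)
        ((ProUnipotentGroup.exp X).1 k)
      refine ⟨x, ?_⟩
      rw [ProUnipotentGroup.lieAlgebra_eq_matLog X k]
      exact (congrArg matLog hx).trans (matLog_exp (hr k x))
    choose x hx using h1
    have hcoord : ∀ k : ℕ, UnipotentGroup.mat (U := expGroup (r k) (hr k))
        ((ProUnipotentGroup.exp X).1 k) = NormedSpace.exp (r k (x k)) := fun k =>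
      (ProUnipotentGroup.coord_exp X k).trans (congrArg _ (hx k))
    refine ⟨⟨x, mem_nilCompletion fun (i j : ℕ) h => hi i ?_⟩,
      Subtype.ext (funext fun k => (hx k).symm)⟩
    refine eq_of_exp_eq (hr i _) (hr i _) ?_
    have h2 := limitGroup_mat_map r hr hi h _ (hcoord j)
    rw [← hcoord i, ← h2]
    exact congrArg (UnipotentGroup.mat (U := expGroup (r i) (hr i)))
      ((ProUnipotentGroup.exp X).2 i j h)

/-- The Lie algebra of the limit group is the pro-nilpotent completion. -/
noncomputable def limitGroupLieEquiv : nilCompletion L ≃ₗ⁅ℝ⁆ (limitGroup r hr hi).lieAlgebra :=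
  LieEquiv.ofBijective (limitGroupLieHom r hr hi) (limitGroupLieHom_bijective r hr hi)

theorem continuous_limitGroupLieEquiv : Continuous (limitGroupLieEquiv r hr hi) := by
  refine Continuous.subtype_mk (continuous_pi fun k : ℕ => ?_) _
  have h : Continuous (r k) := IsModuleTopology.continuous_of_linearMap
    (r k : NilQuotient L k →ₗ[ℝ] Matrix (Fin (n k)) (Fin (n k)) ℝ)
  exact h.comp (continuous_nilCoord k)

theorem continuous_limitGroupLieEquiv_symm : Continuous (limitGroupLieEquiv r hr hi).symm := by
  refine continuous_nilCompletion fun k => ?_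
  -- a linear left inverse of `r k` recovers the `k`-th coordinate
  obtain ⟨s, hs⟩ := (r k : NilQuotient L k →ₗ[ℝ] Matrix (Fin (n k)) (Fin (n k)) ℝ)
    |>.exists_leftInverse_of_injective (LinearMap.ker_eq_bot.2 (hi k))
  have h1 : ∀ X : (limitGroup r hr hi).lieAlgebra,
      nilCoord k ((limitGroupLieEquiv r hr hi).symm X) = s (X.1 k) := by
    intro X
    obtain ⟨x, rfl⟩ := (limitGroupLieEquiv r hr hi).surjective X
    refine (congrArg (nilCoord k) ((limitGroupLieEquiv r hr hi).symm_apply_apply x)).trans ?_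
    exact (LinearMap.congr_fun hs (nilCoord k x)).symm
  have := IsModuleTopology.toContinuousAdd ℝ (NilQuotient L k)
  have : ContinuousSMul ℝ (NilQuotient L k) := ModuleTopology.continuousSMul ℝ (NilQuotient L k)
  have : IsTopologicalAddGroup (NilQuotient L k) := IsModuleTopology.topologicalAddGroup ℝ _
  have h2 : Continuous s := LinearMap.continuous_of_finiteDimensional s
  simp only [h1]
  exact h2.comp ((continuous_apply k).comp continuous_subtype_val)

end LimitGroup

/-! ### Artin relations in unipotent groups -/

section AltProd

theorem map_altProd {M N : Type*} [Monoid M] [Monoid N] (φ : M →* N) (a b : M) (n : ℕ) :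
    φ (altProd a b n) = altProd (φ a) (φ b) n := by
  induction n generalizing a b with
  | zero => exact map_one φ
  | succ n ih => simp only [altProd, map_mul, ih]

theorem altProd_two_mul {M : Type*} [Monoid M] (a b : M) (m : ℕ) :
    altProd a b (2 * m) = (a * b) ^ m := by
  induction m with
  | zero => rw [Nat.mul_zero, pow_zero]; rfl
  | succ m ih =>
    rw [show 2 * (m + 1) = 2 * m + 1 + 1 by ring, altProd, altProd, ih, pow_succ', mul_assoc]

/-- In a nilpotent situation, the braid relation of odd length forces `g = h`: if `h - g` lies in
`N ^ s`, then modulo `N ^ (s + 1)` the alternating products of `n` factors are `g ^ n` plus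
`(n / 2) (h - g)` and `((n + 1) / 2) (h - g)`, respectively. -/
theorem eq_of_altProd_eq_of_odd {A : Type*} [Ring A] [Algebra ℝ A] {N : Submodule ℝ A} {K : ℕ}
    (hN : N * N ≤ N) (hK : N ^ K = ⊥) {g h : A} (hg : g - 1 ∈ N) (hh : h - 1 ∈ N) {n : ℕ}
    (hn : Odd n) (he : altProd g h n = altProd h g n) : g = h := by
  have hanti : ∀ s, N ^ (s + 2) ≤ N ^ (s + 1) := by
    intro s
    induction s with
    | zero => simpa [pow_two] using hN
    | succ s ih => rw [pow_succ N (s + 2), pow_succ N (s + 1)]; exact mul_le_mul_left ih N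
  have step : ∀ s, h - g ∈ N ^ (s + 1) → h - g ∈ N ^ (s + 2) := by
    intro s hd
    obtain ⟨d, rfl⟩ : ∃ d, h = g + d := ⟨h - g, (add_sub_cancel g h).symm⟩
    rw [add_sub_cancel_left] at hd ⊢
    set J := N ^ (s + 2) with hJ
    -- multiplication by elements of `N` carries `N ^ (s + 1)` into `J`, and `J` into itself
    have hl : ∀ a ∈ N, ∀ x ∈ N ^ (s + 1), a * x ∈ J := fun a ha x hx => by
      rw [hJ, pow_succ']; exact Submodule.mul_mem_mul ha hx
    have hr : ∀ a ∈ N, ∀ x ∈ N ^ (s + 1), x * a ∈ J := fun a ha x hx => by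
      rw [hJ, pow_succ]; exact Submodule.mul_mem_mul hx ha
    have hlJ : ∀ a, a - 1 ∈ N → ∀ x ∈ J, a * x ∈ J := fun a ha x hx => by
      have := J.add_mem (hl _ ha x (hanti s hx)) hx
      rwa [sub_mul, one_mul, sub_add_cancel] at this
    have hld : ∀ a, a - 1 ∈ N → a * d - d ∈ J := fun a ha => by
      have := hl _ ha d hd
      rwa [sub_mul, one_mul] at this
    have hpow : ∀ i : ℕ, d * g ^ i - d ∈ J := by
      intro i
      induction i with
      | zero => simp
      | succ i ih =>
        have h1 : d * g ^ (i + 1) - d =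
            (d * g ^ i - d) * (g - 1) + (d * g ^ i - d) + d * (g - 1) := by
          rw [pow_succ]; noncomm_ring
        rw [h1]
        exact J.add_mem (J.add_mem (hr _ hg _ (hanti s ih)) ih) (hr _ hg d hd)
    have key : ∀ i : ℕ, altProd g (g + d) i - g ^ i - ((i / 2 : ℕ) : ℝ) • d ∈ J ∧
        altProd (g + d) g i - g ^ i - (((i + 1) / 2 : ℕ) : ℝ) • d ∈ J := by
      intro i
      induction i with
      | zero => simp [altProd]
      | succ i ih =>
        obtain ⟨h1, h2⟩ := ih
        constructor
        · have h3 : altProd g (g + d) (i + 1) - g ^ (i + 1) - (((i + 1) / 2 : ℕ) : ℝ) • d =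
              g * (altProd (g + d) g i - g ^ i - (((i + 1) / 2 : ℕ) : ℝ) • d) +
              (((i + 1) / 2 : ℕ) : ℝ) • (g * d - d) := by
            simp only [altProd, pow_succ', mul_sub, mul_smul_comm, smul_sub]; abel
          rw [h3]
          exact J.add_mem (hlJ g hg _ h2) (J.smul_mem _ (hld g hg))
        · have h3 : altProd (g + d) g (i + 1) - g ^ (i + 1) - (((i + 1 + 1) / 2 : ℕ) : ℝ) • d =
              (g + d) * (altProd g (g + d) i - g ^ i - ((i / 2 : ℕ) : ℝ) • d) +
              ((i / 2 : ℕ) : ℝ) • ((g + d) * d - d) + (d * g ^ i - d) := by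
            rw [show (i + 1 + 1) / 2 = i / 2 + 1 by omega]
            push_cast
            simp only [altProd, pow_succ', mul_sub, mul_smul_comm, smul_sub, add_smul, one_smul]
            rw [add_mul g d (g ^ i)]
            abel
          rw [h3]
          exact J.add_mem (J.add_mem (hlJ _ hh _ h1) (J.smul_mem _ (hld _ hh))) (hpow i)
    obtain ⟨m, rfl⟩ := hn
    obtain ⟨h1, h2⟩ := key (2 * m + 1)
    have h3 := J.sub_mem h1 h2
    rw [he, show (2 * m + 1) / 2 = m by omega, show (2 * m + 1 + 1) / 2 = m + 1 by omega] at h3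
    have h4 : d = altProd (g + d) g (2 * m + 1) - g ^ (2 * m + 1) - ((m : ℕ) : ℝ) • d -
        (altProd (g + d) g (2 * m + 1) - g ^ (2 * m + 1) - ((m + 1 : ℕ) : ℝ) • d) := by
      push_cast
      rw [add_smul, one_smul]; abel
    rw [h4]
    exact h3
  have hall : ∀ s, h - g ∈ N ^ (s + 1) := by
    intro s
    induction s with
    | zero =>
      have := N.sub_mem hh hg
      rw [sub_sub_sub_cancel_right] at this
      simpa using this
    | succ s ih => exact step s ih
  have h1 := hall K
  rw [pow_succ, hK, Submodule.bot_mul] at h1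
  exact (sub_eq_zero.1 h1).symm

end AltProd

attribute [local instance 100] LieRing.ofAssociativeRing

namespace ProUnipotentGroup

variable {P : ProUnipotentGroup}

theorem commute_exp_of_lie_eq_zero {X Y : P.lieAlgebra} (h : ⁅X, Y⁆ = 0) :
    exp X * exp Y = exp Y * exp X := by
  refine ext_coord fun i => ?_
  have h1 : (X : P.Ambient) i * (Y : P.Ambient) i - (Y : P.Ambient) i * (X : P.Ambient) i = 0 :=
    congrFun (congrArg Subtype.val h) i
  have h2 : Commute ((X : P.Ambient) i) ((Y : P.Ambient) i) := sub_eq_zero.1 h1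
  rw [coord_mul, coord_mul, coord_exp, coord_exp, ← Matrix.exp_add_of_commute _ _ h2,
    ← Matrix.exp_add_of_commute _ _ h2.symm, add_comm]

theorem lie_log_eq_zero {g h : P.Carrier} (hc : g * h = h * g) : ⁅log g, log h⁆ = 0 := by
  refine Subtype.ext (funext fun i => ?_)
  have h1 : Commute (P.coord g i) (P.coord h i) := by
    rw [commute_iff_eq, ← coord_mul, hc, coord_mul]
  exact sub_eq_zero.2 (commute_matLog h1)

/-- An Artin relation of even length `2 m` is `(g h) ^ m = (h g) ^ m`; by the uniqueness of roots,
it says that `g` and `h` commute. -/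
theorem mul_comm_of_altProd_even {g h : P.Carrier} {n : ℕ} (hn : Even n) (h0 : n ≠ 0)
    (he : altProd g h n = altProd h g n) : g * h = h * g := by
  obtain ⟨m, rfl⟩ := hn.two_dvd
  rw [altProd_two_mul, altProd_two_mul] at he
  refine ext_coord fun i => ?_
  refine eq_of_pow_eq_of_unipotent (isNilpotent_coord_sub_one _ i) (isNilpotent_coord_sub_one _ i)
    (m := m) (by omega) ?_
  rw [← coord_pow, he, coord_pow]

variable (P) in
/-- The `i`-th component of the Lie algebra. -/
noncomputable def lieCoord (i : P.ι) :
    P.lieAlgebra →ₗ⁅ℝ⁆ Matrix (Fin (P.obj i).n) (Fin (P.obj i).n) ℝ where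
  toFun X := (X : P.Ambient) i
  map_add' _ _ := rfl
  map_smul' _ _ := rfl
  map_lie' := rfl

/-- An Artin relation of odd length says that `g = h`. -/
theorem eq_of_altProd_odd {g h : P.Carrier} {n : ℕ} (hn : Odd n)
    (he : altProd g h n = altProd h g n) : g = h := by
  refine ext_coord fun i => ?_
  obtain ⟨N, K, hN, hNN, hNK⟩ := exists_nil_submodule (P.lieCoord i)
    fun X => isNilpotent_lieAlgebra X i
  have hmem : ∀ g : P.Carrier, P.coord g i - 1 ∈ N := by
    intro g
    have h1 := matrix_exp_sub_one_mem hNN (hN (log g)) (isNilpotent_lieAlgebra (log g) i)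
    have h2 : NormedSpace.exp (P.lieCoord i (log g)) = P.coord g i :=
      exp_matLog (isNilpotent_coord_sub_one g i)
    rwa [h2] at h1
  let c : P.Carrier →* Matrix (Fin (P.obj i).n) (Fin (P.obj i).n) ℝ :=
    { toFun := fun g => P.coord g i, map_one' := rfl, map_mul' := fun _ _ => rfl }
  have h1 := congrArg c he
  rw [map_altProd, map_altProd] at h1
  exact eq_of_altProd_eq_of_odd hNN hNK (hmem g) (hmem h) hn h1

end ProUnipotentGroup

/-- A Lie algebra homomorphism to nilpotent matrices kills a term of the lower central series. -/
theorem exists_lowerCentralSeries_le_ker {L : Type*} [LieRing L] [LieAlgebra ℝ L] {n : ℕ}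
    (f : L →ₗ⁅ℝ⁆ Matrix (Fin n) (Fin n) ℝ) (hf : ∀ x, IsNilpotent (f x)) :
    ∃ k, ∀ y ∈ LieModule.lowerCentralSeries ℝ L L k, f y = 0 := by
  obtain ⟨N, K, hN, -, hNK⟩ := exists_nil_submodule f hf
  have h : ∀ j, ∀ y ∈ LieModule.lowerCentralSeries ℝ L L j, f y ∈ N ^ (j + 1) := by
    intro j
    induction j with
    | zero => intro y _; simpa using hN y
    | succ j ih =>
      have := lowerCentralSeries_succ_le (j := j)
        (N := (N ^ (j + 2)).comap (f : L →ₗ[ℝ] Matrix (Fin n) (Fin n) ℝ)) (fun a b hb => by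
          show f ⁅a, b⁆ ∈ N ^ (j + 2)
          rw [LieHom.map_lie, LieRing.of_associative_ring_bracket]
          refine sub_mem ?_ ?_
          · rw [pow_succ']; exact Submodule.mul_mem_mul (hN a) (ih b hb)
          · rw [pow_succ]; exact Submodule.mul_mem_mul (ih b hb) (hN a))
      exact fun y hy => this hy
  refine ⟨K, fun y hy => ?_⟩
  have h1 := h K y hy
  rw [pow_succ, hNK, Submodule.bot_mul] at h1
  exact h1

namespace LabelledGraph

variable {V : Type*} (Λ : LabelledGraph V)

/-! ### The Malcev completion of an Artin group -/

/-- Elements of a pro-unipotent group define a homomorphism from the Artin group as soon as their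
logarithms satisfy the relations in the Lie algebra. -/
theorem exists_artinGroup_hom {P : ProUnipotentGroup} (X : V → P.lieAlgebra)
    (hX : ∀ r ∈ Λ.lieRelators, FreeLieAlgebra.lift ℝ X r = 0) :
    ∃ η : Λ.ArtinGroup →* P.Carrier, ∀ v, η (Λ.gen v) = ProUnipotentGroup.exp (X v) := by
  have hrel : ∀ r ∈ Λ.artinRelators,
      FreeGroup.lift (fun v => ProUnipotentGroup.exp (X v)) r = 1 := by
    rintro _ ⟨v, w, hvw, rfl⟩
    rw [map_mul, map_inv, map_altProd, map_altProd, mul_inv_eq_one, FreeGroup.lift_apply_of,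
      FreeGroup.lift_apply_of]
    rcases Nat.even_or_odd (Λ.label s(v, w)) with he | ho
    · have h1 := hX _ (Or.inl ⟨v, w, hvw, he, rfl⟩)
      rw [LieHom.map_lie, FreeLieAlgebra.lift_of_apply, FreeLieAlgebra.lift_of_apply] at h1
      obtain ⟨m, hm⟩ := he.two_dvd
      rw [hm, altProd_two_mul, altProd_two_mul,
        ProUnipotentGroup.commute_exp_of_lie_eq_zero h1]
    · have h1 := hX _ (Or.inr ⟨v, w, hvw, ho, rfl⟩)
      rw [map_sub, FreeLieAlgebra.lift_of_apply, FreeLieAlgebra.lift_of_apply, sub_eq_zero] at h1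
      rw [h1]
  exact ⟨PresentedGroup.toGroup hrel, fun v => PresentedGroup.toGroup.of hrel⟩

/-- The logarithms of the images of the generators under a homomorphism to a pro-unipotent group
satisfy the relations: roots are unique in unipotent groups, so that an even relation says that
the images commute, and an odd one says that they are equal. -/
theorem lift_log_eq_zero {P : ProUnipotentGroup} (ρ : Λ.ArtinGroup →* P.Carrier) :
    ∀ r ∈ Λ.lieRelators,
      FreeLieAlgebra.lift ℝ (fun v => ProUnipotentGroup.log (ρ (Λ.gen v))) r = 0 := by
  have hrel : ∀ v w, Λ.graph.Adj v w → altProd (ρ (Λ.gen v)) (ρ (Λ.gen w)) (Λ.label s(v, w)) =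
      altProd (ρ (Λ.gen w)) (ρ (Λ.gen v)) (Λ.label s(v, w)) := by
    intro v w hvw
    have h1 : PresentedGroup.mk Λ.artinRelators (altProd (FreeGroup.of v) (FreeGroup.of w)
        (Λ.label s(v, w)) * (altProd (FreeGroup.of w) (FreeGroup.of v) (Λ.label s(v, w)))⁻¹) = 1 :=
      PresentedGroup.one_of_mem ⟨v, w, hvw, rfl⟩
    rw [map_mul, map_inv, mul_inv_eq_one, map_altProd, map_altProd] at h1
    have h2 := congrArg ρ h1
    rwa [map_altProd, map_altProd] at h2
  rintro _ (⟨v, w, hvw, he, rfl⟩ | ⟨v, w, hvw, ho, rfl⟩)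
  · rw [LieHom.map_lie, FreeLieAlgebra.lift_of_apply, FreeLieAlgebra.lift_of_apply]
    refine ProUnipotentGroup.lie_log_eq_zero
      (ProUnipotentGroup.mul_comm_of_altProd_even he ?_ (hrel v w hvw))
    have := Λ.two_le_label s(v, w) hvw
    omega
  · rw [map_sub, FreeLieAlgebra.lift_of_apply, FreeLieAlgebra.lift_of_apply, sub_eq_zero,
      ProUnipotentGroup.eq_of_altProd_odd ho (hrel v w hvw)]

variable {n : ℕ → ℕ} (r : ∀ k, NilQuotient (PresentedLie Λ.lieRelators) k →ₗ⁅ℝ⁆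
    Matrix (Fin (n k)) (Fin (n k)) ℝ) (hr : ∀ k x, IsNilpotent (r k x))
  (hi : ∀ k, Function.Injective (r k))

/-- A homomorphism `ρ` from the Artin group to a unipotent group `U` factors through the limit
group: the logarithms `log (ρ (g_v))` define a representation of the presented Lie algebra, which
factors through some nilpotent quotient and integrates to the exponential group of that quotient. -/
theorem limitGroup_exists_lift (U : UnipotentGroup) (ρ : Λ.ArtinGroup →* U.Carrier) :
    ∃ φ : (limitGroup r hr hi).Carrier →* U.Carrier, Continuous φ ∧
      ∀ g v, (limitGroup r hr hi).IsExp g (limitGroupLieEquiv r hr hi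
        (PresentedProLie.gen Λ.lieRelators v) : (limitGroup r hr hi).Ambient) →
        φ g = ρ (Λ.gen v) := by
  let f₀ := PresentedLie.lift _ (Λ.lift_log_eq_zero (U.toProHom.comp ρ))
  let f : PresentedLie Λ.lieRelators →ₗ⁅ℝ⁆ Matrix (Fin U.n) (Fin U.n) ℝ :=
    (U.toPro.lieCoord ()).comp f₀
  have hf : ∀ x, IsNilpotent (f x) := fun x =>
    ProUnipotentGroup.isNilpotent_lieAlgebra (f₀ x) ()
  have hU : ∀ x, ∃ u : U.Carrier, UnipotentGroup.mat u = NormedSpace.exp (f x) := fun x =>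
    ⟨(ProUnipotentGroup.exp (f₀ x)).1 (), ProUnipotentGroup.coord_exp (f₀ x) ()⟩
  have hgen : ∀ v, NormedSpace.exp (f (PresentedLie.gen _ v)) =
      UnipotentGroup.mat (ρ (Λ.gen v)) := by
    intro v
    have h1 : f₀ (PresentedLie.gen _ v) = ProUnipotentGroup.log (U.toProHom (ρ (Λ.gen v))) :=
      PresentedLie.lift_gen _ _ v
    have h2 := ProUnipotentGroup.coord_exp (f₀ (PresentedLie.gen _ v)) ()
    rw [h1, ProUnipotentGroup.exp_log, ← h1] at h2
    exact h2.symm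
  obtain ⟨k, hk⟩ := exists_lowerCentralSeries_le_ker f hf
  have hsurj := NilQuotient.mk_surjective (L := PresentedLie Λ.lieRelators) k
  obtain ⟨φ, hφ, hφexp⟩ := exists_expGroup_hom (r k) (hr k) (hi k) U (NilQuotient.lift f hk)
    (fun x => by obtain ⟨x, rfl⟩ := hsurj x; exact hf x)
    (fun x => by obtain ⟨x, rfl⟩ := hsurj x; exact hU x)
  let pr : (limitGroup r hr hi).Carrier →* (expGroup (r k) (hr k)).Carrier :=
    (Pi.evalMonoidHom (fun i => ((limitGroup r hr hi).obj i).Carrier) k).comp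
      (limitGroup r hr hi).toSubgroup.subtype
  have hpr : Continuous pr := (continuous_apply k).comp continuous_subtype_val
  refine ⟨φ.comp pr, hφ.comp hpr, fun g v hg => ?_⟩
  refine U.isEmbedding_val.injective ?_
  refine (hφexp (pr g) _ (hg k)).trans ?_
  exact hgen v

/-- A morphism from the limit group is determined by the images of the exponentials of the
generators: its differential is continuous, and the Lie algebra generated by the `X_v` is dense. -/
theorem limitGroup_hom_unique {U : UnipotentGroup}
    {φ ψ : (limitGroup r hr hi).Carrier →* U.Carrier} (hφ : Continuous φ) (hψ : Continuous ψ)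
    (h : ∀ v, φ (ProUnipotentGroup.exp (limitGroupLieEquiv r hr hi
        (PresentedProLie.gen Λ.lieRelators v))) = ψ (ProUnipotentGroup.exp
        (limitGroupLieEquiv r hr hi (PresentedProLie.gen Λ.lieRelators v)))) : φ = ψ := by
  let φ' := U.toProHom.comp φ
  let ψ' := U.toProHom.comp ψ
  have hφ' : Continuous φ' := U.continuous_toProHom.comp hφ
  have hψ' : Continuous ψ' := U.continuous_toProHom.comp hψ
  let e := limitGroupLieEquiv r hr hi
  let dφ := (ProUnipotentGroup.differential φ' hφ').comp e.toLieHom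
  let dψ := (ProUnipotentGroup.differential ψ' hψ').comp e.toLieHom
  have hL : ∀ y, dφ (toNilCompletion _ y) = dψ (toNilCompletion _ y) := by
    refine PresentedLie.hom_ext (f := dφ.comp (toNilCompletionHom _))
      (g := dψ.comp (toNilCompletionHom _)) fun v => ProUnipotentGroup.exp_injective ?_
    have h1 := ProUnipotentGroup.exp_differential φ' hφ' (e (PresentedProLie.gen Λ.lieRelators v))
    have h2 := ProUnipotentGroup.exp_differential ψ' hψ' (e (PresentedProLie.gen Λ.lieRelators v))
    exact h1.trans ((congrArg U.toProHom (h v)).trans h2.symm)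
  have hcφ : Continuous dφ := (ProUnipotentGroup.continuous_differential φ' hφ').comp
    (continuous_limitGroupLieEquiv r hr hi)
  have hcψ : Continuous dψ := (ProUnipotentGroup.continuous_differential ψ' hψ').comp
    (continuous_limitGroupLieEquiv r hr hi)
  have hall : ∀ x, dφ x = dψ x := fun x =>
    congrFun (denseRange_toNilCompletion.equalizer hcφ hcψ (funext hL)) x
  have heq : φ' = ψ' := ProUnipotentGroup.hom_eq_of_differential_eq hφ' hψ' fun X => by
    obtain ⟨x, rfl⟩ := e.surjective X
    exact hall x
  ext1 g
  exact U.toProHom_injective (DFunLike.congr_fun heq g)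

/-- The limit group is a Malcev completion of the Artin group, with the generators mapped to the
exponentials of the Lie algebra generators. -/
theorem exists_isMalcevCompletion_limitGroup :
    ∃ η : Λ.ArtinGroup →* (limitGroup r hr hi).Carrier, IsMalcevCompletion _ η ∧
      ∀ v, (limitGroup r hr hi).IsExp (η (Λ.gen v)) (limitGroupLieEquiv r hr hi
        (PresentedProLie.gen Λ.lieRelators v) : (limitGroup r hr hi).Ambient) := by
  let e := limitGroupLieEquiv r hr hi
  let F : PresentedLie Λ.lieRelators →ₗ⁅ℝ⁆ (limitGroup r hr hi).lieAlgebra :=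
    e.toLieHom.comp (toNilCompletionHom _)
  obtain ⟨η, hη⟩ := Λ.exists_artinGroup_hom (P := limitGroup r hr hi)
    (fun v => e (PresentedProLie.gen Λ.lieRelators v)) (fun s hs => by
      have h1 : FreeLieAlgebra.lift ℝ (fun v => e (PresentedProLie.gen Λ.lieRelators v)) =
          F.comp (PresentedLie.mkHom _) := FreeLieAlgebra.hom_ext fun v => by
        rw [FreeLieAlgebra.lift_of_apply]; rfl
      rw [h1, LieHom.comp_apply, PresentedLie.mkHom_eq_zero hs, map_zero])
  have hexp : ∀ v, (limitGroup r hr hi).IsExp (η (Λ.gen v)) (e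
      (PresentedProLie.gen Λ.lieRelators v) : (limitGroup r hr hi).Ambient) := fun v =>
    ProUnipotentGroup.exp_eq_iff.1 (hη v).symm
  refine ⟨η, fun U ρ => ?_, hexp⟩
  obtain ⟨φ, hφ, hφρ⟩ := Λ.limitGroup_exists_lift r hr hi U ρ
  refine ⟨φ, ⟨hφ, PresentedGroup.ext fun v => hφρ _ v (hexp v)⟩, fun ψ ⟨hψ, hψρ⟩ => ?_⟩
  refine Λ.limitGroup_hom_unique r hr hi hψ hφ fun v => ?_
  have h1 := hφρ _ v (hexp v)
  have h2 := DFunLike.congr_fun hψρ (Λ.gen v)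
  rw [← hη v, h1, ← h2]
  rfl

end LabelledGraph

/-! ### Functoriality of the pro-nilpotent completion -/

section NilCompletionMap

variable {L L' : Type*} [LieRing L] [LieAlgebra ℝ L] [LieRing L'] [LieAlgebra ℝ L']

theorem LieHom.map_mem_lowerCentralSeries (f : L →ₗ⁅ℝ⁆ L') (k : ℕ) :
    ∀ y ∈ LieModule.lowerCentralSeries ℝ L L k, f y ∈ LieModule.lowerCentralSeries ℝ L' L' k :=
  fun _ hy => LieIdeal.map_lowerCentralSeries_le k (LieIdeal.mem_map hy)

/-- The homomorphism of nilpotent quotients induced by a Lie homomorphism. -/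
noncomputable def NilQuotient.map (f : L →ₗ⁅ℝ⁆ L') (k : ℕ) :
    NilQuotient L k →ₗ⁅ℝ⁆ NilQuotient L' k :=
  NilQuotient.lift ((NilQuotient.mk L' k).comp f) fun y hy =>
    NilQuotient.mk_eq_zero.2 (f.map_mem_lowerCentralSeries k y hy)

/-- The homomorphism of pro-nilpotent completions induced by a Lie homomorphism. -/
noncomputable def nilCompletionMap (f : L →ₗ⁅ℝ⁆ L') : nilCompletion L →ₗ⁅ℝ⁆ nilCompletion L' where
  toFun x := ⟨fun k => NilQuotient.map f k (nilCoord k x), fun k => by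
    obtain ⟨y, hy⟩ := x.2 k
    exact ⟨f y, fun j hj => congrArg (NilQuotient.map f j) (hy j hj)⟩⟩
  map_add' x y := nilCompletion_ext fun k =>
    (NilQuotient.map f k).map_add (nilCoord k x) (nilCoord k y)
  map_smul' t x := nilCompletion_ext fun k => (NilQuotient.map f k).map_smul t (nilCoord k x)
  map_lie' {x y} := nilCompletion_ext fun k =>
    (NilQuotient.map f k).map_lie (nilCoord k x) (nilCoord k y)

theorem continuous_nilCompletionMap (f : L →ₗ⁅ℝ⁆ L') : Continuous (nilCompletionMap f) := by
  refine continuous_nilCompletion fun k => ?_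
  have := IsModuleTopology.toContinuousAdd ℝ (NilQuotient L' k)
  have : ContinuousSMul ℝ (NilQuotient L' k) := ModuleTopology.continuousSMul ℝ (NilQuotient L' k)
  have h : Continuous (NilQuotient.map f k) := IsModuleTopology.continuous_of_linearMap
    (NilQuotient.map f k : NilQuotient L k →ₗ[ℝ] NilQuotient L' k)
  exact h.comp (continuous_nilCoord k)

theorem nilCompletionMap_leftInverse {f : L →ₗ⁅ℝ⁆ L'} {g : L' →ₗ⁅ℝ⁆ L} (h : ∀ y, g (f y) = y)
    (x : nilCompletion L) : nilCompletionMap g (nilCompletionMap f x) = x := by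
  refine nilCompletion_ext fun k => ?_
  obtain ⟨y, hy⟩ := NilQuotient.mk_surjective k (nilCoord k x)
  show NilQuotient.map g k (NilQuotient.map f k (nilCoord k x)) = _
  rw [← hy]
  exact congrArg (NilQuotient.mk L k) (h y)

/-- Mutually inverse homomorphisms induce an isomorphism of the completions. -/
noncomputable def nilCompletionEquiv (f : L →ₗ⁅ℝ⁆ L') (g : L' →ₗ⁅ℝ⁆ L) (h : ∀ y, g (f y) = y)
    (h' : ∀ y, f (g y) = y) : nilCompletion L ≃ₗ⁅ℝ⁆ nilCompletion L' :=
  { nilCompletionMap f with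
    invFun := nilCompletionMap g
    left_inv := nilCompletionMap_leftInverse h
    right_inv := nilCompletionMap_leftInverse h' }

end NilCompletionMap

/-! ### A quadratic presentation -/

section Degree

attribute [local instance 100] LieRing.ofAssociativeRing

variable {X : Type*}

/-- In the free algebra, `[a, b]` is the difference of the distinct words `a b` and `b a`. -/
theorem lieDegree_lie_of {a b : X} (h : a ≠ b) :
    lieDegree ⁅FreeLieAlgebra.of ℝ a, FreeLieAlgebra.of ℝ b⁆ = 2 := by
  have h1 : FreeAlgebra.equivMonoidAlgebraFreeMonoid
      (FreeLieAlgebra.lift ℝ (FreeAlgebra.ι ℝ (X := X))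
        ⁅FreeLieAlgebra.of ℝ a, FreeLieAlgebra.of ℝ b⁆) =
      MonoidAlgebra.single (FreeMonoid.of a * FreeMonoid.of b) (1 : ℝ) -
        MonoidAlgebra.single (FreeMonoid.of b * FreeMonoid.of a) 1 := by
    rw [LieHom.map_lie, FreeLieAlgebra.lift_of_apply, FreeLieAlgebra.lift_of_apply,
      LieRing.of_associative_ring_bracket, map_sub, map_mul, map_mul]
    have h2 : ∀ c : X, FreeAlgebra.equivMonoidAlgebraFreeMonoid (FreeAlgebra.ι ℝ c) =
        MonoidAlgebra.single (FreeMonoid.of c) (1 : ℝ) := fun c =>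
      FreeAlgebra.lift_ι_apply _ c
    rw [h2, h2, MonoidAlgebra.single_mul_single, MonoidAlgebra.single_mul_single, mul_one]
  have hne : FreeMonoid.of b * FreeMonoid.of a ≠ FreeMonoid.of a * FreeMonoid.of b := fun he =>
    h (List.cons.inj he).1.symm
  classical
  rw [lieDegree, h1]
  refine le_antisymm (Finset.sup_le fun m hm => ?_) ?_
  · rw [Finsupp.mem_support_iff] at hm
    by_contra hlen
    refine hm ?_
    have h2 : FreeMonoid.of a * FreeMonoid.of b ≠ m := by rintro rfl; exact hlen le_rfl
    have h3 : FreeMonoid.of b * FreeMonoid.of a ≠ m := by rintro rfl; exact hlen le_rfl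
    simp [h2, h3]
  · have h2 : FreeMonoid.of a * FreeMonoid.of b ∈
        (MonoidAlgebra.single (FreeMonoid.of a * FreeMonoid.of b) (1 : ℝ) -
        MonoidAlgebra.single (FreeMonoid.of b * FreeMonoid.of a) 1).coeff.support := by
      simp [hne]
    exact Finset.le_sup (f := FreeMonoid.length) h2

theorem isQuadratic_lie_of {a b : X} (h : a ≠ b) :
    IsQuadratic ⁅FreeLieAlgebra.of ℝ a, FreeLieAlgebra.of ℝ b⁆ := by
  refine ⟨fun h0 => ?_, Submodule.subset_span ⟨_, Submodule.subset_span ⟨a, rfl⟩, _,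
    Submodule.subset_span ⟨b, rfl⟩, rfl⟩⟩
  have h1 := lieDegree_lie_of h
  rw [h0, lieDegree, map_zero, map_zero] at h1
  simp at h1

end Degree

namespace LabelledGraph

variable {V : Type*} (Λ : LabelledGraph V)

/-- The map `c` to the set of connected components of the graph formed by the odd edges; a function
that is constant along the odd edges factors through it. -/
theorem exists_oddComponents [Finite V] {T : Type*} (f : V → T)
    (hf : ∀ v w, Λ.graph.Adj v w → Odd (Λ.label s(v, w)) → f v = f w) :
    ∃ (m : ℕ) (c : V → Fin m) (f' : Fin m → T), Function.Surjective c ∧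
      (∀ v w, Λ.graph.Adj v w → Odd (Λ.label s(v, w)) → c v = c w) ∧ ∀ v, f' (c v) = f v := by
  let R : V → V → Prop := fun v w => Λ.graph.Adj v w ∧ Odd (Λ.label s(v, w))
  obtain ⟨m, ⟨e⟩⟩ := Finite.exists_equiv_fin (Quot R)
  refine ⟨m, fun v => e (Quot.mk R v),
    fun i => Quot.lift f (fun v w h => hf v w h.1 h.2) (e.symm i),
    e.surjective.comp Quot.mk_surjective,
    fun v w h1 h2 => congrArg e (Quot.sound ⟨h1, h2⟩), fun v => ?_⟩
  simp

/-- For a map `c` from the vertices to a set of classes: the brackets of the distinct classes of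
the endpoints of even edges. -/
def classRelators {m : ℕ} (c : V → Fin m) : Set (FreeLieAlgebra ℝ (Fin m)) :=
  {u | ∃ v w, Λ.graph.Adj v w ∧ Even (Λ.label s(v, w)) ∧ c v ≠ c w ∧
    u = ⁅FreeLieAlgebra.of ℝ (c v), FreeLieAlgebra.of ℝ (c w)⁆}

/-- Eliminating generators by means of the odd relations leaves quadratic relations only. -/
theorem exists_quadratic_presentation [Finite V] :
    ∃ (m : ℕ) (c : V → Fin m) (e : PresentedProLie (Λ.classRelators c) ≃ₗ⁅ℝ⁆
      PresentedProLie Λ.lieRelators), Continuous e ∧ Continuous e.symm := by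
  obtain ⟨m, c, x, hsurj, hc, hx⟩ := Λ.exists_oddComponents (PresentedLie.gen Λ.lieRelators)
    fun v w hvw ho => by
      have h1 := PresentedLie.mkHom_eq_zero (S := Λ.lieRelators) (Or.inr ⟨v, w, hvw, ho, rfl⟩)
      rwa [map_sub, sub_eq_zero] at h1
  have hF : ∀ u ∈ Λ.lieRelators,
      FreeLieAlgebra.lift ℝ (fun v => PresentedLie.gen (Λ.classRelators c) (c v)) u = 0 := by
    rintro _ (⟨v, w, hvw, he, rfl⟩ | ⟨v, w, hvw, ho, rfl⟩)
    · rw [LieHom.map_lie, FreeLieAlgebra.lift_of_apply, FreeLieAlgebra.lift_of_apply]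
      by_cases h : c v = c w
      · rw [h, lie_self]
      · have h1 := PresentedLie.mkHom_eq_zero (S := Λ.classRelators c) ⟨v, w, hvw, he, h, rfl⟩
        rwa [LieHom.map_lie] at h1
    · rw [map_sub, FreeLieAlgebra.lift_of_apply, FreeLieAlgebra.lift_of_apply, hc v w hvw ho,
        sub_self]
  have hG : ∀ u ∈ Λ.classRelators c, FreeLieAlgebra.lift ℝ x u = 0 := by
    rintro _ ⟨v, w, hvw, he, -, rfl⟩
    have h1 := PresentedLie.mkHom_eq_zero (S := Λ.lieRelators) (Or.inl ⟨v, w, hvw, he, rfl⟩)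
    rw [LieHom.map_lie] at h1
    rw [LieHom.map_lie, FreeLieAlgebra.lift_of_apply, FreeLieAlgebra.lift_of_apply, hx, hx]
    exact h1
  let F := PresentedLie.lift _ hF
  let G := PresentedLie.lift _ hG
  have hFG : ∀ y, F (G y) = y := PresentedLie.hom_ext (f := F.comp G) (g := LieHom.id) fun i => by
    obtain ⟨v, rfl⟩ := hsurj i
    show F (G _) = _
    rw [PresentedLie.lift_gen, hx, PresentedLie.lift_gen]
    rfl
  have hGF : ∀ y, G (F y) = y := PresentedLie.hom_ext (f := G.comp F) (g := LieHom.id) fun v => by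
    show G (F _) = _
    rw [PresentedLie.lift_gen, PresentedLie.lift_gen, hx]
    rfl
  exact ⟨m, c, nilCompletionEquiv G F hFG hGF, continuous_nilCompletionMap G,
    continuous_nilCompletionMap F⟩

/-- The Artin group has a Malcev completion whose Lie algebra has the expected presentation. -/
theorem exists_isMalcevCompletion [Finite V] :
    ∃ (P : ProUnipotentGroup) (η : Λ.ArtinGroup →* P.Carrier), IsMalcevCompletion P η ∧
      ∃ e : PresentedProLie Λ.lieRelators ≃ₗ⁅ℝ⁆ P.lieAlgebra, Continuous e ∧ Continuous e.symm ∧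
        ∀ v, P.IsExp (η (Λ.gen v)) (e (PresentedProLie.gen Λ.lieRelators v) : P.Ambient) := by
  obtain ⟨D, hD, hD1⟩ := PresentedLie.exists_derivation (S := Λ.lieRelators) (by
    rintro _ (⟨v, w, -, -, rfl⟩ | ⟨v, w, -, -, rfl⟩)
    · exact Or.inl ⟨v, w, rfl⟩
    · exact Or.inr ⟨v, w, rfl⟩)
  choose n r hi hr using exists_faithful_nilpotent_rep
    (x := PresentedLie.gen Λ.lieRelators) PresentedLie.generated D hD hD1
  obtain ⟨η, hη, hexp⟩ := Λ.exists_isMalcevCompletion_limitGroup r hr hi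
  exact ⟨_, η, hη, limitGroupLieEquiv r hr hi, continuous_limitGroupLieEquiv r hr hi,
    continuous_limitGroupLieEquiv_symm r hr hi, hexp⟩

end LabelledGraph

theorem mainTheorem9 {V : Type*} [Finite V] (Λ : LabelledGraph V) :
    (∃ (P : ProUnipotentGroup) (η : Λ.ArtinGroup →* P.Carrier), IsMalcevCompletion P η) ∧
    ∀ (P : ProUnipotentGroup) (η : Λ.ArtinGroup →* P.Carrier), IsMalcevCompletion P η →
      (∃ e : PresentedProLie Λ.lieRelators ≃ₗ⁅ℝ⁆ P.lieAlgebra,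
        Continuous e ∧ Continuous e.symm ∧
        ∀ v, P.IsExp (η (Λ.gen v)) (e (PresentedProLie.gen Λ.lieRelators v) : P.Ambient)) ∧
      IsQuadraticallyPresented P.lieAlgebra ∧
      PassesMorganTest P.lieAlgebra := by
  obtain ⟨P₀, η₀, h₀, e₀, he₀, he₀', hexp⟩ := Λ.exists_isMalcevCompletion
  refine ⟨⟨P₀, η₀, h₀⟩, fun P η hη => ?_⟩
  obtain ⟨e₁, he₁, he₁', hexp₁⟩ := h₀.exists_lieEquiv hη
  obtain ⟨m, c, e₂, he₂, he₂'⟩ := Λ.exists_quadratic_presentation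
  have hc : Continuous (e₀.trans e₁) := he₁.comp he₀
  have hc' : Continuous (e₀.trans e₁).symm := he₀'.comp he₁'
  have hS : ∀ u ∈ Λ.classRelators c, IsQuadratic u ∧ lieDegree u = 2 := by
    rintro _ ⟨v, w, -, -, h, rfl⟩
    exact ⟨isQuadratic_lie_of h, lieDegree_lie_of h⟩
  refine ⟨⟨e₀.trans e₁, hc, hc', fun v => hexp₁ _ _ (hexp v)⟩,
    ⟨m, _, fun u hu => (hS u hu).1, e₂.trans (e₀.trans e₁), hc.comp he₂, he₂'.comp hc'⟩,
    ⟨m, _, fun u hu => ?_, e₂.trans (e₀.trans e₁), hc.comp he₂, he₂'.comp hc'⟩⟩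
  rw [(hS u hu).2]
  omega
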